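/- **Setting.** Let $\mathcal G=(V,\mathcal B,E)$ be a Borel graph: $(V,\mathcal B)$ is a standard Borel space and $E\subseteq[V]^2$ is Borel for the $\sigma$-algebra on unordered pairs induced by $\mathcal B\times\mathcal B$. Assume that the maximum degree $\Delta=\Delta(\mathcal G)$ (the least uniform bound on the degrees) is finite. Let $\mathcal E=(E,\mathcal C,I_{\mathcal G})$ be the line graph ($\mathcal C$ is the inherited $\sigma$-algebra; distinct edges sharing a vertex are adjacent) and let $F_{\mathcal E}$ be its connectedness relation. Let $\nu$ be a Borel probability measure on $E$ that is $\mathcal E$-quasi-invariant (the $F_{\mathcal E}$-saturation of every $\nu$-null set is $\nu$-null). Let $\rho_\nu:F_{\mathcal E}\to(0,\infty)$ be a Radon–Nikodym cocycle of $\nu$, i.e. a Borel function with $\nu(g(C))=\int_C\rho_\nu(e,g(e))\,d\nu(e)$ for every Borel $C\subseteq E$ and every injective Borel $g:C\to E$ with $(e,g(e))\in F_{\mathcal E}$ for all $e\in C$. **Colorings.** A partial coloring is a partial Borel map $c$ from $E$ to $\{1,\dots,\Delta+1\}$, with Borel domain, giving different colors to different colored edges that share a vertex. Put $U_c=E\setminus\operatorname{dom}(c)$,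 and let $m_c(x)$ be the set of colors not used by $c$ on edges at $x$. **Chains.** A chain is a finite or infinite sequence $P=(e_0,e_1,\dots)$ of edges in which consecutive edges intersect. $P\sqsubseteq Q$ means that $P$ is a prefix of $Q$. A chain $P$ is *$c$-augmenting* if - it is non-empty and has no repeated edge, $e_0\in U_c$, and all its other edges are colored; - the shift $c_P$ is again a partial coloring, where $c_P(e_i)=c(e_{i+1})$, the last edge of $P$ (if any) is uncolored, and $c_P=c$ off $P$; - $P$ is infinite, or $m_{c_P}(x)\cap m_{c_P}(y)\ne\emptyset$ for the vertices $x\neq y$ of its last edge. **Alternating paths.** For colors $\alpha\ne\beta$ and a vertex $x$ with $\beta\in m_c(x)$, let $P_c(x,\alpha/\beta)$ be the unique maximal chain $(e_0,e_1,\dots)$ without repeated edges such that $x\in e_0$, $x\notin e_1$ (when these edges exist), $c(e_i)=\alpha$ for even $i$ and $c(e_i)=\beta$ for odd $i$. **Fans.** For $x\in e$, a fan around $x$ starting at $e$ is a chain $(e_0,e_1,\dots)$ of distinct edges $e_i=\{x,v_i\}$ with $e_0=e$ such that $c(e_{i+1})=\min m_c(v_i)$ for all $i$ for which $e_{i+1}$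 exists. For $e\in U_c$, $F_c(x,e)$ is the maximal such fan. If $f$ is an edge of $P_c(x,\alpha/\beta)$ that is neither first nor last, and $y$ is the vertex of $f$ not on the preceding edge of the path, then $F_c(x,\alpha/\beta,y)$ is the maximal fan around $y$ starting at $f$ such that $\alpha,\beta\notin m_c(u)$ for the outer vertex $u$ of every edge other than the last one. **3-step Vizing chains.** For $e\in U_c$, a 3-step Vizing chain at $e$ is a $c$-augmenting chain of the form $$W=F^1{}^\frown P^1{}^\frown F^2{}^\frown P^2{}^\frown F^3{}^\frown P^3,$$ in which everything to the right of an empty or infinite piece is empty, and for which there are vertices $y_i,z_i$ and colors $\alpha_i,\beta_i$ ($i=1,2,3$), those $y_i,z_i$ with $F^i\neq\emptyset$, respectively $P^i\ne\emptyset$, being pairwise different, such that for the non-empty pieces $F^1\sqsubseteq F_c(y_1,e)$, $F^{i+1}\sqsubseteq F_c(z_i,\alpha_i/\beta_i,y_{i+1})$ for $i=1,2$, and $P^i\sqsubseteq P_c(z_i,\alpha_i/\beta_i)$ for $i=1,2,3$. For $L\in\mathbb N$, $c$ *does not admit an improvement of weight $L$* if $\nu$-almost no $e\in U_c$ has a 3-step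 Vizing chain $W$ at $e$ with $\sum_{f\in W}\rho_\nu(e,f)\le L$. **Theorem.** In the setting above, assume that $\rho_\nu(e,f)\le 8\Delta$ for all adjacent $e,f$ in the line graph. Let $L\in\mathbb N$ satisfy $\log_{8\Delta}(L)\ge(8\Delta)^{20}$, and let $c$ be a partial coloring that does not admit an improvement of weight $L$. Then $$\nu(U_c)\le\frac{64\,(4\Delta)^7(\Delta!)^{14}}{\bigl(\log_{8\Delta}(L)\bigr)^2\,L}.$$ -/

import Mathlib

open MeasureTheory

namespace MeasurableVizing

/-! ### Radon-Nikodym cocycles -/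

section Measure

variable {X : Type*} [MeasurableSpace X]

/-- `ν` is quasi-invariant for the relation `F`: the `F`-saturation of a null set is null. -/
def IsQuasiInvariant (F : X → X → Prop) (ν : Measure X) : Prop :=
  ∀ A : Set X, MeasurableSet A → ν A = 0 → ν {x | ∃ a ∈ A, F a x} = 0

/-- `ρ` is a Radon-Nikodym cocycle of `ν` with respect to the equivalence relation `F`: a Borel
function on `F` with values in `(0, ∞)` such that `ν (g(C)) = ∫_C ρ(x, g(x)) dν(x)` for every Borel
set `C` and every injective Borel map `g` on `C` with `(x, g(x)) ∈ F`. (A Borel map on `C` is the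
restriction of a Borel map on `X`. The values of `ρ` off `F` are never used.) -/
structure IsRadonNikodymCocycle (F : X → X → Prop) (ν : Measure X) (ρ : X → X → ℝ) : Prop where
  measurable : Measurable fun p : {p : X × X // F p.1 p.2} => ρ p.1.1 p.1.2
  pos : ∀ x y, F x y → 0 < ρ x y
  transport : ∀ (C : Set X) (g : X → X), MeasurableSet C → Measurable g → Set.InjOn g C →
    (∀ x ∈ C, F x (g x)) → ν (g '' C) = ∫⁻ x in C, ENNReal.ofReal (ρ x (g x)) ∂ν

end Measure

/-! ### Borel graphs and partial edge colorings -/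

section Graph

variable {V : Type*}

/-- `d` is the maximum degree `Δ(G)`: the least uniform (finite) bound on the degrees. -/
def IsMaxDegree (G : SimpleGraph V) (d : ℕ) : Prop :=
  IsLeast {d : ℕ | ∀ v, (G.neighborSet v).encard ≤ d} d

variable {G : SimpleGraph V} {k : ℕ}

/-- A partial map from edges to `k` colors (`none` means uncolored) is proper if different colored
edges that share a vertex get different colors. -/
def IsProper (c : G.edgeSet → Option (Fin k)) : Prop :=
  ∀ e f, G.lineGraph.Adj e f → ∀ a, c e = some a → c f ≠ some a

/-- A partial (Borel proper edge) coloring. The σ-algebra on `G.edgeSet` is the one inherited from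
the quotient σ-algebra on unordered pairs. Borel domain follows from Borel color classes. -/
structure IsPartialColoring [MeasurableSpace V] (c : G.edgeSet → Option (Fin k)) : Prop where
  measurable : ∀ a, MeasurableSet {e | c e = some a}
  proper : IsProper c

/-- The set `U_c` of uncolored edges. -/
def uncolored (c : G.edgeSet → Option (Fin k)) : Set G.edgeSet := {e | c e = none}

/-- The set `m_c(x)` of colors missing at `x`. -/
def missing (c : G.edgeSet → Option (Fin k)) (x : V) : Set (Fin k) :=
  {a | ∀ e : G.edgeSet, x ∈ e.1 → c e ≠ some a}

/-! ### Chains -/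

/-- Finite or infinite sequences of edges. -/
abbrev EdgeSeq (G : SimpleGraph V) := Stream'.Seq G.edgeSet

/-- `P ⊑ Q`: the sequence `P` is a prefix of `Q`. -/
def IsPrefix (P Q : EdgeSeq G) : Prop := ∀ n e, P.get? n = some e → Q.get? n = some e

/-- Consecutive edges intersect. -/
def IsChain (P : EdgeSeq G) : Prop :=
  ∀ n e f, P.get? n = some e → P.get? (n + 1) = some f → ∃ v, v ∈ e.1 ∧ v ∈ f.1

/-- No edge is repeated. -/
def EdgeInjective (P : EdgeSeq G) : Prop :=
  ∀ i j e, P.get? i = some e → P.get? j = some e → i = j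

/-- A `c`-shiftable chain: non-empty, edge injective, the first edge is its unique uncolored edge. -/
structure IsShiftable (c : G.edgeSet → Option (Fin k)) (P : EdgeSeq G) : Prop where
  chain : IsChain P
  injective : EdgeInjective P
  first : ∃ e, P.get? 0 = some e ∧ c e = none
  rest : ∀ n e, P.get? (n + 1) = some e → c e ≠ none

open Classical in
/-- The shift `c_P` of `c` along `P = (e_i)_i` (used for edge injective `P`): `e_i` receives the
color of `e_(i+1)`, the last edge of `P` (if there is one) becomes uncolored, and the edges outside
`P` keep their status. -/
noncomputable def shift (c : G.edgeSet → Option (Fin k)) (P : EdgeSeq G) :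
    G.edgeSet → Option (Fin k) := fun f =>
  if h : ∃ i, P.get? i = some f then (P.get? (Nat.find h + 1)).bind c else c f

/-- `P` is `c`-augmenting: it is shiftable, the shift `c_P` is again a partial coloring, and `P` is
infinite or some color is missing for `c_P` at both vertices of the last edge of `P`. (The shift
changes `c` on countably many edges only, so that its being Borel is automatic.) -/
structure IsAugmenting (c : G.edgeSet → Option (Fin k)) (P : EdgeSeq G) : Prop where
  shiftable : IsShiftable c P
  proper : IsProper (shift c P)
  last : ∀ n e x y, P.get? n = some e → P.get? (n + 1) = none → e.1 = s(x, y) →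
    (missing (shift c P) x ∩ missing (shift c P) y).Nonempty

/-! ### Alternating paths and fans -/

/-- `P` is an edge injective chain that is empty or leaves `x` with its first edge, and whose
colors alternate `a, b, a, b, …`. -/
structure IsAlternating (c : G.edgeSet → Option (Fin k)) (x : V) (a b : Fin k) (P : EdgeSeq G) :
    Prop where
  chain : IsChain P
  injective : EdgeInjective P
  first : ∀ e, P.get? 0 = some e → x ∈ e.1
  second : ∀ e, P.get? 1 = some e → x ∉ e.1
  color : ∀ n e, P.get? n = some e → c e = some (if Even n then a else b)

/-- `P` is the (maximal) alternating path `P_c(x, a/b)`, where `a ≠ b` and `b` is missing at `x`. -/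
structure IsAlternatingPath (c : G.edgeSet → Option (Fin k)) (x : V) (a b : Fin k)
    (P : EdgeSeq G) : Prop where
  ne : a ≠ b
  missing : b ∈ missing c x
  alternating : IsAlternating c x a b P
  maximal : ∀ Q, IsAlternating c x a b Q → IsPrefix P Q → Q = P

/-- `P = (e_0, e_1, …)` is a fan around `x` starting at `e`: all edges contain `x`, `e_0 = e`, no
edge is repeated, and if `e_i = {x, v}`, then the color of `e_(i+1)` is the smallest color missing
at `v`. -/
structure IsFan (c : G.edgeSet → Option (Fin k)) (x : V) (e : G.edgeSet) (P : EdgeSeq G) :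
    Prop where
  center : ∀ n f, P.get? n = some f → x ∈ f.1
  first : P.get? 0 = some e
  injective : EdgeInjective P
  color : ∀ n f g v, P.get? n = some f → P.get? (n + 1) = some g → f.1 = s(x, v) →
    ∃ a, c g = some a ∧ IsLeast (missing c v) a

/-- `P` is the maximal fan `F_c(x, e)`. -/
structure IsMaximalFan (c : G.edgeSet → Option (Fin k)) (x : V) (e : G.edgeSet) (P : EdgeSeq G) :
    Prop where
  fan : IsFan c x e P
  maximal : ∀ Q, IsFan c x e Q → IsPrefix P Q → Q = P

/-- An `a/b`-conditional fan around `y` starting at `f`: a fan such that neither `a` nor `b` is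
missing at the outer vertex of any of its edges other than the last one. -/
structure IsConditionalFan (c : G.edgeSet → Option (Fin k)) (a b : Fin k) (y : V) (f : G.edgeSet)
    (P : EdgeSeq G) : Prop where
  fan : IsFan c y f P
  condition : ∀ n g u, P.get? n = some g → P.get? (n + 1) ≠ none → g.1 = s(y, u) →
    a ∉ missing c u ∧ b ∉ missing c u

/-- `P` is the maximal conditional fan `F_c(x, a/b, y)`: it starts at an edge `f` of the alternating
path `P_c(x, a/b)` that is neither its first nor its last edge, and it is centered at the last
vertex `y` of the initial segment of the path that ends with `f`, i.e. at the vertex of `f` that is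
not on the edge `g` preceding `f`. (A conditional fan whose last outer vertex misses `a` or `b` has
no proper extension, so maximality is a condition only if it misses neither.) -/
def IsMaximalConditionalFan (c : G.edgeSet → Option (Fin k)) (x : V) (a b : Fin k) (y : V)
    (P : EdgeSeq G) : Prop :=
  ∃ (A : EdgeSeq G) (n : ℕ) (g f : G.edgeSet), IsAlternatingPath c x a b A ∧
    A.get? n = some g ∧ A.get? (n + 1) = some f ∧ A.get? (n + 2) ≠ none ∧
    y ∈ f.1 ∧ y ∉ g.1 ∧
    IsConditionalFan c a b y f P ∧
    ∀ Q, IsConditionalFan c a b y f Q → IsPrefix P Q → Q = P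

/-! ### 3-step Vizing chains -/

/-- `W` is a 3-step Vizing chain at the uncolored edge `e`: a `c`-augmenting chain of the form
`F 0 ⌢ P 0 ⌢ F 1 ⌢ P 1 ⌢ F 2 ⌢ P 2`, where `F 0` is a prefix of the maximal fan at `e` around `y 0`,
`F (i+1)` is a prefix of the maximal conditional fan on the `i`-th alternating path, and `P i` is a
prefix of the alternating path `P_c(z i, α i/β i)`. Everything to the right of an empty or of an
infinite piece is empty. The vertices `y i`, `z i` of the pieces that occur are pairwise different;
those attached to an empty piece play no role. -/
def IsThreeStepVizingChain (c : G.edgeSet → Option (Fin k)) (e : G.edgeSet) (W : EdgeSeq G) :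
    Prop :=
  e ∈ uncolored c ∧ IsAugmenting c W ∧
  ∃ (F P : Fin 3 → EdgeSeq G) (y z : Fin 3 → V) (α β : Fin 3 → Fin k),
    W = (F 0).append ((P 0).append ((F 1).append ((P 1).append ((F 2).append (P 2))))) ∧
    -- the vertices in use are pairwise different
    (∀ i j, i ≠ j → F i ≠ .nil → F j ≠ .nil → y i ≠ y j) ∧
    (∀ i j, i ≠ j → P i ≠ .nil → P j ≠ .nil → z i ≠ z j) ∧
    (∀ i j, F i ≠ .nil → P j ≠ .nil → y i ≠ z j) ∧
    -- the fans
    (F 0 ≠ .nil → ∃ M, IsMaximalFan c (y 0) e M ∧ IsPrefix (F 0) M) ∧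
    (∀ i : Fin 2, F i.succ ≠ .nil → ∃ M,
      IsMaximalConditionalFan c (z i.castSucc) (α i.castSucc) (β i.castSucc) (y i.succ) M ∧
        IsPrefix (F i.succ) M) ∧
    -- the alternating paths
    (∀ i, P i ≠ .nil → ∃ M, IsAlternatingPath c (z i) (α i) (β i) M ∧ IsPrefix (P i) M) ∧
    -- nothing follows an empty or an infinite piece
    (∀ i, F i = .nil ∨ ¬ (F i).Terminates → P i = .nil) ∧
    (∀ i : Fin 2, P i.castSucc = .nil ∨ ¬ (P i.castSucc).Terminates → F i.succ = .nil)

/-- `c` does not admit an improvement of weight `L` (with respect to `ν` and the cocycle `ρ`):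
`ν`-almost no uncolored edge `e` has a 3-step Vizing chain `W` with `∑_{f ∈ W} ρ(e, f) ≤ L`. The sum
is finite or infinite, with value in `[0, ∞]`. -/
def AdmitsNoImprovement [MeasurableSpace V] (ν : Measure G.edgeSet) (ρ : G.edgeSet → G.edgeSet → ℝ)
    (c : G.edgeSet → Option (Fin k)) (L : ℕ) : Prop :=
  ν {e | e ∈ uncolored c ∧ ∃ W, IsThreeStepVizingChain c e W ∧
    ∑' f : {f // f ∈ W}, ENNReal.ofReal (ρ e f.1) ≤ (L : ENNReal)} = 0

end Graph

end MeasurableVizing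

open MeasurableVizing

namespace MeasurableVizing

/-! ### Moving the uncolored edge -/

section Coloring

variable {V : Type*} {G : SimpleGraph V} {k : ℕ}

/-! Almost every uncolored edge `e` is heavy: all its 3-step Vizing chains weigh more than `L`. The
cocycle grows by a factor of at most `D = 8Δ` per adjacent step, so a chain with at most `T` edges
weighs at most `D ^ T`, and this is at most `L / 2` for a `T` just below `log_D L` (`ae_isHeavy`).

From a heavy edge, chains are built as in the proof of Vizing's theorem. A fan has an augmenting
prefix, or an alternating path can be appended to one of its prefixes, and the chain with the whole
path is augmenting (`exists_first_fan`, `PathReady.isAugmenting`). Augmenting chains of this form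
are heavy and hence have more than `T` edges, so the path is long. It may be cut at most of its
first `M₁` positions and continued by a second fan and a second path (`exists_next_fan`): the number
of unsuitable positions is at most linear in the length of the chain before the path
(`card_goodCenter`). Cutting the second path at most of its first `M₂` positions gives a third path
for each such pair of positions. What precedes the third path has at most `T` edges and weighs at
most `L / 2`, so the edges that third paths can reach for this pair weigh at least `L / 2`
(`IsHeavy.exists_positions`). Summed over all pairs of positions, a heavy edge sends out mass at
least `M₁ M₂ L / 8`.

On the other side, no edge `f` receives much. For two given colors, a vertex lies on one alternating
component with at most two possible starts, and the start determines the position. Hence the number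
of triples of two positions and an edge `e` leading to `f` is bounded by a constant `K` that depends
on `Δ` only (`encard_chainStep_le`). Mass transport with the cocycle
(`IsRadonNikodymCocycle.exists_transport`) turns this into `M₁ M₂ L ν(U_c) ≤ 8 K`
(`measure_uncolored_le`). Both `M₁` and `M₂` can be chosen proportional to `log_D L`, whence the
square of the logarithm. -/

lemma isProper_iff {c : G.edgeSet → Option (Fin k)} :
    IsProper c ↔ ∀ e f : G.edgeSet, ∀ v, e ≠ f → v ∈ e.1 → v ∈ f.1 → ∀ a, c e = some a →
      c f ≠ some a := by
  constructor
  · intro h e f v hne he hf a ha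
    exact h e f (SimpleGraph.lineGraph_adj_iff_exists.2 ⟨hne, v, he, hf⟩) a ha
  · intro h e f hadj a ha
    obtain ⟨hne, v, he, hf⟩ := SimpleGraph.lineGraph_adj_iff_exists.1 hadj
    exact h e f v hne he hf a ha

lemma IsProper.eq_of_color {c : G.edgeSet → Option (Fin k)} (hc : IsProper c) {e f : G.edgeSet}
    {v : V} {a : Fin k} (he : v ∈ e.1) (hf : v ∈ f.1) (hea : c e = some a) (hfa : c f = some a) :
    e = f := by
  by_contra hne
  exact isProper_iff.1 hc e f v hne he hf a hea hfa

lemma edge_ne (e : G.edgeSet) {x y : V} (h : e.1 = s(x, y)) : x ≠ y := by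
  have := e.2
  rw [h] at this
  exact G.ne_of_adj this

open Classical in
/-- The coloring in which the uncolored edge `f` receives the color of `g` and `g` becomes
uncolored. -/
noncomputable def move (c : G.edgeSet → Option (Fin k)) (f g : G.edgeSet) :
    G.edgeSet → Option (Fin k) :=
  fun h => if h = g then none else if h = f then c g else c h

lemma move_right (c : G.edgeSet → Option (Fin k)) (f g : G.edgeSet) : move c f g g = none := by
  simp [move]

lemma move_left (c : G.edgeSet → Option (Fin k)) {f g : G.edgeSet} (h : f ≠ g) :
    move c f g f = c g := by
  simp [move, h]

lemma move_of_ne (c : G.edgeSet → Option (Fin k)) {f g h : G.edgeSet} (hf : h ≠ f) (hg : h ≠ g) :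
    move c f g h = c h := by
  simp [move, hf, hg]

lemma notMem_missing_iff {c : G.edgeSet → Option (Fin k)} {x : V} {a : Fin k} :
    a ∉ missing c x ↔ ∃ e : G.edgeSet, x ∈ e.1 ∧ c e = some a := by
  simp [missing]

section Move

variable {c : G.edgeSet → Option (Fin k)} {f g : G.edgeSet} {v a b : V} {γ : Fin k}

/-- The color `γ` of `g`, now on `f`, could clash only at the vertices of `f`: at `v` its only edge
was `g`, which has lost it, and at `a` it is missing. -/
lemma IsProper.move (hc : IsProper c) (hfv : f.1 = s(v, a))
    (hgv : g.1 = s(v, b)) (hg : c g = some γ) (hγ : γ ∈ missing c a) :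
    IsProper (move c f g) := by
  have key : ∀ h : G.edgeSet, h ≠ f → h ≠ g → ∀ w, w ∈ h.1 → w ∈ f.1 → c h ≠ some γ := by
    intro h hhf hhg w hwh hwf hh
    rw [hfv, Sym2.mem_iff] at hwf
    rcases hwf with rfl | rfl
    · exact hhg (hc.eq_of_color hwh (by simp [hgv]) hh hg)
    · exact hγ h hwh hh
  rw [isProper_iff]
  intro e h w hne he hh δ hδ hδ'
  have heg : e ≠ g := by rintro rfl; simp [move_right] at hδ
  have hhg : h ≠ g := by rintro rfl; simp [move_right] at hδ'
  by_cases hef : e = f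
  · subst hef
    rw [move_left _ heg, hg] at hδ
    rw [move_of_ne _ (Ne.symm hne) hhg, ← hδ] at hδ'
    exact key h hne.symm hhg w hh he hδ'
  · rw [move_of_ne _ hef heg] at hδ
    by_cases hhf : h = f
    · subst hhf
      rw [move_left _ hhg, hg] at hδ'
      rw [← hδ'] at hδ
      exact key e hef heg w he hh hδ
    · rw [move_of_ne _ hhf hhg] at hδ'
      exact hne (hc.eq_of_color he hh hδ hδ')

/-- At the common vertex the color merely passes from `g` to `f`, so no new color appears there. -/
lemma missing_subset_move_center (hgv : g.1 = s(v, b)) (hg : c g = some γ) :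
    missing c v ⊆ missing (move c f g) v := by
  intro δ hδ h hvh hh
  have hhg : h ≠ g := by rintro rfl; simp [move_right] at hh
  by_cases hhf : h = f
  · subst hhf
    rw [move_left _ hhg] at hh
    exact hδ g (by simp [hgv]) hh
  · rw [move_of_ne _ hhf hhg] at hh
    exact hδ h hvh hh

/-- By properness `g` was the only edge of color `γ` at its far end `b`, and `f` does not reach `b`.
-/
lemma color_mem_missing_move_end (hc : IsProper c) (hfv : f.1 = s(v, a)) (hgv : g.1 = s(v, b))
    (hne : f ≠ g) (hg : c g = some γ) : γ ∈ missing (move c f g) b := by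
  intro h hbh hh
  have hhg : h ≠ g := by rintro rfl; simp [move_right] at hh
  have hhf : h ≠ f := by
    rintro rfl
    rw [hfv, Sym2.mem_iff] at hbh
    rcases hbh with h1 | h1
    · exact edge_ne g hgv h1.symm
    · subst h1
      exact hne (Subtype.ext (hfv.trans hgv.symm))
  rw [move_of_ne _ hhf hhg] at hh
  exact hhg (hc.eq_of_color hbh (by simp [hgv]) hh hg)

end Move

/-! ### Shifting along finite chains -/

/-- The shift along a finite chain. -/
noncomputable def listShift (c : G.edgeSet → Option (Fin k)) (A : List G.edgeSet) :
    G.edgeSet → Option (Fin k) := shift c (Stream'.Seq.ofList A)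

lemma shift_of_get? {c : G.edgeSet → Option (Fin k)} {P : EdgeSeq G} (hP : EdgeInjective P) {i : ℕ}
    {f : G.edgeSet} (h : P.get? i = some f) : shift c P f = (P.get? (i + 1)).bind c := by
  classical
  have hex : ∃ i, P.get? i = some f := ⟨i, h⟩
  have : Nat.find hex = i := hP _ _ f (Nat.find_spec hex) h
  unfold shift
  rw [dif_pos hex, this]

lemma shift_of_forall_ne {c : G.edgeSet → Option (Fin k)} {P : EdgeSeq G} {f : G.edgeSet}
    (h : ∀ i, P.get? i ≠ some f) : shift c P f = c f := by
  classical
  unfold shift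
  rw [dif_neg (by simpa using h)]

lemma edgeInjective_ofList {A : List G.edgeSet} (hA : A.Nodup) :
    EdgeInjective (Stream'.Seq.ofList A) := by
  intro i j e hi hj
  rw [Stream'.Seq.ofList_get?] at hi hj
  obtain ⟨hi', hi⟩ := List.getElem?_eq_some_iff.1 hi
  obtain ⟨hj', hj⟩ := List.getElem?_eq_some_iff.1 hj
  exact (hA.getElem_inj_iff).1 (hi.trans hj.symm)

lemma listShift_getElem {c : G.edgeSet → Option (Fin k)} {A : List G.edgeSet} (hA : A.Nodup) {i : ℕ}
    {f : G.edgeSet} (h : A[i]? = some f) : listShift c A f = (A[i + 1]?).bind c := by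
  have := shift_of_get? (c := c) (edgeInjective_ofList hA) (i := i) (f := f)
    (by rw [Stream'.Seq.ofList_get?, h])
  rw [listShift, this, Stream'.Seq.ofList_get?]

lemma listShift_of_notMem {c : G.edgeSet → Option (Fin k)} {A : List G.edgeSet} {f : G.edgeSet}
    (h : f ∉ A) : listShift c A f = c f := by
  apply shift_of_forall_ne
  intro i hi
  rw [Stream'.Seq.ofList_get?] at hi
  exact h (List.mem_of_getElem? hi)

lemma listShift_singleton {c : G.edgeSet → Option (Fin k)} {e : G.edgeSet} (he : c e = none) :
    listShift c [e] = c := by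
  funext f
  by_cases hf : f = e
  · subst hf
    rw [listShift_getElem (by simp) (i := 0) (by simp), he]
    simp
  · rw [listShift_of_notMem (by simpa using hf)]

/-- Lengthening a chain by one edge is one `move`; this is what allows all statements about shifts
to be proved by induction along the chain. -/
lemma listShift_snoc {c : G.edgeSet → Option (Fin k)} {B : List G.edgeSet} {f g : G.edgeSet}
    (h : (B ++ [f] ++ [g]).Nodup) :
    listShift c (B ++ [f] ++ [g]) = move (listShift c (B ++ [f])) f g := by
  have hn : (B ++ [f]).Nodup := (List.nodup_append.1 h).1
  have hg : g ∉ B ++ [f] := by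
    intro hg
    exact (List.nodup_append.1 h).2.2 g hg g (by simp) rfl
  have hfg : f ≠ g := by rintro rfl; simp at hg
  funext e
  by_cases heg : e = g
  · subst heg
    rw [move_right, listShift_getElem h (i := B.length + 1) (by simp)]
    simp
  by_cases hef : e = f
  · subst hef
    rw [move_left _ hfg, listShift_getElem h (i := B.length) (by simp),
      listShift_of_notMem hg]
    simp
  rw [move_of_ne _ hef heg]
  by_cases heB : e ∈ B
  · obtain ⟨i, hi, rfl⟩ := List.getElem_of_mem heB
    have hl : i + 1 < (B ++ [f]).length := by simp; omega
    have h1 : (B ++ [f])[i]? = some B[i] := by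
      rw [List.getElem?_append_left hi, List.getElem?_eq_getElem hi]
    rw [listShift_getElem h (i := i), listShift_getElem hn h1, List.getElem?_append_left hl]
    rw [List.getElem?_append_left (by omega), h1]
  · rw [listShift_of_notMem (by simp [heB, hef, heg]), listShift_of_notMem (by simp [heB, hef])]

/-- `A` is a finite shiftable chain with last edge `f` whose shift is a proper coloring. -/
structure Shifted (c : G.edgeSet → Option (Fin k)) (A : List G.edgeSet) (f : G.edgeSet) : Prop where
  first : ∃ e l, A = e :: l ∧ c e = none ∧ ∀ g ∈ l, c g ≠ none
  last : ∃ B, A = B ++ [f]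
  nodup : A.Nodup
  chain : ∀ i e g, A[i]? = some e → A[i + 1]? = some g → ∃ v, v ∈ e.1 ∧ v ∈ g.1
  proper : IsProper (listShift c A)

namespace Shifted

variable {c : G.edgeSet → Option (Fin k)} {A : List G.edgeSet} {f g : G.edgeSet}

lemma mem_last (h : Shifted c A f) : f ∈ A := by
  obtain ⟨B, rfl⟩ := h.last
  simp

lemma listShift_last (h : Shifted c A f) : listShift c A f = none := by
  obtain ⟨B, rfl⟩ := h.last
  rw [listShift_getElem h.nodup (i := B.length) (by simp)]
  simp

lemma singleton (hc : IsProper c) (hf : c f = none) : Shifted c [f] f where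
  first := ⟨f, [], rfl, hf, by simp⟩
  last := ⟨[], rfl⟩
  nodup := by simp
  chain := by
    intro i e g h1 h2
    simp at h2
  proper := by rwa [listShift_singleton hf]

lemma listShift_append (h : Shifted c A f) (hg : g ∉ A) :
    listShift c (A ++ [g]) = move (listShift c A) f g := by
  obtain ⟨B, rfl⟩ := h.last
  refine listShift_snoc ?_
  rw [List.nodup_append]
  refine ⟨h.nodup, by simp, ?_⟩
  rintro a ha b hb rfl
  simp at hb
  exact hg (hb ▸ ha)

lemma append (h : Shifted c A f) (hg : g ∉ A) {v a b : V} {γ : Fin k} (hfv : f.1 = s(v, a))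
    (hgv : g.1 = s(v, b)) (hgγ : c g = some γ) (hγ : γ ∈ missing (listShift c A) a) :
    Shifted c (A ++ [g]) g where
  first := by
    obtain ⟨e, l, rfl, he, hl⟩ := h.first
    refine ⟨e, l ++ [g], by simp, he, ?_⟩
    intro x hx
    rcases List.mem_append.1 hx with hx | hx
    · exact hl x hx
    · simp at hx
      simp [hx, hgγ]
  last := ⟨A, rfl⟩
  nodup := by
    rw [List.nodup_append]
    refine ⟨h.nodup, by simp, ?_⟩
    rintro a ha b hb rfl
    simp at hb
    exact hg (hb ▸ ha)
  chain := by
    intro i e e' h1 h2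
    by_cases hi : i + 1 < A.length
    · rw [List.getElem?_append_left (by omega)] at h1
      rw [List.getElem?_append_left (by omega)] at h2
      exact h.chain i e e' h1 h2
    · obtain ⟨B, rfl⟩ := h.last
      have hlt : i + 1 < (B ++ [f] ++ [g]).length := (List.getElem?_eq_some_iff.1 h2).1
      have : i = B.length := by simp at hi hlt; omega
      subst this
      simp at h1 h2
      subst h1 h2
      exact ⟨v, by simp [hfv], by simp [hgv]⟩
  proper := by
    rw [h.listShift_append hg]
    refine h.proper.move hfv hgv (γ := γ) ?_ hγ
    rw [listShift_of_notMem hg, hgγ]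

end Shifted

lemma getElem?_take_seq {α : Type*} (P : Stream'.Seq α) (n i : ℕ) (h : i < n) :
    (P.take n)[i]? = P.get? i := by
  rw [Stream'.Seq.getElem?_take, if_pos h]

/-- A sequence that has arbitrarily long initial segments along which one can shift is augmenting if
it is infinite or if some color is missing at both vertices of its last edge after the shift. -/
lemma isAugmenting_of_take {c : G.edgeSet → Option (Fin k)} {P : EdgeSeq G}
    (h0 : P.get? 0 ≠ none)
    (h : ∀ n e, P.get? n = some e →
      ∃ m e', n ≤ m ∧ P.get? m = some e' ∧ Shifted c (P.take (m + 1)) e')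
    (hlast : ∀ n e, P.get? n = some e → P.get? (n + 1) = none → ∃ x y, e.1 = s(x, y) ∧
      (missing (listShift c (P.take (n + 1))) x ∩
        missing (listShift c (P.take (n + 1))) y).Nonempty) :
    IsAugmenting c P := by
  obtain ⟨e₀, he₀⟩ := Option.ne_none_iff_exists'.1 h0
  have hinj : EdgeInjective P := by
    have key : ∀ i j e, i < j → P.get? i = some e → P.get? j = some e → False := by
      intro i j e hij hi hj
      obtain ⟨m, e', hjm, hm, hS⟩ := h j e hj
      have hn := hS.nodup
      have h1 := getElem?_take_seq P (m + 1) i (by omega)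
      have h2 := getElem?_take_seq P (m + 1) j (by omega)
      rw [hi] at h1
      rw [hj] at h2
      obtain ⟨hi', h1⟩ := List.getElem?_eq_some_iff.1 h1
      obtain ⟨hj', h2⟩ := List.getElem?_eq_some_iff.1 h2
      have := (hn.getElem_inj_iff).1 (h1.trans h2.symm)
      omega
    intro i j e hi hj
    rcases lt_trichotomy i j with hij | hij | hij
    · exact (key i j e hij hi hj).elim
    · exact hij
    · exact (key j i e hij hj hi).elim
  have hfirst : c e₀ = none := by
    obtain ⟨m, e', hjm, hm, hS⟩ := h 0 e₀ he₀
    obtain ⟨e, l, hl, he, -⟩ := hS.first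
    have h1 := getElem?_take_seq P (m + 1) 0 (by omega)
    rw [he₀] at h1
    rw [hl] at h1
    simp at h1
    rwa [← h1]
  -- The truncated shift uncolors the edge at position `m`, whereas the full shift may recolor it.
  -- All edges without an occurrence at position `m` or later have the same color in both.
  have hagree : ∀ m e' g, Shifted c (P.take (m + 1)) e' →
      (∀ i, P.get? i = some g → i < m) →
      shift c P g = listShift c (P.take (m + 1)) g := by
    intro n e g hS hg
    by_cases hex : ∃ i, P.get? i = some g
    · obtain ⟨i, hi⟩ := hex
      have hin := hg i hi
      rw [shift_of_get? hinj hi, listShift_getElem hS.nodup (i := i)]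
      · rw [getElem?_take_seq _ _ _ (by omega)]
      · rw [getElem?_take_seq _ _ _ (by omega), hi]
    · push Not at hex
      rw [shift_of_forall_ne hex, listShift_of_notMem]
      intro hmem
      obtain ⟨i, hi⟩ := List.getElem?_of_mem hmem
      have hlt : i < (P.take (n + 1)).length := (List.getElem?_eq_some_iff.1 hi).1
      have := Stream'.Seq.length_take_le (s := P) (n := n + 1)
      rw [getElem?_take_seq _ _ _ (by omega)] at hi
      exact hex i hi
  have hlt : ∀ n i g, P.get? (n + 1) = none → P.get? i = some g → i ≤ n := by
    intro n i g hn hi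
    by_contra hlt
    rw [Stream'.Seq.le_stable P (show n + 1 ≤ i by omega) hn] at hi
    simp at hi
  have hfin : ∀ n e, P.get? n = some e → P.get? (n + 1) = none →
      Shifted c (P.take (n + 1)) e ∧ shift c P = listShift c (P.take (n + 1)) := by
    intro n e he hn1
    obtain ⟨m, e', hjm, hm, hS⟩ := h n e he
    obtain rfl : m = n := le_antisymm (hlt n m e' hn1 hm) hjm
    obtain rfl : e = e' := by rw [he] at hm; exact Option.some.inj hm
    refine ⟨hS, ?_⟩
    funext g
    by_cases hge : g = e
    · subst hge
      rw [hS.listShift_last, shift_of_get? hinj he, hn1]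
      rfl
    · refine hagree m e g hS ?_
      intro i hi
      refine lt_of_le_of_ne (hlt m i g hn1 hi) ?_
      rintro rfl
      rw [he] at hi
      exact hge (Option.some.inj hi).symm
  refine ⟨⟨?_, hinj, ⟨e₀, he₀, hfirst⟩, ?_⟩, ?_, ?_⟩
  · intro n e f he hf
    obtain ⟨m, e', hjm, hm, hS⟩ := h (n + 1) f hf
    refine hS.chain n e f ?_ ?_
    · rw [getElem?_take_seq _ _ _ (by omega), he]
    · rw [getElem?_take_seq _ _ _ (by omega), hf]
  · intro n e he
    obtain ⟨m, e₁, hjm, hm, hS⟩ := h (n + 1) e he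
    obtain ⟨e', l, hl, -, hall⟩ := hS.first
    apply hall
    have h1 := getElem?_take_seq P (m + 1) (n + 1) (by omega)
    rw [hl, he] at h1
    simp at h1
    exact List.mem_of_getElem? h1
  · by_cases hterm : ∃ n, P.get? n = none
    · classical
      have hm := Nat.find_spec hterm
      obtain ⟨n, hn⟩ : ∃ n, Nat.find hterm = n + 1 := by
        apply Nat.exists_eq_succ_of_ne_zero
        intro h00
        rw [h00] at hm
        exact h0 hm
      rw [hn] at hm
      have hn' : P.get? n ≠ none := Nat.find_min hterm (by omega)
      obtain ⟨e, he⟩ := Option.ne_none_iff_exists'.1 hn'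
      obtain ⟨hS, heq⟩ := hfin n e he hm
      rw [heq]
      exact hS.proper
    · push Not at hterm
      rw [isProper_iff]
      intro e f v hne hev hfv a ha
      -- For an infinite chain, properness is tested on two edges at a time, and beyond the
      -- positions of both the shift agrees on them with a finite one.
      have hb : ∀ g, ∃ N, ∀ i, P.get? i = some g → i < N := by
        intro g
        by_cases hex : ∃ i, P.get? i = some g
        · obtain ⟨i, hi⟩ := hex
          refine ⟨i + 1, fun j hj => ?_⟩
          have := hinj i j g hi hj
          omega
        · push Not at hex
          exact ⟨0, fun j hj => (hex j hj).elim⟩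
      obtain ⟨N1, h1⟩ := hb e
      obtain ⟨N2, h2⟩ := hb f
      obtain ⟨e₁, he₁⟩ := Option.ne_none_iff_exists'.1 (hterm (max N1 N2))
      obtain ⟨m, e', hjm, hm, hS⟩ := h _ _ he₁
      have e1 := hagree m e' e hS
        (fun i hi => (h1 i hi).trans_le ((le_max_left _ _).trans hjm))
      have e2 := hagree m e' f hS
        (fun i hi => (h2 i hi).trans_le ((le_max_right _ _).trans hjm))
      rw [e1] at ha
      rw [e2]
      exact isProper_iff.1 hS.proper e f v hne hev hfv a ha
  · intro n e x y he hn hexy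
    obtain ⟨x', y', hexy', hne⟩ := hlast n e he hn
    rw [(hfin n e he hn).2]
    rw [hexy', Sym2.eq_iff] at hexy
    rcases hexy with ⟨rfl, rfl⟩ | ⟨rfl, rfl⟩
    · exact hne
    · rwa [Set.inter_comm]

lemma get?_append_ofList {α : Type*} (l : List α) (s : Stream'.Seq α) (n : ℕ) :
    ((Stream'.Seq.ofList l).append s).get? n =
      if n < l.length then l[n]? else s.get? (n - l.length) := by
  induction l generalizing n with
  | nil => simp
  | cons a l ih =>
    rw [Stream'.Seq.ofList_cons, Stream'.Seq.cons_append]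
    cases n with
    | zero => simp
    | succ n =>
      rw [Stream'.Seq.get?_cons_succ, ih]
      simp

lemma take_succ_of_get? {α : Type*} {s : Stream'.Seq α} {n : ℕ} {e : α} (h : s.get? n = some e) :
    s.take (n + 1) = s.take n ++ [e] := by
  have hlen : (s.take n).length = n := by
    apply le_antisymm Stream'.Seq.length_take_le
    by_contra hlt
    push Not at hlt
    have h1 : (s.take n)[(s.take n).length]? = none := by simp
    rw [getElem?_take_seq _ _ _ hlt] at h1
    rw [s.le_stable hlt.le h1] at h
    simp at h
  apply List.ext_getElem?
  intro i
  rw [Stream'.Seq.getElem?_take]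
  rcases lt_trichotomy i n with hi | rfl | hi
  · rw [if_pos (by omega), List.getElem?_append_left (by omega), getElem?_take_seq _ _ _ hi]
  · rw [if_pos (by omega), List.getElem?_append_right (by omega), hlen]
    simp [h]
  · rw [if_neg (by omega), List.getElem?_eq_none]
    simp [hlen]
    omega

lemma take_append_ofList {α : Type*} (l : List α) (s : Stream'.Seq α) (n : ℕ) :
    ((Stream'.Seq.ofList l).append s).take (l.length + n) = l ++ s.take n := by
  apply List.ext_getElem?
  intro i
  rw [Stream'.Seq.getElem?_take, get?_append_ofList]
  by_cases h : i < l.length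
  · rw [if_pos (by omega), if_pos h, List.getElem?_append_left h]
  · rw [if_neg h, List.getElem?_append_right (by omega), Stream'.Seq.getElem?_take]
    by_cases h' : i < l.length + n
    · rw [if_pos h', if_pos (by omega)]
    · rw [if_neg h', if_neg (by omega)]

end Coloring

/-! ### Alternating paths as sequences of vertices -/

section Path

variable {V : Type*} {G : SimpleGraph V} {k : ℕ}

open Classical in
/-- The neighbor of `v` along the edge of color `a`, and `v` if there is no such edge. -/
noncomputable def colorNbr (c : G.edgeSet → Option (Fin k)) (a : Fin k) (v : V) : V :=
  if h : ∃ w, ∃ e : G.edgeSet, e.1 = s(v, w) ∧ c e = some a then h.choose else v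

lemma exists_colorNbr {c : G.edgeSet → Option (Fin k)} {a : Fin k} {v : V} (h : a ∉ missing c v) :
    ∃ e : G.edgeSet, e.1 = s(v, colorNbr c a v) ∧ c e = some a := by
  obtain ⟨e, hv, he⟩ := notMem_missing_iff.1 h
  obtain ⟨w, hw⟩ := hv
  have hex : ∃ w, ∃ e : G.edgeSet, e.1 = s(v, w) ∧ c e = some a := ⟨w, e, hw, he⟩
  rw [colorNbr, dif_pos hex]
  exact hex.choose_spec

lemma colorNbr_eq {c : G.edgeSet → Option (Fin k)} (hc : IsProper c) {a : Fin k} {v w : V}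
    {e : G.edgeSet} (hvw : e.1 = s(v, w)) (he : c e = some a) : colorNbr c a v = w := by
  have h : a ∉ missing c v := notMem_missing_iff.2 ⟨e, by simp [hvw], he⟩
  obtain ⟨f, hf, hfa⟩ := exists_colorNbr h
  have := hc.eq_of_color (v := v) (by simp [hvw]) (by simp [hf]) he hfa
  subst this
  rw [hvw] at hf
  exact (Sym2.congr_right.1 hf).symm

/-- The color of the `n`-th edge of an alternating path. -/
def altColor (a b : Fin k) (n : ℕ) : Fin k := if Even n then a else b

lemma altColor_zero (a b : Fin k) : altColor a b 0 = a := by simp [altColor]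

lemma altColor_add_two (a b : Fin k) (n : ℕ) : altColor a b (n + 2) = altColor a b n := by
  simp [altColor, Nat.even_add]

lemma altColor_eq_or (a b : Fin k) (n : ℕ) : altColor a b n = a ∨ altColor a b n = b := by
  unfold altColor
  split_ifs <;> simp

lemma altColor_succ_ne {a b : Fin k} (h : a ≠ b) (n : ℕ) :
    altColor a b (n + 1) ≠ altColor a b n := by
  by_cases hn : Even n <;> simp [altColor, Nat.even_add_one, hn, h, h.symm]

lemma eq_altColor_or {a b κ : Fin k} (h : κ = a ∨ κ = b) (n : ℕ) :
    κ = altColor a b n ∨ κ = altColor a b (n + 1) := by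
  by_cases hn : Even n <;> simp [altColor, Nat.even_add_one, hn] <;> tauto

/-- The vertices of the alternating path that starts at `z`. -/
noncomputable def pathVertex (c : G.edgeSet → Option (Fin k)) (z : V) (a b : Fin k) : ℕ → V
  | 0 => z
  | n + 1 => colorNbr c (altColor a b n) (pathVertex c z a b n)

/-- The alternating path that starts at `z` has at least `n` edges. -/
def PathValid (c : G.edgeSet → Option (Fin k)) (z : V) (a b : Fin k) (n : ℕ) : Prop :=
  ∀ j < n, altColor a b j ∉ missing c (pathVertex c z a b j)

variable {c : G.edgeSet → Option (Fin k)} {z : V} {a b : Fin k}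

lemma PathValid.mono {m n : ℕ} (h : PathValid c z a b n) (hmn : m ≤ n) : PathValid c z a b m :=
  fun j hj => h j (hj.trans_le hmn)

lemma pathValid_zero : PathValid c z a b 0 := fun j hj => by omega

lemma PathValid.succ {n : ℕ} (h : PathValid c z a b n)
    (hn : altColor a b n ∉ missing c (pathVertex c z a b n)) : PathValid c z a b (n + 1) := by
  intro j hj
  rcases Nat.lt_succ_iff_lt_or_eq.1 hj with h1 | rfl
  · exact h j h1
  · exact hn

lemma PathValid.exists_edge {n : ℕ} (h : PathValid c z a b (n + 1)) :
    ∃ e : G.edgeSet, e.1 = s(pathVertex c z a b n, pathVertex c z a b (n + 1)) ∧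
      c e = some (altColor a b n) :=
  exists_colorNbr (h n (by omega))

/-- The edges of the alternating path that starts at `z`. -/
noncomputable def pathEdge {n : ℕ} (h : PathValid c z a b (n + 1)) : G.edgeSet :=
  h.exists_edge.choose

lemma pathEdge_val {n : ℕ} (h : PathValid c z a b (n + 1)) :
    (pathEdge h).1 = s(pathVertex c z a b n, pathVertex c z a b (n + 1)) :=
  h.exists_edge.choose_spec.1

lemma color_pathEdge {n : ℕ} (h : PathValid c z a b (n + 1)) :
    c (pathEdge h) = some (altColor a b n) :=
  h.exists_edge.choose_spec.2

lemma pathVertex_ne_succ {n : ℕ} (h : PathValid c z a b (n + 1)) :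
    pathVertex c z a b n ≠ pathVertex c z a b (n + 1) :=
  edge_ne _ (pathEdge_val h)

lemma colorNbr_pathVertex_succ (hc : IsProper c) {n : ℕ} (h : PathValid c z a b (n + 1)) :
    colorNbr c (altColor a b n) (pathVertex c z a b (n + 1)) = pathVertex c z a b n :=
  colorNbr_eq hc ((pathEdge_val h).trans Sym2.eq_swap) (color_pathEdge h)

/-- At a first return to an earlier vertex the arriving edge has one of the two colors, so by
properness it is the path edge after or before that vertex. Its other end is then an earlier
coincidence. At `z` only the color `a` is available, because `b` is missing. -/
lemma pathVertex_ne_of_lt (hc : IsProper c) (hab : a ≠ b) (hb : b ∈ missing c z) :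
    ∀ j i : ℕ, i < j → PathValid c z a b j → pathVertex c z a b i ≠ pathVertex c z a b j := by
  intro j
  induction j using Nat.strong_induction_on with
  | _ j ih =>
  intro i hij hv heq
  obtain ⟨j, rfl⟩ : ∃ m, j = m + 1 := ⟨j - 1, by omega⟩
  have hadj := colorNbr_pathVertex_succ hc hv
  rw [← heq] at hadj
  have hij' : i < j := by
    rcases Nat.lt_succ_iff_lt_or_eq.1 hij with h | rfl
    · exact h
    · exact (pathVertex_ne_succ hv heq).elim
  rcases eq_altColor_or (altColor_eq_or a b j) i with h1 | h1
  · -- the path leaves `X_i` by the same edge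
    rw [h1] at hadj
    change pathVertex c z a b (i + 1) = _ at hadj
    rcases Nat.lt_or_ge (i + 1) j with h2 | h2
    · exact ih j (by omega) (i + 1) h2 (hv.mono (by omega)) hadj
    · have : j = i + 1 := by omega
      subst this
      exact altColor_succ_ne hab i h1
  · rcases Nat.eq_zero_or_pos i with rfl | hi
    · have h0 : altColor a b (0 + 1) = b := by simp [altColor]
      rw [h0] at h1
      have hmem := color_pathEdge hv
      rw [h1] at hmem
      exact hb _ (by rw [pathEdge_val, ← heq]; simp [pathVertex]) hmem
    · obtain ⟨i, rfl⟩ : ∃ m, i = m + 1 := ⟨i - 1, by omega⟩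
      rw [altColor_add_two] at h1
      rw [h1, colorNbr_pathVertex_succ hc (hv.mono (by omega))] at hadj
      exact ih j (by omega) i (by omega) (hv.mono (by omega)) hadj

lemma pathVertex_inj (hc : IsProper c) (hab : a ≠ b) (hb : b ∈ missing c z) {i j : ℕ}
    (hi : PathValid c z a b i) (hj : PathValid c z a b j)
    (h : pathVertex c z a b i = pathVertex c z a b j) : i = j := by
  rcases lt_trichotomy i j with hij | hij | hij
  · exact (pathVertex_ne_of_lt hc hab hb j i hij hj h).elim
  · exact hij
  · exact (pathVertex_ne_of_lt hc hab hb i j hij hi h.symm).elim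

/-- The vertex `v` lies on the alternating path that starts at `z`. -/
def OnPath (c : G.edgeSet → Option (Fin k)) (z : V) (a b : Fin k) (v : V) : Prop :=
  ∃ n, PathValid c z a b n ∧ pathVertex c z a b n = v

/-- A vertex of an alternating path that misses one of the two colors is its first or its last
vertex. -/
lemma eq_start_or_end {n : ℕ} (hn : PathValid c z a b n) {κ : Fin k}
    (hκ : κ = a ∨ κ = b) (hm : κ ∈ missing c (pathVertex c z a b n)) :
    n = 0 ∨ altColor a b n ∈ missing c (pathVertex c z a b n) := by
  rcases Nat.eq_zero_or_pos n with h | h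
  · exact Or.inl h
  · right
    obtain ⟨n, rfl⟩ : ∃ m, n = m + 1 := ⟨n - 1, by omega⟩
    rcases eq_altColor_or hκ n with h1 | h1
    · exfalso
      exact hm _ (by rw [pathEdge_val hn]; simp) (h1 ▸ color_pathEdge hn)
    · rwa [← h1]

lemma end_unique {m n : ℕ}
    (hm : PathValid c z a b m) (hn : PathValid c z a b n)
    (hm' : altColor a b m ∈ missing c (pathVertex c z a b m))
    (hn' : altColor a b n ∈ missing c (pathVertex c z a b n)) : m = n := by
  rcases lt_trichotomy m n with h | h | h
  · exact (hn m h hm').elim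
  · exact h
  · exact (hm n h hn').elim

/-- Edges of the two colors do not leave an alternating path. -/
lemma OnPath.of_edge (hc : IsProper c) (hb : b ∈ missing c z) {v w : V}
    (hv : OnPath c z a b v) {e : G.edgeSet} (he : e.1 = s(v, w)) {κ : Fin k} (hκ : κ = a ∨ κ = b)
    (heκ : c e = some κ) : OnPath c z a b w := by
  obtain ⟨n, hn, rfl⟩ := hv
  have hnext : altColor a b n = κ → OnPath c z a b w := by
    intro h
    refine ⟨n + 1, hn.succ ?_, ?_⟩
    · rw [h]
      exact notMem_missing_iff.2 ⟨e, by simp [he], heκ⟩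
    · rw [pathVertex, h]
      exact colorNbr_eq hc he heκ
  rcases Nat.eq_zero_or_pos n with rfl | h
  · apply hnext
    rcases hκ with rfl | rfl
    · exact altColor_zero _ _
    · exact (hb e (by simp [he, pathVertex]) heκ).elim
  · obtain ⟨n, rfl⟩ : ∃ m, n = m + 1 := ⟨n - 1, by omega⟩
    rcases eq_altColor_or hκ n with h1 | h1
    · refine ⟨n, hn.mono (by omega), ?_⟩
      rw [← colorNbr_pathVertex_succ hc hn, ← h1]
      exact colorNbr_eq hc he heκ
    · exact hnext h1.symm

/-- Traced backwards from `v`, the second path uses only the colors `a` and `b`, and such edges do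
not leave the first path. -/
lemma OnPath.start_mem (hc : IsProper c) (hb : b ∈ missing c z) {z' v : V} {a' b' : Fin k}
    (ha' : a' = a ∨ a' = b) (hb' : b' = a ∨ b' = b) (hv : OnPath c z a b v)
    (hv' : OnPath c z' a' b' v) : OnPath c z a b z' := by
  obtain ⟨n, hn, rfl⟩ := hv'
  induction n with
  | zero => exact hv
  | succ n ih =>
    apply ih (hn.mono (by omega))
    refine hv.of_edge hc hb ((pathEdge_val hn).trans Sym2.eq_swap) ?_ (color_pathEdge hn)
    rcases altColor_eq_or a' b' n with h | h <;> rw [h] <;> assumption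

/-- The last vertex of an alternating path. -/
def IsPathEnd (c : G.edgeSet → Option (Fin k)) (z : V) (a b : Fin k) (v : V) : Prop :=
  ∃ n, PathValid c z a b n ∧ altColor a b n ∈ missing c (pathVertex c z a b n) ∧
    pathVertex c z a b n = v

lemma IsPathEnd.unique {v w : V}
    (hv : IsPathEnd c z a b v) (hw : IsPathEnd c z a b w) : v = w := by
  obtain ⟨n, hn, hn', rfl⟩ := hv
  obtain ⟨m, hm, hm', rfl⟩ := hw
  rw [end_unique hn hm hn' hm']

lemma OnPath.eq_or_isPathEnd {v : V} (hv : OnPath c z a b v) {κ : Fin k}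
    (hκ : κ = a ∨ κ = b) (hm : κ ∈ missing c v) : v = z ∨ IsPathEnd c z a b v := by
  obtain ⟨n, hn, rfl⟩ := hv
  rcases eq_start_or_end hn hκ hm with rfl | h
  · exact Or.inl rfl
  · exact Or.inr ⟨n, hn, h, rfl⟩

/-- Three vertices of an alternating component that miss one of its colors are not different. -/
lemma OnPath.eq_of_missing {v w : V}
    (hv : OnPath c z a b v) (hw : OnPath c z a b w) {κ μ : Fin k} (hκ : κ = a ∨ κ = b)
    (hμ : μ = a ∨ μ = b) (hvm : κ ∈ missing c v) (hwm : μ ∈ missing c w) :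
    v = z ∨ w = z ∨ v = w := by
  rcases hv.eq_or_isPathEnd hκ hvm with h | h
  · exact Or.inl h
  rcases hw.eq_or_isPathEnd hμ hwm with h' | h'
  · exact Or.inr (Or.inl h')
  exact Or.inr (Or.inr (h.unique h'))

open Classical in
/-- The alternating path that starts at `z` as a sequence of edges. -/
noncomputable def pathSeq (c : G.edgeSet → Option (Fin k)) (z : V) (a b : Fin k) : EdgeSeq G :=
  ⟨fun n => if h : PathValid c z a b (n + 1) then some (pathEdge h) else none, by
    intro n hn
    by_cases h : PathValid c z a b (n + 1 + 1)
    · have h' : PathValid c z a b (n + 1) := h.mono (by omega)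
      simp only [dif_pos h'] at hn
      exact absurd hn (by simp)
    · exact dif_neg h⟩

lemma pathSeq_get?_of_valid {n : ℕ} (h : PathValid c z a b (n + 1)) :
    (pathSeq c z a b).get? n = some (pathEdge h) := dif_pos h

lemma pathSeq_get?_of_not_valid {n : ℕ} (h : ¬ PathValid c z a b (n + 1)) :
    (pathSeq c z a b).get? n = none := dif_neg h

lemma pathSeq_get?_eq_some {n : ℕ} {e : G.edgeSet} (h : (pathSeq c z a b).get? n = some e) :
    ∃ hv : PathValid c z a b (n + 1), e = pathEdge hv := by
  by_cases hv : PathValid c z a b (n + 1)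
  · rw [pathSeq_get?_of_valid hv] at h
    exact ⟨hv, (Option.some.inj h).symm⟩
  · rw [pathSeq_get?_of_not_valid hv] at h
    simp at h

lemma pathEdge_inj (hc : IsProper c) (hab : a ≠ b) (hb : b ∈ missing c z) {i j : ℕ}
    (hi : PathValid c z a b (i + 1)) (hj : PathValid c z a b (j + 1))
    (h : pathEdge hi = pathEdge hj) : i = j := by
  have h1 := pathEdge_val hi
  rw [h, pathEdge_val hj, Sym2.eq_iff] at h1
  rcases h1 with ⟨h1, -⟩ | ⟨h1, h2⟩
  · exact (pathVertex_inj hc hab hb (hj.mono (by omega)) (hi.mono (by omega)) h1).symm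
  · have e1 := pathVertex_inj hc hab hb (hj.mono (by omega)) hi h1
    have e2 := pathVertex_inj hc hab hb hj (hi.mono (by omega)) h2
    omega

lemma isAlternating_pathSeq (hc : IsProper c) (hab : a ≠ b) (hb : b ∈ missing c z) :
    IsAlternating c z a b (pathSeq c z a b) where
  chain := by
    intro n e f he hf
    obtain ⟨h1, rfl⟩ := pathSeq_get?_eq_some he
    obtain ⟨h2, rfl⟩ := pathSeq_get?_eq_some hf
    exact ⟨pathVertex c z a b (n + 1), by simp [pathEdge_val], by simp [pathEdge_val]⟩
  injective := by
    intro i j e hi hj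
    obtain ⟨h1, rfl⟩ := pathSeq_get?_eq_some hi
    obtain ⟨h2, h⟩ := pathSeq_get?_eq_some hj
    exact pathEdge_inj hc hab hb h1 h2 h
  first := by
    intro e he
    obtain ⟨h1, rfl⟩ := pathSeq_get?_eq_some he
    rw [pathEdge_val]
    simp [pathVertex]
  second := by
    intro e he hz
    obtain ⟨h1, rfl⟩ := pathSeq_get?_eq_some he
    rw [pathEdge_val, Sym2.mem_iff] at hz
    rcases hz with h | h
    · exact pathVertex_ne_of_lt hc hab hb 1 0 (by omega) (h1.mono (by omega)) h
    · exact pathVertex_ne_of_lt hc hab hb 2 0 (by omega) h1 h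
  color := by
    intro n e he
    obtain ⟨h1, rfl⟩ := pathSeq_get?_eq_some he
    exact color_pathEdge h1

lemma isAlternatingPath_pathSeq (hc : IsProper c) (hab : a ≠ b) (hb : b ∈ missing c z) :
    IsAlternatingPath c z a b (pathSeq c z a b) where
  ne := hab
  missing := hb
  alternating := isAlternating_pathSeq hc hab hb
  maximal := by
    intro Q hQ hpre
    have key : ∀ n e, Q.get? n = some e → (pathSeq c z a b).get? n = some e := by
      intro n
      induction n with
      | zero =>
        intro e he
        have hcol := hQ.color 0 e he
        have hze := hQ.first e he
        rw [if_pos (by simp)] at hcol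
        have hv : PathValid c z a b (0 + 1) := by
          refine pathValid_zero.succ ?_
          rw [altColor_zero]
          exact notMem_missing_iff.2 ⟨e, hze, hcol⟩
        rw [pathSeq_get?_of_valid hv]
        congr 1
        refine hc.eq_of_color (v := z) (by rw [pathEdge_val]; simp [pathVertex]) hze
          (color_pathEdge hv) ?_
        rw [hcol, altColor_zero]
      | succ n ih =>
        intro e he
        obtain ⟨e', he'⟩ : ∃ e', Q.get? n = some e' := by
          rw [← Option.ne_none_iff_exists']
          intro hnone
          rw [Q.le_stable (Nat.le_succ n) hnone] at he
          simp at he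
        obtain ⟨hv, rfl⟩ := pathSeq_get?_eq_some (ih e' he')
        have hcol : c e = some (altColor a b (n + 1)) := hQ.color (n + 1) e he
        obtain ⟨v, hv1, hv2⟩ := hQ.chain n _ e he' he
        have hgood : pathVertex c z a b (n + 1) ∈ e.1 →
            (pathSeq c z a b).get? (n + 1) = some e := by
          intro hx
          have hv3 : PathValid c z a b (n + 1 + 1) :=
            hv.succ (notMem_missing_iff.2 ⟨e, hx, hcol⟩)
          rw [pathSeq_get?_of_valid hv3]
          congr 1
          exact hc.eq_of_color (by rw [pathEdge_val]; simp) hx (color_pathEdge hv3) hcol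
        rw [pathEdge_val, Sym2.mem_iff] at hv1
        -- If `Q` turned back to the previous vertex, properness would force it to repeat the edge
        -- before; for `n = 0` the field `second` forbids it.
        rcases hv1 with rfl | rfl
        · exfalso
          rcases Nat.eq_zero_or_pos n with rfl | h
          · exact hQ.second e he hv2
          · obtain ⟨m, rfl⟩ : ∃ m, n = m + 1 := ⟨n - 1, by omega⟩
            have hvm : PathValid c z a b (m + 1) := hv.mono (by omega)
            have : e = pathEdge hvm := by
              refine hc.eq_of_color hv2 (by rw [pathEdge_val]; simp) hcol ?_
              rw [altColor_add_two]
              exact color_pathEdge hvm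
            have hm := hpre m _ (pathSeq_get?_of_valid hvm)
            rw [← this] at hm
            have := hQ.injective _ _ e hm he
            omega
        · exact hgood hv2
    apply Stream'.Seq.ext
    intro n
    rcases h : Q.get? n with _ | e
    · rcases h' : (pathSeq c z a b).get? n with _ | e
      · rfl
      · rw [hpre n e h'] at h
        simp at h
    · rw [key n e h]

end Path

/-! ### Shifting along an alternating path -/

section Kempe

variable {V : Type*} {G : SimpleGraph V} {k : ℕ} {c : G.edgeSet → Option (Fin k)} {z y : V}
  {a b : Fin k} {A : List G.edgeSet}

/-- The first `n` edges of an alternating path. -/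
noncomputable def pathTake (c : G.edgeSet → Option (Fin k)) (z : V) (a b : Fin k) (n : ℕ) :
    List G.edgeSet := (pathSeq c z a b).take n

lemma pathTake_zero : pathTake c z a b 0 = [] := rfl

lemma pathTake_succ {n : ℕ} (h : PathValid c z a b (n + 1)) :
    pathTake c z a b (n + 1) = pathTake c z a b n ++ [pathEdge h] :=
  take_succ_of_get? (pathSeq_get?_of_valid h)

lemma mem_pathTake {n : ℕ} {e : G.edgeSet} (h : e ∈ pathTake c z a b n) :
    ∃ j, ∃ hv : PathValid c z a b (j + 1), j < n ∧ e = pathEdge hv := by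
  obtain ⟨j, hj⟩ := List.getElem?_of_mem h
  rw [pathTake, Stream'.Seq.getElem?_take] at hj
  split_ifs at hj with hjn
  obtain ⟨hv, he⟩ := pathSeq_get?_eq_some hj
  exact ⟨j, hv, hjn, he⟩

lemma length_pathTake {n : ℕ} (h : PathValid c z a b n) : (pathTake c z a b n).length = n := by
  induction n with
  | zero => rfl
  | succ n ih => rw [pathTake_succ h, List.length_append, ih (h.mono (by omega))]; rfl

/-- After the shift along `A`, whose last edge is `{y, z}`, the alternating path that starts at `z`
is as before, and its appending gives a chain along which one can shift. -/
structure PathReady (c : G.edgeSet → Option (Fin k)) (A : List G.edgeSet) (y z : V)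
    (a b : Fin k) : Prop where
  ne : a ≠ b
  missing : b ∈ missing c z
  shifted : ∃ f : G.edgeSet, f.1 = s(y, z) ∧ Shifted c A f
  left : a ∈ MeasurableVizing.missing (listShift c A) y
  right : b ∈ MeasurableVizing.missing (listShift c A) z
  avoid : ¬ OnPath c z a b y
  clean : ∀ v, OnPath c z a b v → ∀ h ∈ A, v ∈ h.1 → ∀ κ, κ = a ∨ κ = b →
    c h ≠ some κ ∧ listShift c A h ≠ some κ

/-- The vertex before the `n`-th one. -/
noncomputable def pathPrev (c : G.edgeSet → Option (Fin k)) (y z : V) (a b : Fin k) : ℕ → V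
  | 0 => y
  | n + 1 => pathVertex c z a b n

lemma OnPath.pathVertex {n : ℕ} (h : PathValid c z a b n) :
    OnPath c z a b (pathVertex c z a b n) := ⟨n, h, rfl⟩

/-- Invariants of the shift along `A` and the first `n` edges of the alternating path. -/
structure KempeState (c : G.edgeSet → Option (Fin k)) (A : List G.edgeSet) (y z : V)
    (a b : Fin k) (n : ℕ) (f : G.edgeSet) : Prop where
  val : f.1 = s(pathPrev c y z a b n, pathVertex c z a b n)
  shifted : Shifted c (A ++ pathTake c z a b n) f
  left : altColor a b n ∈ missing (listShift c (A ++ pathTake c z a b n)) (pathPrev c y z a b n)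
  right : altColor a b (n + 1) ∈
    missing (listShift c (A ++ pathTake c z a b n)) (pathVertex c z a b n)
  old : ∀ h ∈ A, h.1 ≠ s(y, z) → listShift c (A ++ pathTake c z a b n) h = listShift c A h
  new : ∀ h ∈ pathTake c z a b n, listShift c (A ++ pathTake c z a b n) h = none ∨
    listShift c (A ++ pathTake c z a b n) h = some a ∨
    listShift c (A ++ pathTake c z a b n) h = some b
  last : n = 0 ∧ f.1 = s(y, z) ∨ f ∈ pathTake c z a b n

lemma PathReady.notMem {n : ℕ} (R : PathReady c A y z a b) (h : PathValid c z a b (n + 1)) :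
    pathEdge h ∉ A := by
  intro hA
  exact (R.clean _ (OnPath.pathVertex (h.mono (Nat.le_succ n))) _ hA
    (by rw [pathEdge_val]; simp) _ (altColor_eq_or a b n)).1 (color_pathEdge h)

/-- Each step is one `move` of the uncolored edge `f` to the next path edge `g`. The color of `g` is
missing at the rear end of `f` by `left`. The color in `right` stays missing at the common vertex
and becomes the next `left`; the color that `g` gives up is missing at its far end and becomes the
next `right`. -/
lemma PathReady.kempeState (hc : IsProper c) (R : PathReady c A y z a b) (n : ℕ)
    (hn : PathValid c z a b n) : ∃ f, KempeState c A y z a b n f := by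
  induction n with
  | zero =>
    obtain ⟨f, hf, hS⟩ := R.shifted
    refine ⟨f, hf, ?_, ?_, ?_, ?_, ?_, Or.inl ⟨rfl, hf⟩⟩ <;>
      simp only [pathTake_zero, List.append_nil]
    · exact hS
    · rw [altColor_zero]
      exact R.left
    · have : altColor a b (0 + 1) = b := by simp [altColor]
      rw [this]
      exact R.right
    · simp
    · simp
  | succ n ih =>
    obtain ⟨f, S⟩ := ih (hn.mono (by omega))
    set g := pathEdge hn with hg
    have hgval := pathEdge_val hn
    have hgcol := color_pathEdge hn
    have hgA : g ∉ A := R.notMem hn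
    have hgT : g ∉ pathTake c z a b n := by
      intro hmem
      obtain ⟨j, hv, hj, he⟩ := mem_pathTake hmem
      have := pathEdge_inj hc R.ne R.missing hn hv he
      omega
    have hgl : g ∉ A ++ pathTake c z a b n := by simp [hgA, hgT]
    have hfg : f ≠ g := by
      rintro rfl
      exact hgl S.shifted.mem_last
    have hfval : f.1 = s(pathVertex c z a b n, pathPrev c y z a b n) := S.val.trans Sym2.eq_swap
    have hgcol' : listShift c (A ++ pathTake c z a b n) g = some (altColor a b n) := by
      rw [listShift_of_notMem hgl, hgcol]
    have hmove : listShift c (A ++ pathTake c z a b (n + 1)) =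
        move (listShift c (A ++ pathTake c z a b n)) f g := by
      rw [pathTake_succ hn, ← List.append_assoc, S.shifted.listShift_append hgl]
    have hSh : Shifted c (A ++ pathTake c z a b (n + 1)) g := by
      rw [pathTake_succ hn, ← List.append_assoc]
      exact S.shifted.append hgl hfval hgval hgcol S.left
    refine ⟨g, ?_, hSh, ?_, ?_, ?_, ?_, Or.inr ?_⟩
    · exact hgval
    · rw [hmove]
      exact missing_subset_move_center hgval hgcol' S.right
    · rw [hmove, altColor_add_two]
      exact color_mem_missing_move_end S.shifted.proper hfval hgval hfg hgcol'
    · intro h hA hne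
      rw [hmove, move_of_ne, S.old h hA hne]
      · rintro rfl
        rcases S.last with ⟨-, h1⟩ | h1
        · exact hne h1
        · obtain ⟨j, hv, -, he⟩ := mem_pathTake h1
          rw [he] at hA
          exact R.notMem hv hA
      · rintro rfl
        exact hgA hA
    · intro h hh
      rw [hmove]
      rw [pathTake_succ hn, List.mem_append, List.mem_singleton] at hh
      by_cases hhg : h = g
      · left
        rw [hhg, move_right]
      · by_cases hhf : h = f
        · rw [hhf, move_left _ hfg, hgcol']
          rcases altColor_eq_or a b n with h1 | h1 <;> simp [h1]
        · rw [move_of_ne _ hhf hhg]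
          exact S.new h (hh.resolve_right hhg)
    · rw [pathTake_succ hn]
      simp [hg]

/-- At the end of the path the next color is missing for `c`, and no shifted edge brings it there:
on `A` this is `clean`, or the edge `{y, z}`, and the only path edge at this vertex is the one now
uncolored. Together with `left` this makes the chain augmenting. -/
lemma PathReady.end_mem_missing (hc : IsProper c) (R : PathReady c A y z a b) {n : ℕ}
    {f : G.edgeSet} (S : KempeState c A y z a b n f)
    (hn : PathValid c z a b n) (hend : altColor a b n ∈ MeasurableVizing.missing c (pathVertex c z a b n)) :
    altColor a b n ∈ MeasurableVizing.missing (listShift c (A ++ pathTake c z a b n)) (pathVertex c z a b n) := by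
  intro h hv hh
  by_cases hA : h ∈ A
  · by_cases hyz : h.1 = s(y, z)
    · rw [hyz, Sym2.mem_iff] at hv
      rcases hv with hv | hv
      · exact R.avoid ⟨n, hn, hv⟩
      · have h0 : n = 0 := pathVertex_inj hc R.ne R.missing hn pathValid_zero hv
        subst h0
        have : h = f := Subtype.ext (hyz.trans S.val.symm)
        subst this
        rw [S.shifted.listShift_last] at hh
        simp at hh
    · rw [S.old h hA hyz] at hh
      exact (R.clean _ (OnPath.pathVertex hn) h hA hv _ (altColor_eq_or a b n)).2 hh
  · by_cases hT : h ∈ pathTake c z a b n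
    · obtain ⟨j, hj, hjn, rfl⟩ := mem_pathTake hT
      rw [pathEdge_val, Sym2.mem_iff] at hv
      rcases hv with hv | hv
      · have := pathVertex_inj hc R.ne R.missing hn (hj.mono (by omega)) hv
        omega
      · have := pathVertex_inj hc R.ne R.missing hn hj hv
        subst this
        have : pathEdge hj = f := Subtype.ext ((pathEdge_val hj).trans S.val.symm)
        rw [this, S.shifted.listShift_last] at hh
        simp at hh
    · rw [listShift_of_notMem (by simp [hA, hT])] at hh
      exact hend h hv hh

/-- Appending the whole alternating path gives an augmenting chain. -/
lemma PathReady.isAugmenting (hc : IsProper c) (R : PathReady c A y z a b) :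
    IsAugmenting c ((Stream'.Seq.ofList A).append (pathSeq c z a b)) := by
  obtain ⟨f₀, hf₀, hS₀⟩ := R.shifted
  have hlen : 0 < A.length := List.length_pos_of_mem hS₀.mem_last
  have hget : ∀ n e, ((Stream'.Seq.ofList A).append (pathSeq c z a b)).get? n = some e →
      A.length ≤ n + 1 → ∃ m, n + 1 = A.length + m ∧ PathValid c z a b m := by
    intro n e he hn
    refine ⟨n + 1 - A.length, by omega, ?_⟩
    rcases Nat.lt_or_ge n A.length with h | h
    · have : n + 1 - A.length = 0 := by omega
      rw [this]
      exact pathValid_zero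
    · rw [get?_append_ofList, if_neg (by omega)] at he
      obtain ⟨hv, -⟩ := pathSeq_get?_eq_some he
      exact hv.mono (by omega)
  have hstate : ∀ n e, ((Stream'.Seq.ofList A).append (pathSeq c z a b)).get? n = some e →
      A.length ≤ n + 1 → ∃ m, n + 1 = A.length + m ∧ PathValid c z a b m ∧
        KempeState c A y z a b m e := by
    intro n e he hn
    obtain ⟨m, hm, hv⟩ := hget n e he hn
    obtain ⟨f, S⟩ := R.kempeState hc m hv
    obtain ⟨B, hB⟩ := S.shifted.last
    have h1 := take_succ_of_get? he
    rw [hm, take_append_ofList] at h1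
    change A ++ pathTake c z a b m = _ at h1
    rw [hB] at h1
    have := (List.append_inj' h1 (by simp)).2
    simp at this
    subst this
    exact ⟨m, hm, hv, S⟩
  apply isAugmenting_of_take
  · rw [get?_append_ofList, if_pos hlen]
    simp
    exact List.ne_nil_of_length_pos hlen
  · intro n e he
    by_cases hn : A.length ≤ n + 1
    · obtain ⟨m, hm, hv, S⟩ := hstate n e he hn
      refine ⟨n, e, le_rfl, he, ?_⟩
      rw [hm, take_append_ofList]
      exact S.shifted
    -- Inside `A` nothing is known about intermediate shifts, so the longer initial segment `A`
    -- itself serves; for this `isAugmenting_of_take` allows `m > n`.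
    · push Not at hn
      have he' : ((Stream'.Seq.ofList A).append (pathSeq c z a b)).get? (A.length - 1) =
          some (A[A.length - 1]) := by
        rw [get?_append_ofList, if_pos (by omega), List.getElem?_eq_getElem]
      obtain ⟨m, hm, hv, S⟩ := hstate _ _ he' (by omega)
      refine ⟨A.length - 1, _, by omega, he', ?_⟩
      rw [hm, take_append_ofList]
      exact S.shifted
  · intro n e he hend
    have hn : A.length ≤ n + 1 := by
      by_contra hlt
      rw [get?_append_ofList, if_pos (by omega)] at hend
      simp at hend
      omega
    obtain ⟨m, hm, hv, S⟩ := hstate n e he hn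
    rw [get?_append_ofList, if_neg (by omega), hm, Nat.add_sub_cancel_left] at hend
    have hmiss : altColor a b m ∈ MeasurableVizing.missing c (pathVertex c z a b m) := by
      by_contra hmem
      rw [pathSeq_get?_of_valid (hv.succ hmem)] at hend
      simp at hend
    refine ⟨_, _, S.val, altColor a b m, ?_, ?_⟩
    · rw [hm, take_append_ofList]
      exact S.left
    · rw [hm, take_append_ofList]
      exact R.end_mem_missing hc S hv hmiss

/-- A finite chain is augmenting if some color is missing at both ends of its last edge after the
shift. -/
lemma Shifted.isAugmenting {f : G.edgeSet} (hS : Shifted c A f) {x y : V}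
    (hf : f.1 = s(x, y)) {κ : Fin k} (hx : κ ∈ missing (listShift c A) x)
    (hy : κ ∈ missing (listShift c A) y) : IsAugmenting c (Stream'.Seq.ofList A) := by
  obtain ⟨B, rfl⟩ := hS.last
  have htake : (Stream'.Seq.ofList (B ++ [f])).take (B.length + 1) = B ++ [f] := by
    have := take_append_ofList (B ++ [f]) Stream'.Seq.nil 0
    rw [Stream'.Seq.append_nil] at this
    simpa using this
  have hget : (Stream'.Seq.ofList (B ++ [f])).get? B.length = some f := by
    rw [Stream'.Seq.ofList_get?]
    simp
  apply isAugmenting_of_take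
  · rw [Stream'.Seq.ofList_get?]
    simp
  · intro n e he
    rw [Stream'.Seq.ofList_get?] at he
    have : n < (B ++ [f]).length := (List.getElem?_eq_some_iff.1 he).1
    simp at this
    exact ⟨B.length, f, by omega, hget, by rwa [htake]⟩
  · intro n e he hn
    have h1 : n < (B ++ [f]).length := by
      rw [Stream'.Seq.ofList_get?] at he
      exact (List.getElem?_eq_some_iff.1 he).1
    have h2 : (B ++ [f]).length ≤ n + 1 := by
      rw [Stream'.Seq.ofList_get?] at hn
      simpa using hn
    obtain rfl : n = B.length := by simp at h1 h2; omega
    rw [hget] at he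
    obtain rfl := Option.some.inj he
    exact ⟨x, y, hf, κ, by rwa [htake], by rwa [htake]⟩

end Kempe

/-! ### Fans -/

section Fan

variable {V : Type*} {G : SimpleGraph V} {k : ℕ} {c : G.edgeSet → Option (Fin k)} {y : V}
  {S : Set (Fin k)} {f : G.edgeSet} {u : ℕ → V} {E : ℕ → G.edgeSet} {N : ℕ}

/-- The edges `E 0, …, E N` with outer vertices `u 0, …, u N` form a fan around `y` that starts at
`f`, and no color of `S` is missing at `u j` for `j < N`. -/
structure FanData (c : G.edgeSet → Option (Fin k)) (S : Set (Fin k)) (y : V) (f : G.edgeSet)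
    (u : ℕ → V) (E : ℕ → G.edgeSet) (N : ℕ) : Prop where
  zero : E 0 = f
  val : ∀ j ≤ N, (E j).1 = s(y, u j)
  inj : ∀ i ≤ N, ∀ j ≤ N, E i = E j → i = j
  step : ∀ j < N, ∃ γ, c (E (j + 1)) = some γ ∧ IsLeast (missing c (u j)) γ
  cond : ∀ j < N, ∀ s ∈ S, s ∉ missing c (u j)

/-- The fan cannot be extended. -/
def FanData.Terminal (c : G.edgeSet → Option (Fin k)) (S : Set (Fin k)) (y : V)
    (u : ℕ → V) (E : ℕ → G.edgeSet) (N : ℕ) : Prop :=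
  (∃ s ∈ S, s ∈ missing c (u N)) ∨
    ∀ γ, IsLeast (missing c (u N)) γ → γ ∈ missing c y ∨ ∃ i ≤ N, c (E i) = some γ

lemma FanData.u_inj (F : FanData c S y f u E N) {i j : ℕ} (hi : i ≤ N) (hj : j ≤ N)
    (h : u i = u j) : i = j :=
  F.inj i hi j hj (Subtype.ext (by rw [F.val i hi, F.val j hj, h]))

lemma FanData.succ_le (F : FanData c S y f u E N) {d : ℕ}
    (hd : (G.neighborSet y).encard ≤ d) : N + 1 ≤ d := by
  have hsub : (u '' (Finset.range (N + 1) : Set ℕ)) ⊆ G.neighborSet y := by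
    rintro _ ⟨j, hj, rfl⟩
    have hj : j ≤ N := by simpa [Nat.lt_succ_iff] using hj
    have := (E j).2
    rw [F.val j hj] at this
    exact this
  have hinj : Set.InjOn u (Finset.range (N + 1) : Set ℕ) := by
    intro i hi j hj h
    simp at hi hj
    exact F.u_inj hi hj h
  have := (Set.encard_le_encard hsub).trans hd
  rw [hinj.encard_image, Set.encard_coe_eq_coe_finsetCard, Finset.card_range] at this
  exact_mod_cast this

/-- Greedy extension: a fan that is not terminal can be prolonged by the edge at `y` whose color is
the least one missing at its last outer vertex. The outer vertices are distinct neighbors of `y`, so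
the degree bound stops the process. -/
lemma exists_fanData {d : ℕ} (hd : (G.neighborSet y).encard ≤ d) {w : V} (hf : f.1 = s(y, w)) :
    ∃ u E N, FanData c S y f u E N ∧ FanData.Terminal c S y u E N := by
  classical
  by_contra hcon
  push Not at hcon
  have key : ∀ N, ∃ u E, FanData c S y f u E N := by
    intro N
    induction N with
    | zero =>
      refine ⟨fun _ => w, fun _ => f, rfl, fun _ _ => hf, ?_, ?_, ?_⟩
      · intro i hi j hj _
        omega
      · intro j hj
        omega
      · intro j hj
        omega
    | succ N ih =>
      obtain ⟨u, E, F⟩ := ih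
      have hT := hcon u E N F
      unfold FanData.Terminal at hT
      push Not at hT
      obtain ⟨h1, γ, hγ, hγy, hγE⟩ := hT
      obtain ⟨e, hye, heγ⟩ := notMem_missing_iff.1 hγy
      obtain ⟨v, hv⟩ := hye
      refine ⟨Function.update u (N + 1) v, Function.update E (N + 1) e, ?_, ?_, ?_, ?_, ?_⟩
      · rw [Function.update_of_ne (by omega), F.zero]
      · intro j hj
        by_cases hjN : j = N + 1
        · subst hjN
          simpa using hv
        · rw [Function.update_of_ne hjN, Function.update_of_ne hjN]
          exact F.val j (by omega)
      · intro i hi j hj h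
        by_cases hiN : i = N + 1 <;> by_cases hjN : j = N + 1
        · omega
        · subst hiN
          rw [Function.update_self, Function.update_of_ne hjN] at h
          exact (hγE j (by omega) (h ▸ heγ)).elim
        · subst hjN
          rw [Function.update_self, Function.update_of_ne hiN] at h
          exact (hγE i (by omega) (h ▸ heγ)).elim
        · rw [Function.update_of_ne hiN, Function.update_of_ne hjN] at h
          exact F.inj i (by omega) j (by omega) h
      · intro j hj
        rw [Function.update_of_ne (show j ≠ N + 1 by omega)]
        by_cases hjN : j = N
        · subst hjN
          exact ⟨γ, by rw [Function.update_self, heγ], hγ⟩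
        · rw [Function.update_of_ne (show j + 1 ≠ N + 1 by omega)]
          exact F.step j (by omega)
      · intro j hj s hs
        rw [Function.update_of_ne (show j ≠ N + 1 by omega)]
        by_cases hjN : j = N
        · subst hjN
          exact h1 s hs
        · exact F.cond j (by omega) s hs
  obtain ⟨u, E, F⟩ := key d
  have := F.succ_le hd
  omega

/-- The edges `E 0, …, E i` as a list. -/
def fanList (E : ℕ → G.edgeSet) (i : ℕ) : List G.edgeSet := (List.range (i + 1)).map E

/-- The edges `E 1, …, E i` as a list. -/
def fanTail (E : ℕ → G.edgeSet) (i : ℕ) : List G.edgeSet := (List.range i).map fun j => E (j + 1)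

lemma fanList_eq (E : ℕ → G.edgeSet) (i : ℕ) : fanList E i = E 0 :: fanTail E i := by
  simp [fanList, fanTail, List.range_succ_eq_map, Function.comp_def]

lemma fanTail_succ (E : ℕ → G.edgeSet) (i : ℕ) : fanTail E (i + 1) = fanTail E i ++ [E (i + 1)] := by
  simp [fanTail, List.range_succ]

lemma length_fanTail (E : ℕ → G.edgeSet) (i : ℕ) : (fanTail E i).length = i := by
  simp [fanTail]

lemma mem_fanTail {E : ℕ → G.edgeSet} {i : ℕ} {h : G.edgeSet} :
    h ∈ fanTail E i ↔ ∃ j < i, E (j + 1) = h := by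
  simp [fanTail]

lemma fanSeq_get? (E : ℕ → G.edgeSet) (i n : ℕ) :
    (Stream'.Seq.ofList (fanList E i)).get? n = if n ≤ i then some (E n) else none := by
  rw [Stream'.Seq.ofList_get?, fanList, List.getElem?_map]
  split_ifs with h
  · rw [List.getElem?_range (by omega)]
    rfl
  · rw [List.getElem?_eq_none (by simp; omega)]
    rfl

lemma fanSeq_get?_eq_some {E : ℕ → G.edgeSet} {i n : ℕ} {e : G.edgeSet}
    (h : (Stream'.Seq.ofList (fanList E i)).get? n = some e) : n ≤ i ∧ e = E n := by
  rw [fanSeq_get?] at h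
  split_ifs at h with hn
  exact ⟨hn, (Option.some.inj h).symm⟩

lemma isPrefix_fanSeq (E : ℕ → G.edgeSet) {i N : ℕ} (h : i ≤ N) :
    IsPrefix (Stream'.Seq.ofList (fanList E i)) (Stream'.Seq.ofList (fanList E N)) := by
  intro n e he
  obtain ⟨hn, rfl⟩ := fanSeq_get?_eq_some he
  rw [fanSeq_get?, if_pos (by omega)]

lemma FanData.isFan (F : FanData c S y f u E N) :
    IsFan c y f (Stream'.Seq.ofList (fanList E N)) where
  center := by
    intro n g hg
    obtain ⟨hn, rfl⟩ := fanSeq_get?_eq_some hg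
    rw [F.val n hn]
    simp
  first := by
    rw [fanSeq_get?, if_pos (by omega), F.zero]
  injective := by
    intro i j e hi hj
    obtain ⟨hi', rfl⟩ := fanSeq_get?_eq_some hi
    obtain ⟨hj', h⟩ := fanSeq_get?_eq_some hj
    exact F.inj i hi' j hj' h
  color := by
    intro n g g' v hg hg' hv
    obtain ⟨hn, rfl⟩ := fanSeq_get?_eq_some hg
    obtain ⟨hn', rfl⟩ := fanSeq_get?_eq_some hg'
    rw [F.val n hn, Sym2.congr_right] at hv
    subst hv
    exact F.step n (by omega)

lemma FanData.condition (F : FanData c S y f u E N) (n : ℕ) (g : G.edgeSet) (v : V)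
    (hg : (Stream'.Seq.ofList (fanList E N)).get? n = some g)
    (hn' : (Stream'.Seq.ofList (fanList E N)).get? (n + 1) ≠ none) (hv : g.1 = s(y, v)) :
    ∀ s ∈ S, s ∉ missing c v := by
  obtain ⟨hn, rfl⟩ := fanSeq_get?_eq_some hg
  rw [F.val n hn, Sym2.congr_right] at hv
  subst hv
  rw [fanSeq_get?] at hn'
  split_ifs at hn' with h
  · exact F.cond n (by omega)
  · exact absurd rfl hn'

/-- A further edge would carry the least color missing at `u N`, but this color is absent at `y` or
already used on the fan, or the condition forbids going on. The parameter `S` covers both kinds of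
fans: `∅` for the fan at an uncolored edge, `{a, b}` for conditional fans. -/
lemma FanData.maximal (hc : IsProper c) (F : FanData c S y f u E N)
    (hT : FanData.Terminal c S y u E N) {Q : EdgeSeq G} (hQ : IsFan c y f Q)
    (hcond : ∀ g, Q.get? N = some g → Q.get? (N + 1) ≠ none →
      ∀ v, g.1 = s(y, v) → ∀ s ∈ S, s ∉ missing c v)
    (hpre : IsPrefix (Stream'.Seq.ofList (fanList E N)) Q) :
    Q = Stream'.Seq.ofList (fanList E N) := by
  have hget : ∀ i ≤ N, Q.get? i = some (E i) := by
    intro i hi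
    apply hpre
    rw [fanSeq_get?, if_pos hi]
  have hend : Q.get? (N + 1) = none := by
    by_contra hne
    obtain ⟨g, hg⟩ := Option.ne_none_iff_exists'.1 hne
    have hN := hget N le_rfl
    obtain ⟨γ, hγ, hleast⟩ := hQ.color N _ g (u N) hN hg (F.val N le_rfl)
    have hyg := hQ.center _ _ hg
    rcases hT with ⟨s, hs, hs'⟩ | hT
    · exact hcond _ hN hne _ (F.val N le_rfl) s hs hs'
    · rcases hT γ hleast with h1 | ⟨i, hi, h1⟩
      · exact h1 g hyg hγ
      · have : g = E i := hc.eq_of_color hyg (hQ.center i _ (hget i hi)) hγ h1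
        have h2 := hget i hi
        rw [← this] at h2
        have := hQ.injective _ _ g h2 hg
        omega
  apply Stream'.Seq.ext
  intro n
  rw [fanSeq_get?]
  split_ifs with hn
  · exact hget n hn
  · exact Q.le_stable (by omega) hend

/-! ### Shifting along a fan -/

/-- Invariants of the shift along `B` and the first `i + 1` edges of a fan that starts with the last
edge of `B`. -/
structure FanState (c : G.edgeSet → Option (Fin k)) (B : List G.edgeSet) (E : ℕ → G.edgeSet)
    (i : ℕ) : Prop where
  shifted : Shifted c (B ++ fanTail E i) (E i)
  off : ∀ h, (∀ l ≤ i, h ≠ E l) → listShift c (B ++ fanTail E i) h = listShift c B h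
  on : ∀ j < i, listShift c (B ++ fanTail E i) (E j) = c (E (j + 1))

variable {B : List G.edgeSet}

/-- The colors of the fan edges are missing, after the shift along `B`, at the outer vertices of the
preceding edges. -/
structure FanReady (c : G.edgeSet → Option (Fin k)) (B : List G.edgeSet) (y : V) (u : ℕ → V)
    (E : ℕ → G.edgeSet) (N : ℕ) : Prop where
  shifted : Shifted c B (E 0)
  notMem : ∀ j < N, E (j + 1) ∉ B
  color : ∀ j < N, ∃ γ, c (E (j + 1)) = some γ ∧ γ ∈ missing (listShift c B) (u j)

/-- Among the fan edges only `E i` contains `u i`, and after the shift it is uncolored. -/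
lemma FanState.missing_outer (F : FanData c S y f u E N) {i : ℕ} (hi : i ≤ N)
    (T : FanState c B E i) :
    missing (listShift c B) (u i) ⊆ missing (listShift c (B ++ fanTail E i)) (u i) := by
  intro κ hκ h hh hcol
  by_cases hex : ∃ l ≤ i, h = E l
  · obtain ⟨l, hl, rfl⟩ := hex
    rw [F.val l (by omega), Sym2.mem_iff] at hh
    rcases hh with hh | hh
    · exact edge_ne _ (F.val i hi) hh.symm
    · have := F.u_inj hi (by omega) hh
      subst this
      rw [T.shifted.listShift_last] at hcol
      simp at hcol
  · push Not at hex
    rw [T.off h hex] at hcol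
    exact hκ h hh hcol

/-- The shift hands the colors of fan edges to their predecessors, so at `y` only colors that were
present before occur. -/
lemma FanState.missing_center (F : FanData c S y f u E N) (R : FanReady c B y u E N) {i : ℕ}
    (hi : i ≤ N) (T : FanState c B E i) :
    missing (listShift c B) y ⊆ missing (listShift c (B ++ fanTail E i)) y := by
  intro κ hκ h hh hcol
  by_cases hex : ∃ l ≤ i, h = E l
  · obtain ⟨l, hl, rfl⟩ := hex
    rcases Nat.lt_or_ge l i with hlt | hge
    · rw [T.on l hlt] at hcol
      refine hκ (E (l + 1)) (by rw [F.val (l + 1) (by omega)]; simp) ?_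
      rw [listShift_of_notMem (R.notMem l (by omega)), hcol]
    · obtain rfl : l = i := by omega
      rw [T.shifted.listShift_last] at hcol
      simp at hcol
  · push Not at hex
    rw [T.off h hex] at hcol
    exact hκ h hh hcol

lemma FanReady.fanState (F : FanData c S y f u E N) (R : FanReady c B y u E N) :
    ∀ i ≤ N, FanState c B E i := by
  intro i
  induction i with
  | zero =>
    intro _
    refine ⟨?_, ?_, ?_⟩ <;> simp [fanTail]
    exact R.shifted
  | succ i ih =>
    intro hi
    have T := ih (by omega)
    obtain ⟨γ, hγ, hm⟩ := R.color i (by omega)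
    have hval := F.val i (by omega)
    have hval' := F.val (i + 1) hi
    have hne : ∀ l ≤ i, E l ≠ E (i + 1) := by
      intro l hl h
      have := F.inj l (by omega) (i + 1) hi h
      omega
    have hnm : E (i + 1) ∉ B ++ fanTail E i := by
      rw [List.mem_append, not_or]
      refine ⟨R.notMem i (by omega), ?_⟩
      rw [mem_fanTail]
      rintro ⟨j, hj, h⟩
      exact hne (j + 1) (by omega) h
    have heq : listShift c (B ++ fanTail E (i + 1)) =
        move (listShift c (B ++ fanTail E i)) (E i) (E (i + 1)) := by
      rw [fanTail_succ, ← List.append_assoc, T.shifted.listShift_append hnm]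
    refine ⟨?_, ?_, ?_⟩
    · rw [fanTail_succ, ← List.append_assoc]
      exact T.shifted.append hnm hval hval' hγ (T.missing_outer F (by omega) hm)
    · intro h hh
      rw [heq, move_of_ne _ (hh i (by omega)) (hh (i + 1) le_rfl),
        T.off h fun l hl => hh l (by omega)]
    · intro j hj
      rw [heq]
      rcases Nat.lt_succ_iff_lt_or_eq.1 hj with hj' | rfl
      · rw [move_of_ne _ _ (hne j hj'.le), T.on j hj']
        intro h
        have := F.inj j (by omega) i (by omega) h
        omega
      · rw [move_left _ (hne j le_rfl), listShift_of_notMem hnm]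

/-- If a color is missing at both ends of a fan edge, the chain that ends there is augmenting. -/
lemma FanReady.isAugmenting (F : FanData c S y f u E N) (R : FanReady c B y u E N) {i : ℕ}
    (hi : i ≤ N) {κ : Fin k} (hy : κ ∈ missing (listShift c B) y)
    (hu : κ ∈ missing (listShift c B) (u i)) :
    IsAugmenting c (Stream'.Seq.ofList (B ++ fanTail E i)) := by
  have T := R.fanState F i hi
  exact T.shifted.isAugmenting (F.val i hi) (T.missing_center F R hi hy)
    (T.missing_outer F hi hu)

/-- The path must not be disturbed by edges recolored earlier: `hclean` handles those of `B`, and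
`hfan` the fan edges `E j`, which now have the color of `E (j + 1)`. Since `y` is off the path, only
the outer vertices of fan edges matter. -/
lemma FanReady.pathReady (hc : IsProper c) (F : FanData c S y f u E N)
    (R : FanReady c B y u E N) {i : ℕ} (hi : i ≤ N) {a b : Fin k} (hab : a ≠ b)
    (hb : b ∈ missing c (u i)) (ha' : a ∈ missing (listShift c B) y)
    (hb' : b ∈ missing (listShift c B) (u i)) (havoid : ¬ OnPath c (u i) a b y)
    (hclean : ∀ v, OnPath c (u i) a b v → ∀ h ∈ B, v ∈ h.1 → ∀ κ, κ = a ∨ κ = b →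
      c h ≠ some κ ∧ listShift c B h ≠ some κ)
    (hfan : ∀ j < i, OnPath c (u i) a b (u j) → ∀ κ, κ = a ∨ κ = b → c (E (j + 1)) ≠ some κ) :
    PathReady c (B ++ fanTail E i) y (u i) a b := by
  have T := R.fanState F i hi
  refine ⟨hab, hb, ⟨E i, F.val i hi, T.shifted⟩, T.missing_center F R hi ha',
    T.missing_outer F hi hb', havoid, ?_⟩
  intro v hv h hh hvh κ hκ
  by_cases hex : ∃ l ≤ i, h = E l
  · obtain ⟨l, hl, rfl⟩ := hex
    have hval := F.val l (by omega)
    rw [hval, Sym2.mem_iff] at hvh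
    rcases hvh with rfl | rfl
    · exact (havoid hv).elim
    · constructor
      · intro hcol
        exact havoid (hv.of_edge hc hb (hval.trans Sym2.eq_swap) hκ hcol)
      · rcases Nat.lt_or_ge l i with hlt | hge
        · rw [T.on l hlt]
          exact hfan l hlt hv κ hκ
        · obtain rfl : l = i := by omega
          rw [T.shifted.listShift_last]
          simp
  · push Not at hex
    rw [T.off h hex]
    refine hclean v hv h ?_ hvh κ hκ
    rcases List.mem_append.1 hh with h1 | h1
    · exact h1
    · obtain ⟨j, hj, rfl⟩ := mem_fanTail.1 h1
      exact (hex (j + 1) (by omega) rfl).elim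

lemma OnPath.trans (hc : IsProper c) {z z' v : V} {a b : Fin k} (hb : b ∈ missing c z)
    (hz : OnPath c z a b z') (hv : OnPath c z' a b v) : OnPath c z a b v := by
  obtain ⟨n, hn, rfl⟩ := hv
  induction n with
  | zero => exact hz
  | succ n ih =>
    exact (ih (hn.mono (by omega))).of_edge hc hb (pathEdge_val hn) (altColor_eq_or a b n)
      (color_pathEdge hn)

/-- If the first color missing at the outer vertex of the last edge of a fan is used on an earlier
edge of the fan, then one of two alternating paths can be appended. -/
lemma FanReady.exists_pathReady (hc : IsProper c) (F : FanData c S y f u E N)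
    (R : FanReady c B y u E N) {i : ℕ} (hi : i < N) {δ γ : Fin k} (hδ : δ ∈ missing c y)
    (hδ' : δ ∈ missing (listShift c B) y) (hγ : c (E (i + 1)) = some γ)
    (hγi : γ ∈ missing c (u i)) (hγN : γ ∈ missing c (u N))
    (hγi' : γ ∈ missing (listShift c B) (u i)) (hγN' : γ ∈ missing (listShift c B) (u N))
    (hclean : ∀ i ≤ N, γ ∈ missing c (u i) → ∀ v, OnPath c (u i) δ γ v → ∀ h ∈ B, v ∈ h.1 →
      ∀ κ, κ = δ ∨ κ = γ → c h ≠ some κ ∧ listShift c B h ≠ some κ) :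
    ∃ i ≤ N, PathReady c (B ++ fanTail E i) y (u i) δ γ := by
  have hmem : ∀ j ≤ N, y ∈ (E j).1 := by
    intro j hj
    rw [F.val j hj]
    simp
  have hδγ : δ ≠ γ := by
    rintro rfl
    exact hδ _ (hmem (i + 1) (by omega)) hγ
  have huniq : ∀ j < N, c (E (j + 1)) = some γ → j = i := by
    intro j hj h
    have h1 := hc.eq_of_color (hmem (j + 1) (by omega)) (hmem (i + 1) (by omega)) h hγ
    have := F.inj _ (by omega) _ (by omega) h1
    omega
  have hδE : ∀ j < N, c (E (j + 1)) ≠ some δ := fun j hj => hδ _ (hmem (j + 1) (by omega))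
  have hyu : ∀ j ≤ N, y ≠ u j := fun j hj => edge_ne _ (F.val j hj)
  -- The vertices `y`, `u i` and `u N` all miss `δ` or `γ`, and a two-colored component has at most
  -- two such vertices. If `y` is on the path from `u i`, then `u N` lies in another component, and
  -- its path avoids both.
  by_cases hy : OnPath c (u i) δ γ y
  · have h1 : ¬ OnPath c (u N) δ γ (u i) := by
      intro h
      rcases OnPath.eq_of_missing (h.trans hc hγN hy) h (Or.inl rfl) (Or.inr rfl) hδ hγi with
        h' | h' | h'
      · exact hyu N le_rfl h'
      · have := F.u_inj hi.le le_rfl h'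
        omega
      · exact hyu i hi.le h'
    have h2 : ¬ OnPath c (u N) δ γ y := by
      intro h
      exact h1 (h.start_mem hc hγN (Or.inl rfl) (Or.inr rfl) hy)
    refine ⟨N, le_rfl, R.pathReady hc F le_rfl hδγ hγN hδ' hγN' h2 (hclean N le_rfl hγN) ?_⟩
    rintro j hj hv κ (rfl | rfl)
    · exact hδE j hj
    · intro h
      rw [huniq j hj h] at hv
      exact h1 hv
  · refine ⟨i, hi.le, R.pathReady hc F hi.le hδγ hγi hδ' hγi' hy (hclean i hi.le hγi) ?_⟩
    rintro j hj hv κ (rfl | rfl)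
    · exact hδE j (by omega)
    · intro h
      have := huniq j (by omega) h
      omega

/-- The outcome of the construction of a fan after the chain `B`: a prefix of the fan is augmenting,
or an alternating path can be appended to it. -/
def FanOutcome (c : G.edgeSet → Option (Fin k)) (B : List G.edgeSet) (y : V) (u : ℕ → V)
    (E : ℕ → G.edgeSet) (i : ℕ) : Prop :=
  IsAugmenting c (Stream'.Seq.ofList (B ++ fanTail E i)) ∨
    ∃ a b, PathReady c (B ++ fanTail E i) y (u i) a b

/-- The first fan. -/
lemma exists_first_fan (hc : IsProper c) {d : ℕ} (hd : (G.neighborSet y).encard ≤ d)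
    (hmiss : ∀ v, (missing c v).Nonempty) {w : V} (hf : f.1 = s(y, w)) (hfc : c f = none) :
    ∃ u E N i, FanData c ∅ y f u E N ∧ FanData.Terminal c ∅ y u E N ∧ i ≤ N ∧
      FanOutcome c [f] y u E i := by
  obtain ⟨u, E, N, F, hT⟩ := exists_fanData (c := c) (S := ∅) hd hf
  have hsh : listShift c [f] = c := listShift_singleton hfc
  have R : FanReady c [f] y u E N := by
    refine ⟨?_, ?_, ?_⟩
    · rw [F.zero]
      exact Shifted.singleton hc hfc
    · intro j hj
      rw [List.mem_singleton]
      intro h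
      rw [← F.zero] at h
      have := F.inj _ (by omega) _ (by omega) h
      omega
    · intro j hj
      obtain ⟨γ, h1, h2⟩ := F.step j hj
      exact ⟨γ, h1, by rw [hsh]; exact h2.1⟩
  obtain ⟨γ, hγ⟩ : ∃ γ, IsLeast (missing c (u N)) γ :=
    (Set.toFinite _).exists_minimal (hmiss (u N)) |>.imp fun γ h => ⟨h.1, fun x hx =>
      (le_total γ x).elim id fun h' => h.2 hx h'⟩
  rcases hT with ⟨s, hs, -⟩ | hT'
  · exact hs.elim
  -- Either `γ` is also missing at the center and the whole fan is augmenting, or `γ` is the color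
  -- of an earlier edge `E (i + 1)`. In the latter case it is missing at `u i` as well as at `u N`.
  rcases hT' γ hγ with h1 | ⟨i', hi', h1⟩
  · refine ⟨u, E, N, N, F, Or.inr hT', le_rfl, Or.inl ?_⟩
    exact R.isAugmenting F le_rfl (κ := γ) (by rwa [hsh]) (by rw [hsh]; exact hγ.1)
  · obtain ⟨i, rfl⟩ : ∃ i, i' = i + 1 := by
      apply Nat.exists_eq_succ_of_ne_zero
      rintro rfl
      rw [F.zero, hfc] at h1
      simp at h1
    obtain ⟨γ', h2, h3⟩ := F.step i (by omega)
    obtain rfl : γ' = γ := by rw [h1] at h2; exact (Option.some.inj h2).symm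
    obtain ⟨δ, hδ⟩ := hmiss y
    obtain ⟨j, hj, hP⟩ := R.exists_pathReady hc F (i := i) (by omega) hδ (by rwa [hsh]) h1 h3.1
      hγ.1 (by rw [hsh]; exact h3.1) (by rw [hsh]; exact hγ.1) (by
        intro i hi _ v hv h hh hvh κ hκ
        rw [hsh]
        rw [List.mem_singleton] at hh
        subst hh
        simp [hfc])
    exact ⟨u, E, N, j, F, Or.inr hT', hj, Or.inr ⟨δ, γ', hP⟩⟩

/-- `v` is joined to `y` by a colored edge. -/
def ColoredAdj (c : G.edgeSet → Option (Fin k)) (y v : V) : Prop :=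
  ∃ e : G.edgeSet, e.1 = s(y, v) ∧ c e ≠ none

/-- The vertex `y` is suitable as the center of the fan that follows the chain `A` and an
initial segment of the alternating path that starts at `z`. -/
structure GoodCenter (c : G.edgeSet → Option (Fin k)) (A : List G.edgeSet) (z : V) (a b : Fin k)
    (y : V) : Prop where
  center : ∀ h ∈ A, y ∉ h.1
  nbr : ∀ v, ColoredAdj c y v → ∀ h ∈ A, v ∉ h.1
  pathEnd : ∀ v, ColoredAdj c y v → ¬ IsPathEnd c z a b v
  path : ∀ z' a' b', ColoredAdj c y z' → a' ≠ b' → b' ∈ missing c z' → ∀ v, OnPath c z' a' b' v →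
    ∀ h ∈ A, v ∉ h.1

/-- The later fans. -/
lemma exists_next_fan (hc : IsProper c) {d : ℕ} {A : List G.edgeSet} {x z : V} {a b : Fin k} {n : ℕ}
    (R : PathReady c A x z a b)
    (hd : (G.neighborSet (pathVertex c z a b (n + 2))).encard ≤ d)
    (hmiss : ∀ v, (missing c v).Nonempty)
    (hn : PathValid c z a b (n + 3)) (hgood : GoodCenter c A z a b (pathVertex c z a b (n + 2)))
    (hn2 : PathValid c z a b (n + 2)) :
    ∃ u E N i, FanData c {a, b} (pathVertex c z a b (n + 2)) (pathEdge hn2) u E N ∧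
      FanData.Terminal c {a, b} (pathVertex c z a b (n + 2)) u E N ∧ i ≤ N ∧
      FanOutcome c (A ++ pathTake c z a b (n + 2)) (pathVertex c z a b (n + 2)) u E i := by
  set y := pathVertex c z a b (n + 2) with hy
  set f := pathEdge hn2 with hf
  have hfval : f.1 = s(y, pathVertex c z a b (n + 1)) := (pathEdge_val hn2).trans Sym2.eq_swap
  have hfcol : c f = some (altColor a b (n + 1)) := color_pathEdge hn2
  obtain ⟨u, E, N, F, hT⟩ := exists_fanData (c := c) (S := {a, b}) hd hfval
  obtain ⟨f', K⟩ := R.kempeState hc (n + 2) hn2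
  obtain rfl : f' = f := by
    apply Subtype.ext
    rw [K.val, hfval]
    exact Sym2.eq_swap
  set B := A ++ pathTake c z a b (n + 2) with hB
  obtain ⟨f₀, hf₀, hS₀⟩ := R.shifted
  have hzA : ∃ h ∈ A, z ∈ h.1 := ⟨f₀, hS₀.mem_last, by rw [hf₀]; simp⟩
  have hu0 : u 0 = pathVertex c z a b (n + 1) := by
    have h1 := F.val 0 (by omega)
    rw [F.zero, hfval] at h1
    exact (Sym2.congr_right.1 h1).symm
  have hS : ∀ κ : Fin k, κ ∈ ({a, b} : Set (Fin k)) ↔ κ = a ∨ κ = b := fun κ => Iff.rfl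
  -- The color of a later fan edge is missing at the preceding outer vertex, where the condition
  -- excludes `a` and `b`.
  have hEcol : ∀ j < N, ∀ κ, κ = a ∨ κ = b → c (E (j + 1)) ≠ some κ := by
    intro j hj κ hκ h
    obtain ⟨γ, h1, h2⟩ := F.step j hj
    rw [h] at h1
    obtain rfl := Option.some.inj h1
    exact F.cond j hj _ hκ h2.1
  have hcadj : ∀ j ≤ N, ColoredAdj c y (u j) := by
    intro j hj
    refine ⟨E j, F.val j hj, ?_⟩
    rcases Nat.eq_zero_or_pos j with rfl | hpos
    · rw [F.zero, hfcol]
      simp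
    · obtain ⟨j, rfl⟩ : ∃ i, j = i + 1 := ⟨j - 1, by omega⟩
      obtain ⟨γ, h1, -⟩ := F.step j (by omega)
      rw [h1]
      simp
  -- Off `A` the shift changes only path edges, and their colors remain among `a` and `b`. A path
  -- vertex missing one of these is `z`, which lies on `A`, or the end of the path.
  have hmono : ∀ v, (∀ h ∈ A, v ∉ h.1) → ¬ IsPathEnd c z a b v →
      missing c v ⊆ missing (listShift c B) v := by
    intro v hvA hvE κ hκ h hvh hcol
    have hA : h ∉ A := fun hA => hvA h hA hvh
    by_cases hTk : h ∈ pathTake c z a b (n + 2)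
    · have hκab : κ = a ∨ κ = b := by
        rcases K.new h hTk with h1 | h1 | h1 <;> rw [hcol] at h1 <;> simp at h1 <;> simp [h1]
      obtain ⟨j, hj, -, rfl⟩ := mem_pathTake hTk
      have hon : OnPath c z a b v := by
        rw [pathEdge_val, Sym2.mem_iff] at hvh
        rcases hvh with rfl | rfl
        · exact OnPath.pathVertex (hj.mono (by omega))
        · exact OnPath.pathVertex hj
      rcases hon.eq_or_isPathEnd hκab hκ with rfl | h1
      · obtain ⟨h, hh, hz⟩ := hzA
        exact hvA h hh hz
      · exact hvE h1
    · rw [listShift_of_notMem (by simp [hB, hA, hTk])] at hcol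
      exact hκ h hvh hcol
  have hyend : ¬ IsPathEnd c z a b y := by
    rintro ⟨m, hm, hm', hmy⟩
    obtain rfl := pathVertex_inj hc R.ne R.missing hm hn2 hmy
    exact hn (n + 2) (by omega) hm'
  have hmono_y := hmono y hgood.center hyend
  have hmono_u : ∀ j ≤ N, missing c (u j) ⊆ missing (listShift c B) (u j) :=
    fun j hj => hmono (u j) (hgood.nbr _ (hcadj j hj)) (hgood.pathEnd _ (hcadj j hj))
  have hyab : ∀ κ, κ = a ∨ κ = b → κ ∉ missing c y := by
    intro κ hκ hm
    rcases (OnPath.pathVertex hn2).eq_or_isPathEnd hκ hm with h1 | h1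
    · obtain ⟨h, hh, hz⟩ := hzA
      exact hgood.center h hh (by rwa [hy, h1])
    · exact hyend h1
  have RF : FanReady c B y u E N := by
    refine ⟨?_, ?_, ?_⟩
    · rw [F.zero]
      exact K.shifted
    · intro j hj hmem
      rcases List.mem_append.1 hmem with h1 | h1
      · exact hgood.center _ h1 (by rw [F.val (j + 1) (by omega)]; simp)
      · obtain ⟨m, hm, -, he⟩ := mem_pathTake h1
        exact hEcol j hj _ (altColor_eq_or a b m) (he ▸ color_pathEdge hm)
    · intro j hj
      obtain ⟨γ, h1, h2⟩ := F.step j hj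
      exact ⟨γ, h1, hmono_u j (by omega) h2.1⟩
  -- An outer vertex missing `a` or `b` cannot belong to the old path: it would be its start or its
  -- end, and `GoodCenter` excludes both. Its own path in these two colors is therefore disjoint
  -- from the old one.
  have hdisj : ∀ j ≤ N, ∀ a' b' κ, a' = a ∨ a' = b → b' = a ∨ b' = b → κ = a ∨ κ = b →
      κ ∈ missing c (u j) → ∀ v, OnPath c (u j) a' b' v → ¬ OnPath c z a b v := by
    intro j hj a' b' κ ha' hb' hκ hm v hv hvz
    have h1 := hvz.start_mem hc R.missing ha' hb' hv
    rcases h1.eq_or_isPathEnd hκ hm with h2 | h2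
    · obtain ⟨h, hh, hz⟩ := hzA
      exact hgood.nbr _ (hcadj j hj) h hh (h2 ▸ hz)
    · exact hgood.pathEnd _ (hcadj j hj) h2
  -- Uncoloring `f` frees its color at `y`.
  have hright : altColor a b (n + 1) ∈ missing (listShift c B) y := by
    have := K.right
    rwa [show n + 2 + 1 = n + 1 + 2 by omega, altColor_add_two] at this
  refine ⟨u, E, N, ?_⟩
  -- If the fan stops because `u N` misses `a` or `b`, then either this is the color freed at `y`
  -- and the fan is augmenting, or it is the other color, and the path from `u N` in the same two
  -- colors is available by `hdisj`.
  by_cases hex : ∃ s ∈ ({a, b} : Set (Fin k)), s ∈ missing c (u N)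
  · obtain ⟨s, hs, hsm⟩ := hex
    refine ⟨N, F, hT, le_rfl, ?_⟩
    rcases eq_altColor_or hs (n + 1) with h1 | h1
    · left
      exact RF.isAugmenting F le_rfl (κ := s) (by rw [h1]; exact hright) (hmono_u N le_rfl hsm)
    · right
      have hne : altColor a b (n + 1) ≠ s := by
        rw [h1]
        exact (altColor_succ_ne R.ne (n + 1)).symm
      have ha' := altColor_eq_or a b (n + 1)
      have hd' := hdisj N le_rfl (altColor a b (n + 1)) s s ha' hs hs hsm
      refine ⟨altColor a b (n + 1), s, RF.pathReady hc F le_rfl hne hsm hright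
        (hmono_u N le_rfl hsm) (fun h => hd' _ h (OnPath.pathVertex hn2)) ?_ ?_⟩
      · intro v hv h hh hvh κ hκ
        rcases List.mem_append.1 hh with h2 | h2
        · exact (hgood.path _ _ _ (hcadj N le_rfl) hne hsm v hv h h2 hvh).elim
        · exfalso
          obtain ⟨m, hm, -, rfl⟩ := mem_pathTake h2
          rw [pathEdge_val, Sym2.mem_iff] at hvh
          rcases hvh with rfl | rfl
          · exact hd' _ hv (OnPath.pathVertex (hm.mono (by omega)))
          · exact hd' _ hv (OnPath.pathVertex hm)
      · intro j hj _ κ hκ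
        apply hEcol j hj
        rcases hκ with rfl | rfl
        · exact ha'
        · exact hs
  -- Otherwise the argument for the first fan applies. Here `δ` and `γ` differ from `a` and `b`,
  -- while the old path carries only `a` and `b` before and after the shift, so it does not
  -- interfere.
  · have hT' := hT.resolve_left hex
    push Not at hex
    obtain ⟨γ, hγ⟩ : ∃ γ, IsLeast (missing c (u N)) γ :=
      (Set.toFinite _).exists_minimal (hmiss (u N)) |>.imp fun γ h => ⟨h.1, fun x hx =>
        (le_total γ x).elim id fun h' => h.2 hx h'⟩
    have hγab : ¬ (γ = a ∨ γ = b) := fun h => hex γ h hγ.1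
    rcases hT' γ hγ with h1 | ⟨i', hi', h1⟩
    · exact ⟨N, F, hT, le_rfl, Or.inl
        (RF.isAugmenting F le_rfl (hmono_y h1) (hmono_u N le_rfl hγ.1))⟩
    · obtain ⟨i, rfl⟩ : ∃ i, i' = i + 1 := by
        apply Nat.exists_eq_succ_of_ne_zero
        rintro rfl
        rw [F.zero, hfcol] at h1
        exact hγab (Option.some.inj h1 ▸ altColor_eq_or a b (n + 1))
      obtain ⟨γ', h2, h3⟩ := F.step i (by omega)
      obtain rfl : γ' = γ := by rw [h1] at h2; exact (Option.some.inj h2).symm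
      obtain ⟨δ, hδ⟩ := hmiss y
      have hδab : ¬ (δ = a ∨ δ = b) := fun h => hyab δ h hδ
      have hδγ : δ ≠ γ' := by
        rintro rfl
        exact hδ (E (i + 1)) (by rw [F.val (i + 1) (by omega)]; simp) h1
      obtain ⟨j, hj, hP⟩ := RF.exists_pathReady hc F (i := i) (by omega) hδ (hmono_y hδ) h1 h3.1
        hγ.1 (hmono_u i (by omega) h3.1) (hmono_u N le_rfl hγ.1) (by
          intro i hi hγi v hv h hh hvh κ hκ
          rcases List.mem_append.1 hh with h2 | h2
          · exact (hgood.path _ _ _ (hcadj i hi) hδγ hγi v hv h h2 hvh).elim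
          · have hκab : ¬ (κ = a ∨ κ = b) := by
              rcases hκ with rfl | rfl
              · exact hδab
              · exact hγab
            constructor
            · obtain ⟨m, hm, -, rfl⟩ := mem_pathTake h2
              intro h
              rw [color_pathEdge hm] at h
              exact hκab (Option.some.inj h ▸ altColor_eq_or a b m)
            · rcases K.new h h2 with h4 | h4 | h4 <;> rw [h4] <;> simp <;> rintro rfl <;>
                simp at hκab)
      exact ⟨j, F, hT, hj, Or.inr ⟨δ, γ', hP⟩⟩

end Fan

/-! ### Assembling multi-step Vizing chains -/

section Assemble

variable {V : Type*} {G : SimpleGraph V} {k : ℕ} {c : G.edgeSet → Option (Fin k)} {e : G.edgeSet}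

/-- `l` is an initial segment of the maximal fan at `e` around `y`. -/
def IsFanSegment (c : G.edgeSet → Option (Fin k)) (y : V) (e : G.edgeSet) (l : List G.edgeSet) :
    Prop :=
  l ≠ [] ∧ ∃ M, IsMaximalFan c y e M ∧ IsPrefix (Stream'.Seq.ofList l) M

/-- `l` is an initial segment of the maximal conditional fan around `y`. -/
def IsConditionalFanSegment (c : G.edgeSet → Option (Fin k)) (z : V) (a b : Fin k) (y : V)
    (l : List G.edgeSet) : Prop :=
  l ≠ [] ∧ ∃ M, IsMaximalConditionalFan c z a b y M ∧ IsPrefix (Stream'.Seq.ofList l) M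

/-- `Q` is an initial segment of the alternating path at `z`. -/
def IsPathSegment (c : G.edgeSet → Option (Fin k)) (z : V) (a b : Fin k) (Q : EdgeSeq G) : Prop :=
  ∃ M, IsAlternatingPath c z a b M ∧ IsPrefix Q M

lemma ofList_eq_nil {α : Type*} {l : List α} : Stream'.Seq.ofList l = .nil ↔ l = [] := by
  rw [← Stream'.Seq.ofList_nil]
  exact Stream'.Seq.ofList_injective.eq_iff

variable {y₁ z₁ y₂ z₂ y₃ z₃ : V} {a₁ b₁ a₂ b₂ a₃ b₃ : Fin k} {l₁ p₁ l₂ p₂ l₃ : List G.edgeSet}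
  {Q : EdgeSeq G}

/-- The final piece `Q` is a sequence and not a list, so that it can be empty (the fan is already
augmenting), finite or infinite. -/
lemma isThreeStepVizingChain_one (he : c e = none) (h₁ : IsFanSegment c y₁ e l₁)
    (hQ : Q ≠ .nil → IsPathSegment c z₁ a₁ b₁ Q) (hne : y₁ ≠ z₁)
    (haug : IsAugmenting c ((Stream'.Seq.ofList l₁).append Q)) :
    IsThreeStepVizingChain c e ((Stream'.Seq.ofList l₁).append Q) := by
  refine ⟨he, haug, ![Stream'.Seq.ofList l₁, .nil, .nil], ![Q, .nil, .nil], fun _ => y₁,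
    fun _ => z₁, fun _ => a₁, fun _ => b₁, ?_, ?_, ?_, ?_, ?_, ?_, ?_, ?_, ?_⟩
  · simp [Stream'.Seq.append_nil]
  · simp [Fin.forall_fin_succ]
  · simp [Fin.forall_fin_succ]
  · simp [hne]
  · intro _
    exact h₁.2
  · simp [Fin.forall_fin_succ]
  · simp only [Fin.forall_fin_succ]
    simp
    exact hQ
  · simp [Fin.forall_fin_succ, ofList_eq_nil, Stream'.Seq.terminates_ofList, h₁.1]
  · simp [Fin.forall_fin_succ]

lemma isThreeStepVizingChain_two (he : c e = none) (h₁ : IsFanSegment c y₁ e l₁)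
    (hp₁ : IsPathSegment c z₁ a₁ b₁ (Stream'.Seq.ofList p₁)) (hp₁' : p₁ ≠ [])
    (h₂ : IsConditionalFanSegment c z₁ a₁ b₁ y₂ l₂)
    (hQ : Q ≠ .nil → IsPathSegment c z₂ a₂ b₂ Q) (hne : [y₁, z₁, y₂, z₂].Nodup)
    (haug : IsAugmenting c ((Stream'.Seq.ofList (l₁ ++ p₁ ++ l₂)).append Q)) :
    IsThreeStepVizingChain c e ((Stream'.Seq.ofList (l₁ ++ p₁ ++ l₂)).append Q) := by
  simp only [List.nodup_cons, List.mem_cons, List.not_mem_nil, or_false, not_or,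
    not_false_eq_true, List.nodup_nil, and_true] at hne
  obtain ⟨⟨h12, h13, h14⟩, ⟨h23, h24⟩, h34⟩ := hne
  refine ⟨he, haug, ![Stream'.Seq.ofList l₁, Stream'.Seq.ofList l₂, .nil],
    ![Stream'.Seq.ofList p₁, Q, .nil], ![y₁, y₂, y₂],
    ![z₁, z₂, z₂], ![a₁, a₂, a₂], ![b₁, b₂, b₂], ?_, ?_, ?_, ?_, ?_, ?_, ?_, ?_, ?_⟩
  · simp [Stream'.Seq.append_nil, Stream'.Seq.ofList_append, Stream'.Seq.append_assoc]
  · simp [Fin.forall_fin_succ, h13, Ne.symm h13]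
  · simp [Fin.forall_fin_succ, h24, Ne.symm h24]
  · simp [Fin.forall_fin_succ, h12, h14, Ne.symm h23, h34]
  · intro _
    exact h₁.2
  · simp only [Fin.forall_fin_succ]
    simp
    exact fun _ => h₂.2
  · simp only [Fin.forall_fin_succ]
    simp
    exact ⟨fun _ => hp₁, hQ⟩
  · simp [Fin.forall_fin_succ, ofList_eq_nil, Stream'.Seq.terminates_ofList, h₁.1, h₂.1]
  · simp [Fin.forall_fin_succ, ofList_eq_nil, Stream'.Seq.terminates_ofList, hp₁']

lemma isThreeStepVizingChain_three (he : c e = none) (h₁ : IsFanSegment c y₁ e l₁)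
    (hp₁ : IsPathSegment c z₁ a₁ b₁ (Stream'.Seq.ofList p₁)) (hp₁' : p₁ ≠ [])
    (h₂ : IsConditionalFanSegment c z₁ a₁ b₁ y₂ l₂)
    (hp₂ : IsPathSegment c z₂ a₂ b₂ (Stream'.Seq.ofList p₂)) (hp₂' : p₂ ≠ [])
    (h₃ : IsConditionalFanSegment c z₂ a₂ b₂ y₃ l₃)
    (hQ : Q ≠ .nil → IsPathSegment c z₃ a₃ b₃ Q) (hne : [y₁, z₁, y₂, z₂, y₃, z₃].Nodup)
    (haug : IsAugmenting c ((Stream'.Seq.ofList (l₁ ++ p₁ ++ l₂ ++ p₂ ++ l₃)).append Q)) :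
    IsThreeStepVizingChain c e ((Stream'.Seq.ofList (l₁ ++ p₁ ++ l₂ ++ p₂ ++ l₃)).append Q) := by
  simp only [List.nodup_cons, List.mem_cons, List.not_mem_nil, or_false, not_or,
    not_false_eq_true, List.nodup_nil, and_true] at hne
  obtain ⟨⟨h12, h13, h14, h15, h16⟩, ⟨h23, h24, h25, h26⟩, ⟨h34, h35, h36⟩, ⟨h45, h46⟩, h56⟩ := hne
  refine ⟨he, haug, ![Stream'.Seq.ofList l₁, Stream'.Seq.ofList l₂, Stream'.Seq.ofList l₃],
    ![Stream'.Seq.ofList p₁, Stream'.Seq.ofList p₂, Q], ![y₁, y₂, y₃],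
    ![z₁, z₂, z₃], ![a₁, a₂, a₃], ![b₁, b₂, b₃], ?_, ?_, ?_, ?_, ?_, ?_, ?_, ?_, ?_⟩
  · simp [Stream'.Seq.ofList_append, Stream'.Seq.append_assoc]
  · simp [Fin.forall_fin_succ, h13, h15, h35, Ne.symm h13, Ne.symm h15, Ne.symm h35]
  · simp [Fin.forall_fin_succ, h24, h26, h46, Ne.symm h24, Ne.symm h26, Ne.symm h46]
  · simp [Fin.forall_fin_succ, h12, h14, h16, Ne.symm h23, h34, h36, Ne.symm h25, Ne.symm h45, h56]
  · intro _
    exact h₁.2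
  · simp only [Fin.forall_fin_succ]
    simp
    exact ⟨fun _ => h₂.2, fun _ => h₃.2⟩
  · simp only [Fin.forall_fin_succ]
    simp
    exact ⟨fun _ => hp₁, fun _ => hp₂, hQ⟩
  · simp [Fin.forall_fin_succ, ofList_eq_nil, Stream'.Seq.terminates_ofList, h₁.1, h₂.1,
      h₃.1]
  · simp [Fin.forall_fin_succ, ofList_eq_nil, Stream'.Seq.terminates_ofList, hp₁', hp₂']

end Assemble

/-! ### Counting steps -/

section Counting

lemma encard_biUnion_le {ι α : Type*} {s : Set ι} {f : ι → Set α} {m n : ℕ} (hs : s.encard ≤ m)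
    (hf : ∀ i ∈ s, (f i).encard ≤ n) : (⋃ i ∈ s, f i).encard ≤ (m * n : ℕ) := by
  classical
  have hfin : s.Finite := Set.finite_of_encard_le_coe hs
  obtain ⟨t, rfl⟩ := hfin.exists_finset_coe
  rw [Set.encard_coe_eq_coe_finsetCard, Nat.cast_le] at hs
  have key : ∀ t : Finset ι, (∀ i ∈ t, (f i).encard ≤ n) →
      (⋃ i ∈ t, f i).encard ≤ (t.card * n : ℕ) := by
    intro t
    induction t using Finset.induction_on with
    | empty => simp
    | insert a t ha ih =>
      intro h
      rw [Finset.set_biUnion_insert, Finset.card_insert_of_notMem ha]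
      refine (Set.encard_union_le _ _).trans ?_
      have h1 := h a (by simp)
      have h2 := ih fun i hi => h i (by simp [hi])
      calc (f a).encard + (⋃ i ∈ t, f i).encard ≤ (n : ℕ∞) + (t.card * n : ℕ) := add_le_add h1 h2
        _ = ((t.card + 1) * n : ℕ) := by push_cast; ring
  refine (key t hf).trans ?_
  exact_mod_cast Nat.mul_le_mul_right n hs

variable {V : Type*} {G : SimpleGraph V} {d : ℕ} {c : G.edgeSet → Option (Fin (d + 1))}

lemma missing_nonempty (hd : ∀ v, (G.neighborSet v).encard ≤ d) (v : V) :
    (missing c v).Nonempty := by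
  by_contra hne
  rw [Set.not_nonempty_iff_eq_empty] at hne
  have hall : ∀ a, a ∉ missing c v := by simp [hne]
  choose e he hea using fun a => exists_colorNbr (hall a)
  have hinj : Function.Injective fun a => colorNbr c a v := by
    intro a b hab
    have : e a = e b := Subtype.ext (by rw [he, he]; exact congrArg (fun w => s(v, w)) hab)
    have h1 := hea a
    rw [this, hea b] at h1
    exact (Option.some.inj h1).symm
  have hsub : Set.range (fun a => colorNbr c a v) ⊆ G.neighborSet v := by
    rintro _ ⟨a, rfl⟩
    have := (e a).2
    rw [he] at this
    exact this
  have h1 := (Set.encard_le_encard hsub).trans (hd v)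
  rw [← Set.image_univ, hinj.encard_image, Set.encard_univ, ENat.card_eq_coe_fintype_card,
    Fintype.card_fin] at h1
  have : d + 1 ≤ d := by exact_mod_cast h1
  omega

lemma encard_edges_le (hd : ∀ v, (G.neighborSet v).encard ≤ d) (v : V) :
    {e : G.edgeSet | v ∈ e.1}.encard ≤ d := by
  classical
  have h1 : (Subtype.val '' {e : G.edgeSet | v ∈ e.1}).encard = {e : G.edgeSet | v ∈ e.1}.encard :=
    Subtype.val_injective.encard_image _
  rw [← h1]
  refine le_trans ?_ (hd v)
  rw [← Set.encard_congr (G.incidenceSetEquivNeighborSet v)]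
  apply Set.encard_le_encard
  rintro _ ⟨e, he, rfl⟩
  exact ⟨e.2, he⟩

/-- All these starts lie in one two-colored component and miss `b`, so each is an end of it. This is
why alternating paths can be traced backwards with bounded ambiguity. -/
lemma encard_pathStarts_le (hc : IsProper c) {a b : Fin (d + 1)} (v : V) :
    {z | b ∈ missing c z ∧ OnPath c z a b v}.encard ≤ 2 := by
  rcases Set.eq_empty_or_nonempty {z | b ∈ missing c z ∧ OnPath c z a b v} with h | ⟨z₀, hz₀, hv₀⟩
  · rw [h]
    simp
  · have hsub : {z | b ∈ missing c z ∧ OnPath c z a b v} ⊆ {z₀} ∪ {w | IsPathEnd c z₀ a b w} := by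
      rintro z ⟨hz, hv⟩
      have h1 := hv₀.start_mem hc hz₀ (Or.inl rfl) (Or.inr rfl) hv
      rcases h1.eq_or_isPathEnd (Or.inr rfl) hz with h | h
      · exact Or.inl h
      · exact Or.inr h
    refine (Set.encard_le_encard hsub).trans ((Set.encard_union_le _ _).trans ?_)
    have : {w | IsPathEnd c z₀ a b w}.encard ≤ 1 := by
      rw [Set.encard_le_one_iff]
      intro v w hv hw
      exact hv.unique hw
    rw [Set.encard_singleton]
    calc 1 + {w | IsPathEnd c z₀ a b w}.encard ≤ (1 : ℕ∞) + 1 := by gcongr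
      _ = 2 := by norm_num

/-- The vertex `v` is the `n`-th vertex of some alternating path that starts at `z`. -/
def PathStep (c : G.edgeSet → Option (Fin (d + 1))) (z : V) (n : ℕ) (v : V) : Prop :=
  ∃ a b, a ≠ b ∧ b ∈ missing c z ∧ PathValid c z a b n ∧ pathVertex c z a b n = v

/-- The vertex `v` is the `n`-th vertex of some alternating path that starts at a neighbor of `y`. -/
def Step (c : G.edgeSet → Option (Fin (d + 1))) (y : V) (n : ℕ) (v : V) : Prop :=
  ∃ z, ColoredAdj c y z ∧ PathStep c z n v

/-- The vertex `v` is the `n`-th vertex of some alternating path that starts near the edge `e`. -/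
def StartStep (c : G.edgeSet → Option (Fin (d + 1))) (e : G.edgeSet) (n : ℕ) (v : V) : Prop :=
  ∃ y z, y ∈ e.1 ∧ (ColoredAdj c y z ∨ e.1 = s(y, z)) ∧ PathStep c z n v

/-- The edge `f` lies on an alternating path that starts at a neighbor of `y`. -/
def EdgeStep (c : G.edgeSet → Option (Fin (d + 1))) (y : V) (f : G.edgeSet) : Prop :=
  ∃ z a b n, ColoredAdj c y z ∧ a ≠ b ∧ b ∈ missing c z ∧ ∃ h : PathValid c z a b (n + 1),
    f = pathEdge h

/-- The edge `f` may lie on the last alternating path of a 3-step Vizing chain at `e` that leaves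
its first two alternating paths at given positions. -/
def ChainStep (c : G.edgeSet → Option (Fin (d + 1))) (n₁ n₂ : ℕ) (e f : G.edgeSet) : Prop :=
  ∃ y₂ y₃, StartStep c e (n₁ + 2) y₂ ∧ Step c y₂ (n₂ + 2) y₃ ∧ EdgeStep c y₃ f

lemma ColoredAdj.adj {y z : V} (h : ColoredAdj c y z) : G.Adj y z := by
  obtain ⟨e, he, -⟩ := h
  have := e.2
  rwa [he] at this

/-- A bound for the number of vertices and positions from which one step leads to a given vertex. -/
def stepBound (d : ℕ) : ℕ := 2 * ((d + 1) * d) * d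

/-- There are `(d + 1) * d` ordered pairs of colors and at most two starts for each. The position is
determined by the start and `v`, so counting all positions jointly costs no further factor; the gain
of `M₁ M₂` in the final bound rests on this. -/
lemma encard_pathStep_le (hc : IsProper c) (v : V) :
    {p : V × ℕ | PathStep c p.1 p.2 v}.encard ≤ (2 * ((d + 1) * d) : ℕ) := by
  have hsub : {p : V × ℕ | PathStep c p.1 p.2 v} ⊆
      ⋃ q ∈ ((Finset.univ : Finset (Fin (d + 1))).offDiag : Set (Fin (d + 1) × Fin (d + 1))),
        ⋃ z ∈ {z | q.2 ∈ missing c z ∧ OnPath c z q.1 q.2 v},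
          {p : V × ℕ | p.1 = z ∧ q.1 ≠ q.2 ∧ q.2 ∈ missing c z ∧ PathValid c z q.1 q.2 p.2 ∧
            pathVertex c z q.1 q.2 p.2 = v} := by
    rintro ⟨z, n⟩ ⟨a, b, hab, hb, hv, rfl⟩
    simp only [Set.mem_iUnion]
    exact ⟨(a, b), by simp [hab], z, ⟨hb, n, hv, rfl⟩, rfl, hab, hb, hv, rfl⟩
  refine (Set.encard_le_encard hsub).trans ?_
  have h1 : ((Finset.univ : Finset (Fin (d + 1))).offDiag :
      Set (Fin (d + 1) × Fin (d + 1))).encard ≤ ((d + 1) * d : ℕ) := by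
    rw [Set.encard_coe_eq_coe_finsetCard, Finset.offDiag_card, Finset.card_univ, Fintype.card_fin,
      Nat.cast_le, Nat.mul_succ]
    simp
  refine (encard_biUnion_le h1 (n := 2 * 1) fun q _ => ?_).trans
    (le_of_eq (by push_cast; ring))
  refine encard_biUnion_le (m := 2) (encard_pathStarts_le hc v) fun z hz => ?_
  rw [Nat.cast_one, Set.encard_le_one_iff]
  rintro ⟨x, n⟩ ⟨x', n'⟩ ⟨h1, h2, h3, h4, h5⟩ ⟨h1', -, -, h4', h5'⟩
  simp only at h1 h2 h3 h4 h5 h1' h4' h5'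
  subst h1
  rw [h1', pathVertex_inj hc h2 h3 h4 h4' (h5.trans h5'.symm)]

lemma encard_step_le (hc : IsProper c) (hd : ∀ v, (G.neighborSet v).encard ≤ d) (v : V) :
    {p : V × ℕ | Step c p.1 p.2 v}.encard ≤ stepBound d := by
  have hsub : {p : V × ℕ | Step c p.1 p.2 v} ⊆
      ⋃ q ∈ {p : V × ℕ | PathStep c p.1 p.2 v}, (fun y => (y, q.2)) '' G.neighborSet q.1 := by
    rintro ⟨y, n⟩ ⟨z, hz, hv⟩
    simp only [Set.mem_iUnion]
    exact ⟨(z, n), hv, y, hz.adj.symm, rfl⟩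
  refine (Set.encard_le_encard hsub).trans (encard_biUnion_le (encard_pathStep_le hc v) ?_)
  intro q _
  exact (Set.encard_image_le _ _).trans (hd q.1)

lemma encard_startStep_le (hc : IsProper c) (hd : ∀ v, (G.neighborSet v).encard ≤ d) (v : V) :
    {p : G.edgeSet × ℕ | StartStep c p.1 p.2 v}.encard ≤ (stepBound d * d : ℕ) := by
  have hsub : {p : G.edgeSet × ℕ | StartStep c p.1 p.2 v} ⊆
      ⋃ q ∈ {p : V × ℕ | PathStep c p.1 p.2 v}, ⋃ y ∈ G.neighborSet q.1,
        (fun e => (e, q.2)) '' {e : G.edgeSet | y ∈ e.1} := by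
    rintro ⟨e, n⟩ ⟨y, z, hy, hz, hv⟩
    simp only [Set.mem_iUnion]
    refine ⟨(z, n), hv, y, ?_, e, hy, rfl⟩
    rcases hz with hz | hz
    · exact hz.adj.symm
    · have := e.2
      rw [hz] at this
      exact SimpleGraph.Adj.symm this
  refine (Set.encard_le_encard hsub).trans ?_
  rw [stepBound, mul_assoc]
  refine encard_biUnion_le (encard_pathStep_le hc v) fun q _ => ?_
  refine encard_biUnion_le (hd q.1) fun y _ => ?_
  exact (Set.encard_image_le _ _).trans (encard_edges_le hd y)

/-- A fixed vertex of `f` lies on every path through `f`, so the count for vertices applies. -/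
lemma encard_edgeStep_le (hc : IsProper c) (hd : ∀ v, (G.neighborSet v).encard ≤ d)
    (f : G.edgeSet) : {y | EdgeStep c y f}.encard ≤ stepBound d := by
  obtain ⟨⟨v, w⟩, hvw⟩ : ∃ p : V × V, f.1 = s(p.1, p.2) := by
    rcases f with ⟨f, hf⟩
    induction f with
    | h x y => exact ⟨(x, y), rfl⟩
  have hsub : {y | EdgeStep c y f} ⊆ Prod.fst '' {p : V × ℕ | Step c p.1 p.2 v} := by
    rintro y ⟨z, a, b, n, hz, hab, hb, h, rfl⟩
    rw [pathEdge_val, Sym2.eq_iff] at hvw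
    rcases hvw with ⟨h1, -⟩ | ⟨-, h1⟩
    · exact ⟨(y, n), ⟨z, hz, a, b, hab, hb, h.mono (by omega), h1⟩, rfl⟩
    · exact ⟨(y, n + 1), ⟨z, hz, a, b, hab, hb, h, h1⟩, rfl⟩
  exact (Set.encard_le_encard hsub).trans
    ((Set.encard_image_le _ _).trans (encard_step_le hc hd v))

lemma encard_chainStep_le (hc : IsProper c) (hd : ∀ v, (G.neighborSet v).encard ≤ d)
    (f : G.edgeSet) :
    {p : (ℕ × ℕ) × G.edgeSet | ChainStep c p.1.1 p.1.2 p.2 f}.encard ≤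
      (stepBound d * (stepBound d * (stepBound d * d)) : ℕ) := by
  have hsub : {p : (ℕ × ℕ) × G.edgeSet | ChainStep c p.1.1 p.1.2 p.2 f} ⊆
      ⋃ y₃ ∈ {y | EdgeStep c y f}, ⋃ q ∈ {p : V × ℕ | Step c p.1 p.2 y₃},
        -- `ChainStep` leaves its paths at the vertices of index `n₁ + 2` and `n₂ + 2`; the
        -- subtractions recover `n₁` and `n₂`.
        (fun r : G.edgeSet × ℕ => ((r.2 - 2, q.2 - 2), r.1)) ''
          {p : G.edgeSet × ℕ | StartStep c p.1 p.2 q.1} := by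
    rintro ⟨⟨n₁, n₂⟩, e⟩ ⟨y₂, y₃, h1, h2, h3⟩
    simp only [Set.mem_iUnion]
    exact ⟨y₃, h3, (y₂, n₂ + 2), h2, (e, n₁ + 2), h1, rfl⟩
  refine (Set.encard_le_encard hsub).trans ?_
  refine encard_biUnion_le (encard_edgeStep_le hc hd f) fun y₃ _ => ?_
  refine encard_biUnion_le (encard_step_le hc hd y₃) fun q _ => ?_
  exact (Set.encard_image_le _ _).trans (encard_startStep_le hc hd q.1)

/-- A bound for the number of unsuitable centers. -/
def badBound (d l : ℕ) : ℕ := 2 * l + 2 * l * d + d + 2 * l * stepBound d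

lemma encard_not_goodCenter_le (hc : IsProper c) (hd : ∀ v, (G.neighborSet v).encard ≤ d)
    (A : List G.edgeSet) (z : V) (a b : Fin (d + 1)) :
    {y | ¬ GoodCenter c A z a b y}.encard ≤ badBound d A.length := by
  classical
  set D : Set V := {v | ∃ h ∈ A, v ∈ h.1} with hD
  have hDcard : D.encard ≤ (2 * A.length : ℕ) := by
    have hsub : D ⊆ ⋃ h ∈ (A.toFinset : Set G.edgeSet), {v | v ∈ h.1} := by
      rintro v ⟨h, hh, hv⟩
      simp only [Set.mem_iUnion]
      exact ⟨h, by simpa using hh, hv⟩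
    refine (Set.encard_le_encard hsub).trans ?_
    rw [mul_comm]
    refine encard_biUnion_le ?_ ?_
    · rw [Set.encard_coe_eq_coe_finsetCard]
      exact_mod_cast A.toFinset_card_le
    · rintro ⟨h, -⟩ -
      induction h with
      | h x y =>
        have : {v | v ∈ s(x, y)} = {x, y} := by
          ext v
          simp
        rw [this]
        refine (Set.encard_insert_le _ _).trans ?_
        rw [Set.encard_singleton]
        norm_num
  have hends : {v | IsPathEnd c z a b v}.encard ≤ (1 : ℕ) := by
    rw [Nat.cast_one, Set.encard_le_one_iff]
    intro v w hv hw
    exact hv.unique hw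
  -- Four ways to be unsuitable: to lie on `A`, to be a neighbor of `A`, to be a neighbor of the
  -- path's end, or to reach `A` by one step. They give the four summands of `badBound`.
  have hsub : {y | ¬ GoodCenter c A z a b y} ⊆ ((D ∪ ⋃ v ∈ D, G.neighborSet v) ∪
      ⋃ v ∈ {v | IsPathEnd c z a b v}, G.neighborSet v) ∪
      ⋃ v ∈ D, Prod.fst '' {p : V × ℕ | Step c p.1 p.2 v} := by
    intro y hy
    by_contra hcon
    simp only [Set.mem_union, not_or, Set.mem_iUnion, not_exists] at hcon
    obtain ⟨⟨⟨h1, h2⟩, h3⟩, h4⟩ := hcon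
    apply hy
    refine ⟨?_, ?_, ?_, ?_⟩
    · intro h hh hyh
      exact h1 ⟨h, hh, hyh⟩
    · intro v hv h hh hvh
      exact h2 v ⟨h, hh, hvh⟩ hv.adj.symm
    · intro v hv hend
      exact h3 v hend hv.adj.symm
    · rintro z' a' b' hz' hab hb v ⟨n, hn, hnv⟩ h hh hvh
      exact h4 v ⟨h, hh, hvh⟩ ⟨(y, n), ⟨z', hz', a', b', hab, hb, hn, hnv⟩, rfl⟩
  refine (Set.encard_le_encard hsub).trans ?_
  have e2 : (⋃ v ∈ D, G.neighborSet v).encard ≤ (2 * A.length * d : ℕ) :=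
    encard_biUnion_le hDcard fun v _ => hd v
  have e3 : (⋃ v ∈ {v | IsPathEnd c z a b v}, G.neighborSet v).encard ≤ (1 * d : ℕ) :=
    encard_biUnion_le hends fun v _ => hd v
  have e4 : (⋃ v ∈ D, Prod.fst '' {p : V × ℕ | Step c p.1 p.2 v}).encard ≤
      (2 * A.length * stepBound d : ℕ) :=
    encard_biUnion_le hDcard fun v _ =>
      (Set.encard_image_le _ _).trans (encard_step_le hc hd v)
  refine (Set.encard_union_le _ _).trans ?_
  have hb : ((badBound d A.length : ℕ) : ℕ∞) = (((2 * A.length : ℕ) : ℕ∞) + (2 * A.length * d : ℕ) +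
      (1 * d : ℕ)) + (2 * A.length * stepBound d : ℕ) := by
    unfold badBound
    push_cast
    ring
  rw [hb]
  refine add_le_add ((Set.encard_union_le _ _).trans (add_le_add
    ((Set.encard_union_le _ _).trans (add_le_add hDcard e2)) e3)) e4

open Classical in
/-- Most positions on a long alternating path are suitable. -/
lemma card_goodCenter (hc : IsProper c) (hd : ∀ v, (G.neighborSet v).encard ≤ d)
    (A : List G.edgeSet) {z : V} {a b : Fin (d + 1)} (hab : a ≠ b) (hb : b ∈ missing c z) {M : ℕ}
    (hv : PathValid c z a b (M + 2)) :
    M ≤ ((Finset.range M).filter fun n =>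
      GoodCenter c A z a b (pathVertex c z a b (n + 2))).card + badBound d A.length := by
  have h1 := Finset.card_filter_add_card_filter_not (s := Finset.range M) fun n =>
      GoodCenter c A z a b (pathVertex c z a b (n + 2))
  rw [Finset.card_range] at h1
  have h2 : ((Finset.range M).filter fun n =>
      ¬ GoodCenter c A z a b (pathVertex c z a b (n + 2))).card ≤ badBound d A.length := by
    have h3 := encard_not_goodCenter_le hc hd A z a b
    have hinj : Set.InjOn (fun n => pathVertex c z a b (n + 2))
        (((Finset.range M).filter fun n =>
          ¬ GoodCenter c A z a b (pathVertex c z a b (n + 2)) : Finset ℕ) : Set ℕ) := by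
      intro i hi j hj h
      simp at hi hj
      have := pathVertex_inj hc hab hb (hv.mono (by omega)) (hv.mono (by omega)) h
      omega
    have h4 := hinj.encard_image
    rw [Set.encard_coe_eq_coe_finsetCard] at h4
    have h5 : ((fun n => pathVertex c z a b (n + 2)) ''
        (((Finset.range M).filter fun n =>
          ¬ GoodCenter c A z a b (pathVertex c z a b (n + 2)) : Finset ℕ) : Set ℕ)) ⊆
        {y | ¬ GoodCenter c A z a b y} := by
      rintro _ ⟨n, hn, rfl⟩
      simp at hn
      exact hn.2
    have := (Set.encard_le_encard h5).trans h3
    rw [h4] at this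
    exact_mod_cast this
  omega

end Counting

/-! ### Uncolored edges without light 3-step Vizing chains -/

section Heavy

variable {V : Type*} {G : SimpleGraph V} {d : ℕ} {c : G.edgeSet → Option (Fin (d + 1))}

/-- The total weight of the edges of a chain. -/
noncomputable def chainWeight (φ : G.edgeSet → ENNReal) (W : EdgeSeq G) : ENNReal :=
  ∑' f : {f // f ∈ W}, φ f

/-- All 3-step Vizing chains at the uncolored edge `e` are heavy, but short chains are light. -/
structure IsHeavy (c : G.edgeSet → Option (Fin (d + 1))) (e : G.edgeSet) (φ : G.edgeSet → ENNReal)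
    (L D : ℕ) : Prop where
  color : c e = none
  heavy : ∀ W, IsThreeStepVizingChain c e W → (L : ENNReal) < chainWeight φ W
  light : ∀ A : List G.edgeSet, IsShiftable c (Stream'.Seq.ofList A) → A.head? = some e →
    chainWeight φ (Stream'.Seq.ofList A) ≤ (D : ENNReal) ^ A.length

lemma Shifted.isShiftable {A : List G.edgeSet} {f : G.edgeSet} (h : Shifted c A f) :
    IsShiftable c (Stream'.Seq.ofList A) where
  chain := by
    intro n e g he hg
    rw [Stream'.Seq.ofList_get?] at he hg
    exact h.chain n e g he hg
  injective := edgeInjective_ofList h.nodup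
  first := by
    obtain ⟨e, l, rfl, he, -⟩ := h.first
    exact ⟨e, rfl, he⟩
  rest := by
    obtain ⟨e, l, rfl, -, hl⟩ := h.first
    intro n g hg
    rw [Stream'.Seq.ofList_get?, List.getElem?_cons_succ] at hg
    exact hl g (List.mem_of_getElem? hg)

lemma pathSeq_eq_ofList {z : V} {a b : Fin (d + 1)} {N : ℕ} (hN : ¬ PathValid c z a b (N + 1)) :
    pathSeq c z a b = Stream'.Seq.ofList (pathTake c z a b N) := by
  apply Stream'.Seq.ext
  intro i
  rw [Stream'.Seq.ofList_get?, pathTake, Stream'.Seq.getElem?_take]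
  split_ifs with hi
  · rfl
  · exact pathSeq_get?_of_not_valid fun h => hN (h.mono (by omega))

lemma isPathSegment_pathTake (hc : IsProper c) {z : V} {a b : Fin (d + 1)} (hab : a ≠ b)
    (hb : b ∈ missing c z) (n : ℕ) :
    IsPathSegment c z a b (Stream'.Seq.ofList (pathTake c z a b n)) := by
  refine ⟨_, isAlternatingPath_pathSeq hc hab hb, ?_⟩
  intro i e he
  rw [Stream'.Seq.ofList_get?, pathTake, Stream'.Seq.getElem?_take] at he
  split_ifs at he
  exact he

lemma isPathSegment_pathSeq (hc : IsProper c) {z : V} {a b : Fin (d + 1)} (hab : a ≠ b)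
    (hb : b ∈ missing c z) : IsPathSegment c z a b (pathSeq c z a b) :=
  ⟨_, isAlternatingPath_pathSeq hc hab hb, fun _ _ h => h⟩

lemma FanData.isFanSegment (hc : IsProper c) {y : V} {f : G.edgeSet} {u : ℕ → V}
    {E : ℕ → G.edgeSet} {N i : ℕ} (F : FanData c ∅ y f u E N)
    (hT : FanData.Terminal c ∅ y u E N) (hi : i ≤ N) : IsFanSegment c y f (fanList E i) := by
  refine ⟨by simp [fanList_eq], _, ⟨F.isFan, ?_⟩, isPrefix_fanSeq E hi⟩
  intro Q hQ hpre
  exact F.maximal hc hT hQ (by simp) hpre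

/-- The fan starts at the path edge of index `n + 1`, which has a predecessor, and validity up to `n
+ 3` provides a successor, so this edge is neither first nor last. -/
lemma FanData.isConditionalFanSegment (hc : IsProper c) {z : V} {a b : Fin (d + 1)} (hab : a ≠ b)
    (hb : b ∈ missing c z) {n : ℕ} (hn : PathValid c z a b (n + 3)) (hn2 : PathValid c z a b (n + 2))
    {u : ℕ → V} {E : ℕ → G.edgeSet} {N i : ℕ}
    (F : FanData c {a, b} (pathVertex c z a b (n + 2)) (pathEdge hn2) u E N)
    (hT : FanData.Terminal c {a, b} (pathVertex c z a b (n + 2)) u E N) (hi : i ≤ N) :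
    IsConditionalFanSegment c z a b (pathVertex c z a b (n + 2)) (fanList E i) := by
  have hn1 : PathValid c z a b (n + 1) := hn2.mono (by omega)
  refine ⟨by simp [fanList_eq], _, ⟨pathSeq c z a b, n, pathEdge hn1, pathEdge hn2,
    isAlternatingPath_pathSeq hc hab hb, pathSeq_get?_of_valid hn1, pathSeq_get?_of_valid hn2, ?_,
    ?_, ?_, ⟨F.isFan, ?_⟩, ?_⟩, isPrefix_fanSeq E hi⟩
  · rw [pathSeq_get?_of_valid hn]
    simp
  · rw [pathEdge_val]
    simp
  · rw [pathEdge_val, Sym2.mem_iff]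
    rintro (h | h)
    · have := pathVertex_inj hc hab hb hn2 (hn2.mono (by omega)) h
      omega
    · have := pathVertex_inj hc hab hb hn2 (hn2.mono (by omega)) h
      omega
  · intro m g v hg hm hv
    have := F.condition m g v hg hm hv
    exact ⟨this a (Or.inl rfl), this b (Or.inr rfl)⟩
  · intro Q hQ hpre
    refine F.maximal hc hT hQ.fan ?_ hpre
    rintro g hg hN v hv s (rfl | rfl)
    · exact (hQ.condition _ g v hg hN hv).1
    · exact (hQ.condition _ g v hg hN hv).2

lemma FanData.coloredAdj {S : Set (Fin (d + 1))} {y : V} {f : G.edgeSet} {u : ℕ → V}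
    {E : ℕ → G.edgeSet} {N i : ℕ} (F : FanData c S y f u E N) (hi : i ≤ N) :
    (c f ≠ none ∨ i ≠ 0) → ColoredAdj c y (u i) := by
  intro h
  refine ⟨E i, F.val i hi, ?_⟩
  rcases Nat.eq_zero_or_pos i with rfl | hpos
  · rw [F.zero]
    exact h.resolve_right (by simp)
  · obtain ⟨i, rfl⟩ : ∃ j, i = j + 1 := ⟨i - 1, by omega⟩
    obtain ⟨γ, h1, -⟩ := F.step i (by omega)
    rw [h1]
    simp

/-- The edge where path and fan meet is the last path edge in the construction by shifts, but the
first fan edge in the definition of a Vizing chain. -/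
lemma chain_eq {A : List G.edgeSet} {z : V} {a b : Fin (d + 1)} {n i : ℕ}
    (hn2 : PathValid c z a b (n + 2)) {E : ℕ → G.edgeSet} (h0 : E 0 = pathEdge hn2) :
    A ++ pathTake c z a b (n + 2) ++ fanTail E i =
      A ++ pathTake c z a b (n + 1) ++ fanList E i := by
  rw [fanList_eq, h0, pathTake_succ hn2]
  simp

namespace IsHeavy

variable {e : G.edgeSet} {φ : G.edgeSet → ENNReal} {L D T : ℕ}

lemma chainWeight_le (H : IsHeavy c e φ L D) (hD : 1 ≤ D) (hT : 2 * D ^ T ≤ L)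
    {A : List G.edgeSet} (hA : IsShiftable c (Stream'.Seq.ofList A)) (he : A.head? = some e)
    (hlen : A.length ≤ T) : 2 * chainWeight φ (Stream'.Seq.ofList A) ≤ L := by
  have h1 := H.light A hA he
  have h2 : 2 * D ^ A.length ≤ L :=
    le_trans (Nat.mul_le_mul_left 2 (Nat.pow_le_pow_right hD hlen)) hT
  calc 2 * chainWeight φ (Stream'.Seq.ofList A) ≤ 2 * (D : ENNReal) ^ A.length := by gcongr
    _ = ((2 * D ^ A.length : ℕ) : ENNReal) := by push_cast; rfl
    _ ≤ L := by exact_mod_cast h2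

lemma not_short (H : IsHeavy c e φ L D) (hD : 1 ≤ D) (hT : 2 * D ^ T ≤ L)
    {A : List G.edgeSet} (hA : IsThreeStepVizingChain c e (Stream'.Seq.ofList A))
    (he : A.head? = some e) : T < A.length := by
  by_contra hlen
  push Not at hlen
  have h1 := H.chainWeight_le hD hT hA.2.1.shiftable he hlen
  have h2 := H.heavy _ hA
  have h3 : chainWeight φ (Stream'.Seq.ofList A) ≤ 2 * chainWeight φ (Stream'.Seq.ofList A) := by
    rw [two_mul]
    exact le_self_add
  exact absurd (h2.trans_le (h3.trans h1)) (lt_irrefl _)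

/-- A path that ended before `M` edges would complete an augmenting chain with at most `T` edges,
which would be too light. -/
lemma pathValid (H : IsHeavy c e φ L D) (hD : 1 ≤ D) (hT : 2 * D ^ T ≤ L)
    {A : List G.edgeSet} {z : V} {a b : Fin (d + 1)} {M : ℕ}
    (hA : IsThreeStepVizingChain c e ((Stream'.Seq.ofList A).append (pathSeq c z a b)))
    (he : A.head? = some e) (hlen : A.length + M ≤ T) : PathValid c z a b M := by
  classical
  by_contra hM
  have hex : ∃ m, ¬ PathValid c z a b m := ⟨M, hM⟩
  obtain ⟨N, hN⟩ : ∃ N, Nat.find hex = N + 1 := by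
    apply Nat.exists_eq_succ_of_ne_zero
    intro h0
    have := Nat.find_spec hex
    rw [h0] at this
    exact this pathValid_zero
  have h1 : ¬ PathValid c z a b (N + 1) := hN ▸ Nat.find_spec hex
  have h2 : PathValid c z a b N := by
    by_contra h
    exact Nat.find_min hex (m := N) (by omega) h
  have h3 : N < M := by
    by_contra h
    exact hM (h2.mono (by omega))
  rw [pathSeq_eq_ofList h1, ← Stream'.Seq.ofList_append] at hA
  have h4 := H.not_short hD hT hA (by
    obtain ⟨l, rfl⟩ : ∃ l, A = e :: l := by
      cases A with
      | nil => simp at he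
      | cons x l =>
        simp at he
        exact ⟨l, by rw [he]⟩
    rfl)
  rw [List.length_append, length_pathTake h2] at h4
  omega

/-- A heavy edge sends much weight along the third alternating paths of its chains. -/
lemma exists_positions (H : IsHeavy c e φ L D) (hc : IsProper c)
    (hd : ∀ v, (G.neighborSet v).encard ≤ d) (hD : 1 ≤ D) (hT : 2 * D ^ T ≤ L) {M₁ M₂ : ℕ}
    (hlen : 3 * d + M₁ + M₂ + 10 ≤ T) :
    ∃ S₁ ⊆ Finset.range M₁, M₁ ≤ S₁.card + badBound d d ∧ ∀ n₁ ∈ S₁,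
      ∃ S₂ ⊆ Finset.range M₂, M₂ ≤ S₂.card + badBound d (M₁ + 2 * d + 2) ∧ ∀ n₂ ∈ S₂,
        (L : ENNReal) ≤ 2 * ∑' f : {f // ChainStep c n₁ n₂ e f}, φ f := by
  classical
  have hmiss := missing_nonempty (c := c) hd
  have hbad : ∀ l m, l ≤ m → badBound d l ≤ badBound d m := by
    intro l m h
    unfold badBound
    gcongr
  obtain ⟨y₁, w, hyw⟩ : ∃ y w, e.1 = s(y, w) := by
    rcases e with ⟨e, he⟩
    induction e with
    | h x y => exact ⟨x, y, rfl⟩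
  -- the first step
  obtain ⟨u₁, E₁, N₁, i₁, F₁, hT₁, hi₁, hO₁⟩ := exists_first_fan hc (hd y₁) hmiss hyw H.color
  have hlen₁ := F₁.succ_le (hd y₁)
  have hA₁ : [e] ++ fanTail E₁ i₁ = fanList E₁ i₁ := by rw [fanList_eq, F₁.zero]; rfl
  rw [FanOutcome, hA₁] at hO₁
  have hhead₁ : (fanList E₁ i₁).head? = some e := by rw [fanList_eq, F₁.zero]; rfl
  have hlenA₁ : (fanList E₁ i₁).length ≤ d := by
    rw [fanList_eq, List.length_cons, length_fanTail]
    omega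
  have hseg₁ := F₁.isFanSegment hc hT₁ hi₁
  have hyz₁ : y₁ ≠ u₁ i₁ := edge_ne _ (F₁.val i₁ hi₁)
  -- The fan cannot have an augmenting prefix, since that would be a light Vizing chain. The colors
  -- `0` belong to an empty piece and are placeholders.
  obtain ⟨a₁, b₁, R₁⟩ : ∃ a b, PathReady c (fanList E₁ i₁) y₁ (u₁ i₁) a b := by
    refine hO₁.resolve_left fun haug => ?_
    have hW := isThreeStepVizingChain_one (Q := .nil) (z₁ := u₁ i₁) (a₁ := 0) (b₁ := 0) H.color
      hseg₁ (by simp) hyz₁ (by rwa [Stream'.Seq.append_nil])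
    rw [Stream'.Seq.append_nil] at hW
    have := H.not_short hD hT hW hhead₁
    omega
  set A₁ := fanList E₁ i₁ with hA₁def
  set z₁ := u₁ i₁ with hz₁
  have hW₁ := isThreeStepVizingChain_one H.color hseg₁
    (fun _ => isPathSegment_pathSeq hc R₁.ne R₁.missing) hyz₁ (R₁.isAugmenting hc)
  have hv₁ : PathValid c z₁ a₁ b₁ (M₁ + 3) := H.pathValid hD hT hW₁ hhead₁ (by omega)
  refine ⟨(Finset.range M₁).filter fun n =>
      GoodCenter c A₁ z₁ a₁ b₁ (pathVertex c z₁ a₁ b₁ (n + 2)), Finset.filter_subset _ _,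
    (card_goodCenter hc hd A₁ R₁.ne R₁.missing (hv₁.mono (by omega))).trans
      (Nat.add_le_add_left (hbad _ _ hlenA₁) _), ?_⟩
  intro n₁ hn₁
  rw [Finset.mem_filter, Finset.mem_range] at hn₁
  obtain ⟨hn₁, hg₂⟩ := hn₁
  -- the second step
  have hvn₁ : PathValid c z₁ a₁ b₁ (n₁ + 3) := hv₁.mono (by omega)
  have hvn₁' : PathValid c z₁ a₁ b₁ (n₁ + 2) := hv₁.mono (by omega)
  obtain ⟨u₂, E₂, N₂, i₂, F₂, hT₂, hi₂, hO₂⟩ := exists_next_fan hc R₁ (hd _) hmiss hvn₁ hg₂ hvn₁'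
  have hlen₂ := F₂.succ_le (hd _)
  rw [FanOutcome, chain_eq hvn₁' F₂.zero] at hO₂
  have hseg₂ := F₂.isConditionalFanSegment hc R₁.ne R₁.missing hvn₁ hvn₁' hT₂ hi₂
  have hcadj₂ := F₂.coloredAdj hi₂ (Or.inl (by rw [color_pathEdge hvn₁']; simp))
  have hval₂ := F₂.val i₂ hi₂
  set y₂ := pathVertex c z₁ a₁ b₁ (n₁ + 2) with hy₂
  set z₂ := u₂ i₂ with hz₂
  set A₂ := A₁ ++ pathTake c z₁ a₁ b₁ (n₁ + 1) ++ fanList E₂ i₂ with hA₂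
  have hhead₂ : A₂.head? = some e := by
    rw [hA₂, hA₁def, fanList_eq, F₁.zero]
    rfl
  have hlenA₂ : A₂.length ≤ n₁ + 2 * d + 2 := by
    rw [hA₂, List.length_append, List.length_append, length_pathTake (hv₁.mono (by omega)),
      fanList_eq E₂, List.length_cons, length_fanTail]
    omega
  have hp₁ : pathTake c z₁ a₁ b₁ (n₁ + 1) ≠ [] := by
    apply List.ne_nil_of_length_pos
    rw [length_pathTake (hv₁.mono (by omega))]
    omega
  obtain ⟨f₁, hf₁, hS₁⟩ := R₁.shifted
  have hyz₂ : y₂ ≠ z₂ := edge_ne _ hval₂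
  have hnotin₂ : (y₁ ≠ y₂ ∧ z₁ ≠ y₂) ∧ y₁ ≠ z₂ ∧ z₁ ≠ z₂ := by
    have h1 := hg₂.center f₁ hS₁.mem_last
    have h2 := hg₂.nbr _ hcadj₂ f₁ hS₁.mem_last
    rw [hf₁, Sym2.mem_iff, not_or] at h1 h2
    exact ⟨⟨Ne.symm h1.1, Ne.symm h1.2⟩, Ne.symm h2.1, Ne.symm h2.2⟩
  have hnd₂ : [y₁, z₁, y₂, z₂].Nodup := by
    simp [hyz₁, hyz₂, hnotin₂.1.1, hnotin₂.1.2, hnotin₂.2.1, hnotin₂.2.2]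
  obtain ⟨a₂, b₂, R₂⟩ : ∃ a b, PathReady c A₂ y₂ z₂ a b := by
    refine hO₂.resolve_left fun haug => ?_
    have hW := isThreeStepVizingChain_two (Q := .nil) (z₂ := z₂) (a₂ := 0) (b₂ := 0) H.color
      hseg₁ (isPathSegment_pathTake hc R₁.ne R₁.missing _) hp₁ hseg₂ (by simp) hnd₂
      (by rwa [Stream'.Seq.append_nil])
    rw [Stream'.Seq.append_nil] at hW
    have : T < A₂.length := H.not_short hD hT hW hhead₂
    omega
  have hW₂ := isThreeStepVizingChain_two H.color
    hseg₁ (isPathSegment_pathTake hc R₁.ne R₁.missing _) hp₁ hseg₂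
    (fun _ => isPathSegment_pathSeq hc R₂.ne R₂.missing) hnd₂ (R₂.isAugmenting hc)
  have hv₂ : PathValid c z₂ a₂ b₂ (M₂ + 3) := 
    H.pathValid (A := A₂) hD hT hW₂ hhead₂ (by omega)
  refine ⟨(Finset.range M₂).filter fun n =>
      GoodCenter c A₂ z₂ a₂ b₂ (pathVertex c z₂ a₂ b₂ (n + 2)), Finset.filter_subset _ _,
    (card_goodCenter hc hd A₂ R₂.ne R₂.missing (hv₂.mono (by omega))).trans
      (Nat.add_le_add_left (hbad _ _ (by omega)) _), ?_⟩
  intro n₂ hn₂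
  rw [Finset.mem_filter, Finset.mem_range] at hn₂
  obtain ⟨hn₂, hg₃⟩ := hn₂
  -- the third step
  have hvn₂ : PathValid c z₂ a₂ b₂ (n₂ + 3) := hv₂.mono (by omega)
  have hvn₂' : PathValid c z₂ a₂ b₂ (n₂ + 2) := hv₂.mono (by omega)
  obtain ⟨u₃, E₃, N₃, i₃, F₃, hT₃, hi₃, hO₃⟩ := exists_next_fan hc R₂ (hd _) hmiss hvn₂ hg₃ hvn₂'
  have hlen₃ := F₃.succ_le (hd _)
  rw [FanOutcome, chain_eq hvn₂' F₃.zero] at hO₃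
  have hseg₃ := F₃.isConditionalFanSegment hc R₂.ne R₂.missing hvn₂ hvn₂' hT₃ hi₃
  have hcadj₃ := F₃.coloredAdj hi₃ (Or.inl (by rw [color_pathEdge hvn₂']; simp))
  have hval₃ := F₃.val i₃ hi₃
  set y₃ := pathVertex c z₂ a₂ b₂ (n₂ + 2) with hy₃
  set z₃ := u₃ i₃ with hz₃
  set A₃ := A₂ ++ pathTake c z₂ a₂ b₂ (n₂ + 1) ++ fanList E₃ i₃ with hA₃
  have hhead₃ : A₃.head? = some e := by
    rw [hA₃, hA₂, hA₁def, fanList_eq, F₁.zero]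
    rfl
  have hlenA₃ : A₃.length ≤ T := by
    rw [hA₃, List.length_append, List.length_append, length_pathTake (hv₂.mono (by omega)),
      fanList_eq E₃, List.length_cons, length_fanTail]
    omega
  have hp₂ : pathTake c z₂ a₂ b₂ (n₂ + 1) ≠ [] := by
    apply List.ne_nil_of_length_pos
    rw [length_pathTake (hv₂.mono (by omega))]
    omega
  obtain ⟨f₂, hf₂, hS₂⟩ := R₂.shifted
  have hyz₃ : y₃ ≠ z₃ := edge_ne _ hval₃
  have hnotin₃ : (y₂ ≠ y₃ ∧ z₂ ≠ y₃) ∧ y₂ ≠ z₃ ∧ z₂ ≠ z₃ := by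
    have h1 := hg₃.center f₂ hS₂.mem_last
    have h2 := hg₃.nbr _ hcadj₃ f₂ hS₂.mem_last
    rw [hf₂, Sym2.mem_iff, not_or] at h1 h2
    exact ⟨⟨Ne.symm h1.1, Ne.symm h1.2⟩, Ne.symm h2.1, Ne.symm h2.2⟩
  have hnotin₃' : (y₁ ≠ y₃ ∧ z₁ ≠ y₃) ∧ y₁ ≠ z₃ ∧ z₁ ≠ z₃ := by
    have hm : f₁ ∈ A₂ := by simp [hA₂, hS₁.mem_last]
    have h1 := hg₃.center f₁ hm
    have h2 := hg₃.nbr _ hcadj₃ f₁ hm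
    rw [hf₁, Sym2.mem_iff, not_or] at h1 h2
    exact ⟨⟨Ne.symm h1.1, Ne.symm h1.2⟩, Ne.symm h2.1, Ne.symm h2.2⟩
  have hnd₃ : [y₁, z₁, y₂, z₂, y₃, z₃].Nodup := by
    simp [hyz₁, hyz₂, hyz₃, hnotin₂.1.1, hnotin₂.1.2, hnotin₂.2.1, hnotin₂.2.2, hnotin₃.1.1,
      hnotin₃.1.2, hnotin₃.2.1, hnotin₃.2.2, hnotin₃'.1.1, hnotin₃'.1.2, hnotin₃'.2.1,
      hnotin₃'.2.2]
  obtain ⟨a₃, b₃, R₃⟩ : ∃ a b, PathReady c A₃ y₃ z₃ a b := by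
    refine hO₃.resolve_left fun haug => ?_
    have hW := isThreeStepVizingChain_three (Q := .nil) (z₃ := z₃) (a₃ := 0) (b₃ := 0) H.color
      hseg₁ (isPathSegment_pathTake hc R₁.ne R₁.missing _) hp₁ hseg₂
      (isPathSegment_pathTake hc R₂.ne R₂.missing _) hp₂ hseg₃ (by simp) hnd₃
      (by rwa [Stream'.Seq.append_nil])
    rw [Stream'.Seq.append_nil] at hW
    have : T < A₃.length := H.not_short hD hT hW hhead₃
    omega
  have hW₃ := isThreeStepVizingChain_three H.color
    hseg₁ (isPathSegment_pathTake hc R₁.ne R₁.missing _) hp₁ hseg₂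
    (isPathSegment_pathTake hc R₂.ne R₂.missing _) hp₂ hseg₃
    (fun _ => isPathSegment_pathSeq hc R₃.ne R₃.missing) hnd₃ (R₃.isAugmenting hc)
  have hheavy := H.heavy _ hW₃
  obtain ⟨f₃, hf₃, hS₃⟩ := R₃.shifted
  have hlight := H.chainWeight_le hD hT hS₃.isShiftable hhead₃ hlenA₃
  -- The chain consists of `A₃`, of weight at most `L / 2`, and the third path, all of whose edges
  -- are related to `e` by `ChainStep`. These must therefore make up the remaining `L / 2`.
  have hsub : {f | f ∈ (Stream'.Seq.ofList A₃).append (pathSeq c z₃ a₃ b₃)} ⊆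
      {f | f ∈ Stream'.Seq.ofList A₃} ∪ {f | ChainStep c n₁ n₂ e f} := by
    intro f hf
    rcases Stream'.Seq.of_mem_append hf with h | h
    · exact Or.inl h
    · right
      obtain ⟨i, hi⟩ := Stream'.Seq.mem_iff_exists_get?.1 h
      obtain ⟨hv, rfl⟩ := pathSeq_get?_eq_some hi.symm
      refine ⟨y₂, y₃, ⟨y₁, z₁, by rw [hyw]; simp, ?_, a₁, b₁, R₁.ne, R₁.missing, hvn₁', rfl⟩,
        ⟨z₂, hcadj₂, a₂, b₂, R₂.ne, R₂.missing, hvn₂', rfl⟩,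
        ⟨z₃, a₃, b₃, i, hcadj₃, R₃.ne, R₃.missing, hv, rfl⟩⟩
      -- If the fan prefix is just the uncolored edge `e`, then `z₁` is the other vertex of `e` and
      -- the `ColoredAdj` alternative is not guaranteed; hence the second alternative in
      -- `StartStep`.
      rcases Nat.eq_zero_or_pos i₁ with h0 | h0
      · right
        rw [← F₁.zero, F₁.val 0 (by omega), hz₁, h0]
      · exact Or.inl (F₁.coloredAdj hi₁ (Or.inr (by omega)))
  have hle : chainWeight φ ((Stream'.Seq.ofList A₃).append (pathSeq c z₃ a₃ b₃)) ≤
      chainWeight φ (Stream'.Seq.ofList A₃) + ∑' f : {f // ChainStep c n₁ n₂ e f}, φ f := by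
    refine (ENNReal.tsum_mono_subtype φ hsub).trans ?_
    exact ENNReal.tsum_union_le φ _ _
  have h1 : (L : ENNReal) + L ≤ L + 2 * ∑' f : {f // ChainStep c n₁ n₂ e f}, φ f := by
    calc (L : ENNReal) + L = 2 * L := (two_mul _).symm
      _ ≤ 2 * (chainWeight φ (Stream'.Seq.ofList A₃) +
          ∑' f : {f // ChainStep c n₁ n₂ e f}, φ f) := by
        gcongr
        exact hheavy.le.trans hle
      _ = 2 * chainWeight φ (Stream'.Seq.ofList A₃) +
          2 * ∑' f : {f // ChainStep c n₁ n₂ e f}, φ f := mul_add _ _ _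
      _ ≤ _ := by gcongr
  exact (ENNReal.add_le_add_iff_left (ENNReal.natCast_ne_top L)).1 h1

end IsHeavy

end Heavy

/-! ### Borel maps that are finite-to-one -/

section Borel

/-- A space that embeds measurably into a standard Borel space is standard Borel. -/
lemma standardBorelSpace_of_measurableEmbedding {X Y : Type*} [MeasurableSpace X]
    [MeasurableSpace Y] [StandardBorelSpace Y] {f : X → Y} (hf : MeasurableEmbedding f) :
    StandardBorelSpace X := by
  have := hf.measurableSet_range.standardBorel
  let e := hf.equivRange
  let := upgradeStandardBorel (Set.range f)
  let tX : TopologicalSpace X := TopologicalSpace.induced e inferInstance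
  refine ⟨tX, ⟨?_⟩, e.toEquiv.polishSpace_induced⟩
  have h1 : ‹MeasurableSpace X› = MeasurableSpace.comap e inferInstance :=
    e.measurableEmbedding.comap_eq.symm
  have h2 := eq_borel_upgradeStandardBorel (Set.range f)
  rw [h1]
  exact (congrArg (MeasurableSpace.comap (e : X → Set.range f)) h2).trans borel_comap.symm

/-- A Borel map with fibers of bounded size is injective on the members of a countable Borel
partition. -/
lemma exists_injOn_cover {X Y : Type*} [MeasurableSpace X] [StandardBorelSpace X]
    [MeasurableSpace Y] [StandardBorelSpace Y] {f : X → Y} (hf : Measurable f) (K : ℕ) :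
    ∀ C : Set X, MeasurableSet C → (∀ y, {x ∈ C | f x = y}.encard ≤ K) →
      ∃ S : ℕ → Set X, (∀ n, MeasurableSet (S n)) ∧ (∀ n, Set.InjOn f (S n)) ∧ C = ⋃ n, S n := by
  induction K with
  | zero =>
    intro C _ hK
    refine ⟨fun _ => ∅, fun _ => MeasurableSet.empty, fun _ => Set.injOn_empty f, ?_⟩
    rw [Set.iUnion_empty]
    rw [Set.eq_empty_iff_forall_notMem]
    intro x hx
    have h1 := hK (f x)
    rw [Nat.cast_zero, nonpos_iff_eq_zero, Set.encard_eq_zero] at h1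
    exact (h1 ▸ (⟨hx, rfl⟩ : x ∈ {x' ∈ C | f x' = f x}) : x ∈ (∅ : Set X))
  | succ K ih =>
    intro C hC hK
    set r : X → ℝ := embeddingReal X
    have hr : Measurable r := measurable_embeddingReal X
    have hrinj : Function.Injective r := (measurableEmbedding_embeddingReal X).injective
    -- `Z` lists the fibers of maximal size `K + 1` in increasing order of a Borel injection into
    -- the reals, so each of them occurs as exactly one tuple.
    set Z : Set (Fin (K + 1) → X) := {t | (∀ i, t i ∈ C) ∧ (∀ i, f (t i) = f (t 0)) ∧
      ∀ i j, i < j → r (t i) < r (t j)} with hZ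
    have hZm : MeasurableSet Z := by
      have e : Z = (⋂ i, (fun t : Fin (K + 1) → X => t i) ⁻¹' C) ∩
          ((⋂ i, {t : Fin (K + 1) → X | f (t i) = f (t 0)}) ∩
          ⋂ i, ⋂ j, ⋂ _ : i < j, {t : Fin (K + 1) → X | r (t i) < r (t j)}) := by
        ext t
        simp [hZ]
      rw [e]
      refine (MeasurableSet.iInter fun i => measurable_pi_apply i hC).inter
        ((MeasurableSet.iInter fun i => ?_).inter
        (MeasurableSet.iInter fun i => MeasurableSet.iInter fun j => MeasurableSet.iInter fun _ => ?_))
      · exact measurableSet_eq_fun (hf.comp (measurable_pi_apply i))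
          (hf.comp (measurable_pi_apply 0))
      · exact measurableSet_lt (hr.comp (measurable_pi_apply i)) (hr.comp (measurable_pi_apply j))
    have hfib : ∀ t ∈ Z, Set.range t = {x ∈ C | f x = f (t 0)} := by
      intro t ht
      have hinj : Function.Injective t := by
        intro i j hij
        rcases lt_trichotomy i j with h | h | h
        · exact absurd (ht.2.2 i j h) (by rw [hij]; exact lt_irrefl _)
        · exact h
        · exact absurd (ht.2.2 j i h) (by rw [hij]; exact lt_irrefl _)
      have hsub : Set.range t ⊆ {x ∈ C | f x = f (t 0)} := by
        rintro _ ⟨i, rfl⟩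
        exact ⟨ht.1 i, ht.2.1 i⟩
      refine Set.Finite.eq_of_subset_of_encard_le' (Set.finite_of_encard_le_coe (hK _)) hsub ?_
      refine (hK _).trans ?_
      rw [← Set.image_univ, hinj.encard_image, Set.encard_univ, ENat.card_eq_coe_fintype_card,
        Fintype.card_fin]
    have huniq : ∀ t ∈ Z, ∀ t' ∈ Z, f (t 0) = f (t' 0) → t = t' := by
      intro t ht t' ht' h
      have h1 : Set.range t = Set.range t' := by rw [hfib t ht, hfib t' ht', h]
      have h2 : r ∘ t = r ∘ t' := by
        apply (StrictMono.range_inj (f := r ∘ t) (g := r ∘ t') (fun i j hij => ht.2.2 i j hij)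
          fun i j hij => ht'.2.2 i j hij).1
        rw [Set.range_comp, Set.range_comp, h1]
      exact hrinj.comp_left h2
    -- The `i`-th points of these fibers. A coordinate is injective on `Z`, so `P i` is Borel by the
    -- Lusin–Souslin theorem.
    set P : Fin (K + 1) → Set X := fun i => (fun t : Fin (K + 1) → X => t i) '' Z with hP
    have hPm : ∀ i, MeasurableSet (P i) := by
      intro i
      refine hZm.image_of_measurable_injOn (measurable_pi_apply i) ?_
      intro t ht t' ht' h
      refine huniq t ht t' ht' ?_
      rw [← ht.2.1 i, ← ht'.2.1 i]
      exact congrArg f h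
    have hPinj : ∀ i, Set.InjOn f (P i) := by
      rintro i _ ⟨t, ht, rfl⟩ _ ⟨t', ht', rfl⟩ h
      have : f (t i) = f (t' i) := h
      rw [ht.2.1 i, ht'.2.1 i] at this
      change t i = t' i
      rw [huniq t ht t' ht' this]
    have hPC : ∀ i, P i ⊆ C := by
      rintro i _ ⟨t, ht, rfl⟩
      exact ht.1 i
    set C' : Set X := C \ ⋃ i, P i with hC'
    have hC'm : MeasurableSet C' := hC.diff (MeasurableSet.iUnion hPm)
    -- After removal of the full fibers at most `K` points remain in each fiber: `K + 1` of them,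
    -- sorted, would form a tuple of `Z`, whose entries have been removed.
    obtain ⟨S, hS, hSinj, hSC⟩ := ih C' hC'm (by
      intro y
      by_contra hlt
      push Not at hlt
      have hge : ((K + 1 : ℕ) : ℕ∞) ≤ {x ∈ C' | f x = y}.encard := by
        push_cast
        exact Order.add_one_le_of_lt hlt
      obtain ⟨A, hA, hAcard⟩ := Set.exists_subset_encard_eq hge
      have hAfin : A.Finite := Set.finite_of_encard_eq_coe hAcard
      obtain ⟨A, rfl⟩ := hAfin.exists_finset_coe
      rw [Set.encard_coe_eq_coe_finsetCard, Nat.cast_inj] at hAcard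
      classical
      have hBcard : (A.image r).card = K + 1 := by
        rw [Finset.card_image_of_injective _ hrinj, hAcard]
      set o := (A.image r).orderEmbOfFin hBcard
      have hmem : ∀ i, ∃ x ∈ A, r x = o i := by
        intro i
        exact Finset.mem_image.1 ((A.image r).orderEmbOfFin_mem hBcard i)
      choose t htA ht using hmem
      have htC : ∀ i, t i ∈ C' ∧ f (t i) = y := fun i => hA (htA i)
      have htZ : t ∈ Z := by
        refine ⟨fun i => (htC i).1.1, fun i => (htC i).2.trans (htC 0).2.symm, fun i j hij => ?_⟩
        rw [ht, ht]
        exact o.strictMono hij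
      exact (htC 0).1.2 (Set.mem_iUnion.2 ⟨0, t, htZ, rfl⟩))
    refine ⟨fun n => if h : n < K + 1 then P ⟨n, h⟩ else S (n - (K + 1)), ?_, ?_, ?_⟩
    · intro n
      by_cases h : n < K + 1
      · simp only [h, dif_pos]
        exact hPm _
      · simp only [h]
        exact hS _
    · intro n
      by_cases h : n < K + 1
      · simp only [h, dif_pos]
        exact hPinj _
      · simp only [h]
        exact hSinj _
    · apply Set.Subset.antisymm
      · intro x hx
        by_cases hxP : x ∈ ⋃ i, P i
        · obtain ⟨i, hi⟩ := Set.mem_iUnion.1 hxP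
          refine Set.mem_iUnion.2 ⟨i.1, ?_⟩
          rw [dif_pos i.2]
          exact hi
        · have : x ∈ C' := ⟨hx, hxP⟩
          rw [hSC] at this
          obtain ⟨n, hn⟩ := Set.mem_iUnion.1 this
          refine Set.mem_iUnion.2 ⟨n + (K + 1), ?_⟩
          rw [dif_neg (by omega), Nat.add_sub_cancel]
          exact hn
      · refine Set.iUnion_subset fun n => ?_
        by_cases h : n < K + 1
        · rw [dif_pos h]
          exact hPC _
        · rw [dif_neg h]
          refine (Set.subset_iUnion S _).trans ?_
          rw [← hSC]
          exact Set.sdiff_subset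

end Borel

/-! ### Borel structure of the edge set -/

section Edges

variable {V : Type*} [MeasurableSpace V]

lemma measurable_sym2_of_comp {Y : Type*} [MeasurableSpace Y] {f : Sym2 V → Y}
    (h : Measurable fun p : V × V => f s(p.1, p.2)) : Measurable f := fun _ hs => h hs

lemma measurable_sym2_mk : Measurable fun p : V × V => s(p.1, p.2) := fun _ hs => hs

variable [StandardBorelSpace V]

open Classical in
/-- The smaller vertex of an unordered pair for a fixed Borel linear order. -/
noncomputable def minVertex : Sym2 V → V :=
  Sym2.lift ⟨fun x y => if embeddingReal V x ≤ embeddingReal V y then x else y, by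
    intro x y
    have hinj := (measurableEmbedding_embeddingReal V).injective
    rcases lt_trichotomy (embeddingReal V x) (embeddingReal V y) with h | h | h
    · simp [h.le, not_le.2 h]
    · simp [hinj h]
    · simp [h.le, not_le.2 h]⟩

open Classical in
/-- The larger vertex of an unordered pair for a fixed Borel linear order. -/
noncomputable def maxVertex : Sym2 V → V :=
  Sym2.lift ⟨fun x y => if embeddingReal V x ≤ embeddingReal V y then y else x, by
    intro x y
    have hinj := (measurableEmbedding_embeddingReal V).injective
    rcases lt_trichotomy (embeddingReal V x) (embeddingReal V y) with h | h | h
    · simp [h.le, not_le.2 h]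
    · simp [hinj h]
    · simp [h.le, not_le.2 h]⟩

open Classical in
lemma minVertex_mk (x y : V) :
    minVertex s(x, y) = if embeddingReal V x ≤ embeddingReal V y then x else y := rfl

open Classical in
lemma maxVertex_mk (x y : V) :
    maxVertex s(x, y) = if embeddingReal V x ≤ embeddingReal V y then y else x := rfl

lemma mk_minVertex_maxVertex (e : Sym2 V) : s(minVertex e, maxVertex e) = e := by
  induction e with
  | h x y =>
    rw [minVertex_mk, maxVertex_mk]
    split_ifs
    · rfl
    · exact Sym2.eq_swap

lemma measurable_minVertex : Measurable (minVertex : Sym2 V → V) := by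
  classical
  apply measurable_sym2_of_comp
  simp only [minVertex_mk]
  have hr := measurable_embeddingReal V
  exact Measurable.ite (measurableSet_le (hr.comp measurable_fst) (hr.comp measurable_snd))
    measurable_fst measurable_snd

lemma measurable_maxVertex : Measurable (maxVertex : Sym2 V → V) := by
  classical
  apply measurable_sym2_of_comp
  simp only [maxVertex_mk]
  have hr := measurable_embeddingReal V
  exact Measurable.ite (measurableSet_le (hr.comp measurable_fst) (hr.comp measurable_snd))
    measurable_snd measurable_fst

/-- Sorting the two vertices by a Borel injection into the reals identifies unordered pairs with a
Borel half of `V × V`. -/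
instance : StandardBorelSpace (Sym2 V) := by
  have hr := measurable_embeddingReal V
  refine standardBorelSpace_of_measurableEmbedding (Y := V × V)
    (f := fun e => (minVertex e, maxVertex e)) ?_
  refine MeasurableEmbedding.of_measurable_inverse
    (g := fun p => s(p.1, p.2)) (measurable_minVertex.prodMk measurable_maxVertex) ?_
    measurable_sym2_mk mk_minVertex_maxVertex
  have : Set.range (fun e : Sym2 V => (minVertex e, maxVertex e)) =
      {p | embeddingReal V p.1 ≤ embeddingReal V p.2} := by
    ext ⟨x, y⟩
    constructor
    · rintro ⟨e, he⟩
      induction e with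
      | h a b =>
        simp only [minVertex_mk, maxVertex_mk] at he
        rw [Prod.mk.injEq] at he
        obtain ⟨rfl, rfl⟩ := he
        change embeddingReal V _ ≤ embeddingReal V _
        split_ifs with h
        · exact h
        · exact (not_le.1 h).le
    · intro h
      have h : embeddingReal V x ≤ embeddingReal V y := h
      exact ⟨s(x, y), by simp [minVertex_mk, maxVertex_mk, h]⟩
  rw [this]
  exact measurableSet_le (hr.comp measurable_fst) (hr.comp measurable_snd)

end Edges

/-! ### Relations given by countably many partial Borel maps -/

section Relation

/-- The relation `R` is the union of the graphs of countably many partial Borel maps. -/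
def IsCountablyFunctional {X Y : Type*} [MeasurableSpace X] [MeasurableSpace Y]
    (R : X → Y → Prop) : Prop :=
  ∃ (ι : Type) (_ : Countable ι) (S : ι → Set X) (g : ι → X → Y), (∀ i, MeasurableSet (S i)) ∧
    (∀ i, Measurable (g i)) ∧ ∀ x y, R x y ↔ ∃ i, x ∈ S i ∧ g i x = y

variable {X Y Z : Type*} [MeasurableSpace X] [MeasurableSpace Y] [MeasurableSpace Z]

namespace IsCountablyFunctional

lemma of_measurable {g : X → Y} (hg : Measurable g) {S : Set X} (hS : MeasurableSet S) :
    IsCountablyFunctional fun x y => x ∈ S ∧ g x = y :=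
  ⟨Unit, inferInstance, fun _ => S, fun _ => g, fun _ => hS, fun _ => hg, fun x y => by simp⟩

lemma congr {R R' : X → Y → Prop} (h : IsCountablyFunctional R) (h' : ∀ x y, R' x y ↔ R x y) :
    IsCountablyFunctional R' := by
  have : R' = R := by
    ext x y
    exact h' x y
  rwa [this]

lemma exists_of_countable {κ : Type} [Countable κ] {R : κ → X → Y → Prop}
    (h : ∀ i, IsCountablyFunctional (R i)) : IsCountablyFunctional fun x y => ∃ i, R i x y := by
  choose ι hι S g hS hg hR using h
  refine ⟨Σ i, ι i, inferInstance, fun p => S p.1 p.2, fun p => g p.1 p.2, fun p => hS _ _,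
    fun p => hg _ _, fun x y => ?_⟩
  constructor
  · rintro ⟨i, hi⟩
    obtain ⟨j, hj⟩ := (hR i x y).1 hi
    exact ⟨⟨i, j⟩, hj⟩
  · rintro ⟨⟨i, j⟩, hj⟩
    exact ⟨i, (hR i x y).2 ⟨j, hj⟩⟩

lemma or {R R' : X → Y → Prop} (h : IsCountablyFunctional R) (h' : IsCountablyFunctional R') :
    IsCountablyFunctional fun x y => R x y ∨ R' x y := by
  refine (exists_of_countable (κ := Bool) (R := fun b => if b then R else R') ?_).congr ?_
  · intro b
    cases b
    · exact h'
    · exact h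
  · intro x y
    simp [or_comm]

lemma comp {R : X → Y → Prop} {R' : Y → Z → Prop} (h : IsCountablyFunctional R)
    (h' : IsCountablyFunctional R') : IsCountablyFunctional fun x z => ∃ y, R x y ∧ R' y z := by
  obtain ⟨ι, hι, S, g, hS, hg, hR⟩ := h
  obtain ⟨ι', hι', S', g', hS', hg', hR'⟩ := h'
  refine ⟨ι × ι', inferInstance, fun p => S p.1 ∩ g p.1 ⁻¹' S' p.2, fun p => g' p.2 ∘ g p.1,
    fun p => (hS _).inter (hg _ (hS' _)), fun p => (hg' _).comp (hg _), fun x z => ?_⟩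
  constructor
  · rintro ⟨y, h1, h2⟩
    obtain ⟨i, hi, rfl⟩ := (hR x y).1 h1
    obtain ⟨j, hj, rfl⟩ := (hR' _ z).1 h2
    exact ⟨(i, j), ⟨hi, hj⟩, rfl⟩
  · rintro ⟨⟨i, j⟩, ⟨hi, hj⟩, rfl⟩
    exact ⟨g i x, (hR _ _).2 ⟨i, hi, rfl⟩, (hR' _ _).2 ⟨j, hj, rfl⟩⟩

end IsCountablyFunctional

variable {F : X → X → Prop} {ν : Measure X} {ρ : X → X → ℝ}

/-- As `ρ` is Borel on the subtype `F` only, the function is formed on `C` and then extended by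
zero. -/
lemma IsRadonNikodymCocycle.measurable_indicator (hρ : IsRadonNikodymCocycle F ν ρ) {C : Set X}
    (hC : MeasurableSet C) {g : X → X} (hg : Measurable g) (hF : ∀ x ∈ C, F x (g x)) :
    Measurable (C.indicator fun x => ENNReal.ofReal (ρ x (g x))) := by
  classical
  have h : Measurable fun x : C => ENNReal.ofReal (ρ x (g x)) :=
    (hρ.measurable.comp (Measurable.subtype_mk
      (p := fun p : X × X => F p.1 p.2) (f := fun x : C => ((x : X), g x))
      (measurable_subtype_coe.prodMk (hg.comp measurable_subtype_coe))
      (h := fun x => hF x x.2))).ennreal_ofReal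
  have h' := Measurable.dite h (g := fun _ => 0) measurable_const hC
  convert h' using 2 with x
  by_cases hx : x ∈ C <;> simp [hx]

/-- The map `g` increases the measure at most by the factor `r` where it is injective. -/
def ScalesMeasure (ν : Measure X) (g : X → X) (r : ENNReal) : Prop :=
  ∀ C, MeasurableSet C → Set.InjOn g C → ν (g '' C) ≤ r * ν C

lemma scalesMeasure_id : ScalesMeasure ν id 1 := fun C _ _ => by simp

variable [StandardBorelSpace X]

/-- Mass transport along a relation that is countably functional and finite-to-one. -/
lemma IsRadonNikodymCocycle.exists_transport (hρ : IsRadonNikodymCocycle F ν ρ)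
    {R : X → X → Prop} (hR : IsCountablyFunctional R) (hF : ∀ x y, R x y → F x y) {K : ℕ}
    (hK : ∀ y, {x | R x y}.encard ≤ K) :
    ∃ k N : X → ENNReal, Measurable k ∧ Measurable N ∧
      (∀ x, ∑' y : {y // R x y}, ENNReal.ofReal (ρ x y) ≤ k x) ∧
      (∀ y, N y ≤ ({x | R x y}.encard : ENNReal)) ∧ ∫⁻ x, k x ∂ν ≤ ∫⁻ y, N y ∂ν := by
  obtain ⟨ι, hι, S, g, hS, hg, hRS⟩ := hR
  have hcov : ∀ i, ∃ T : ℕ → Set X, (∀ n, MeasurableSet (T n)) ∧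
      (∀ n, Set.InjOn (g i) (T n)) ∧ S i = ⋃ n, T n := by
    intro i
    refine exists_injOn_cover (hg i) K (S i) (hS i) fun y => ?_
    refine (Set.encard_le_encard ?_).trans (hK y)
    rintro x ⟨hx, hxy⟩
    exact (hRS x y).2 ⟨i, hx, hxy⟩
  choose T hT hTinj hTS using hcov
  obtain ⟨_⟩ := nonempty_encodable (ι × ℕ)
  -- Each related pair `(x, y)` is kept only for the first index that produces it. Sums over indices
  -- then count every pair once.
  set A : ι × ℕ → Set X := fun j => T j.1 j.2 \
    ⋃ l : ι × ℕ, ⋃ _ : Encodable.encode l < Encodable.encode j,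
      T l.1 l.2 ∩ {x | g l.1 x = g j.1 x} with hA
  have hAm : ∀ j, MeasurableSet (A j) := fun j =>
    (hT _ _).diff (MeasurableSet.iUnion fun l => MeasurableSet.iUnion fun _ =>
      (hT _ _).inter (measurableSet_eq_fun (hg _) (hg _)))
  have hAT : ∀ j, A j ⊆ T j.1 j.2 := fun j => Set.sdiff_subset
  have hAR : ∀ j, ∀ x ∈ A j, R x (g j.1 x) := by
    intro j x hx
    refine (hRS _ _).2 ⟨j.1, ?_, rfl⟩
    rw [hTS]
    exact Set.mem_iUnion.2 ⟨_, hAT j hx⟩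
  have hAinj : ∀ j, Set.InjOn (g j.1) (A j) := fun j => (hTinj _ _).mono (hAT j)
  have hAdisj : ∀ j l x, x ∈ A j → x ∈ A l → g j.1 x = g l.1 x → j = l := by
    intro j l x hj hl h
    rcases lt_trichotomy (Encodable.encode j) (Encodable.encode l) with hlt | heq | hlt
    · refine absurd ?_ hl.2
      exact Set.mem_iUnion.2 ⟨j, Set.mem_iUnion.2 ⟨hlt, hAT j hj, h⟩⟩
    · exact Encodable.encode_injective heq
    · refine absurd ?_ hj.2
      exact Set.mem_iUnion.2 ⟨l, Set.mem_iUnion.2 ⟨hlt, hAT l hl, h.symm⟩⟩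
  have hAex : ∀ x y, R x y → ∃ j, x ∈ A j ∧ g j.1 x = y := by
    intro x y hxy
    obtain ⟨i, hi, hiy⟩ := (hRS x y).1 hxy
    rw [hTS] at hi
    obtain ⟨n, hn⟩ := Set.mem_iUnion.1 hi
    have hex : ∃ m : ℕ, ∃ j : ι × ℕ, Encodable.encode j = m ∧ x ∈ T j.1 j.2 ∧ g j.1 x = y :=
      ⟨_, (i, n), rfl, hn, hiy⟩
    classical
    obtain ⟨j, hjm, hjx, hjy⟩ := Nat.find_spec hex
    refine ⟨j, ⟨hjx, ?_⟩, hjy⟩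
    intro hmem
    obtain ⟨l, hl⟩ := Set.mem_iUnion.1 hmem
    obtain ⟨hlt, hlx, hly⟩ := Set.mem_iUnion.1 hl
    rw [hjm] at hlt
    exact Nat.find_min hex hlt ⟨l, rfl, hlx, (show g l.1 x = g j.1 x from hly).trans hjy⟩
  have hkm : ∀ j, Measurable ((A j).indicator fun x => ENNReal.ofReal (ρ x (g j.1 x))) :=
    fun j => hρ.measurable_indicator (hAm j) (hg _) fun x hx => hF _ _ (hAR j x hx)
  have hIm : ∀ j, MeasurableSet (g j.1 '' A j) := fun j =>
    (hAm j).image_of_measurable_injOn (hg _) (hAinj j)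
  have hNm : ∀ j, Measurable ((g j.1 '' A j).indicator fun _ => (1 : ENNReal)) :=
    fun j => measurable_const.indicator (hIm j)
  -- Outgoing and incoming mass, written as countable sums over the indices and hence Borel. The
  -- defining identity of the cocycle, applied on each `A j`, shows that their integrals agree.
  refine ⟨fun x => ∑' j, (A j).indicator (fun x => ENNReal.ofReal (ρ x (g j.1 x))) x,
    fun y => ∑' j, (g j.1 '' A j).indicator (fun _ => (1 : ENNReal)) y,
    Measurable.tsum hkm, Measurable.tsum hNm, ?_, ?_, ?_⟩
  · intro x
    choose j hj hjy using fun y : {y // R x y} => hAex x y.1 y.2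
    have hjinj : Function.Injective j := by
      intro y y' h
      apply Subtype.ext
      rw [← hjy, ← hjy, h]
    refine le_trans (le_of_eq ?_) (ENNReal.tsum_comp_le_tsum_of_injective hjinj _)
    refine tsum_congr fun y => ?_
    rw [Set.indicator_of_mem (hj y), hjy]
  · intro y
    have h1 : ∑' j, (g j.1 '' A j).indicator (fun _ => (1 : ENNReal)) y =
        ∑' _ : {j | y ∈ g j.1 '' A j}, (1 : ENNReal) := by
      rw [tsum_subtype {j | y ∈ g j.1 '' A j} fun _ => (1 : ENNReal)]
      rfl
    simp only [h1, ENNReal.tsum_set_one]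
    rw [ENat.toENNReal_le]
    choose x hx hxy using fun j : {j | y ∈ g j.1 '' A j} => j.2
    refine Function.Embedding.encard_le ⟨fun j => ⟨x j, ?_⟩, ?_⟩
    · have := hAR j _ (hx j)
      rwa [hxy j] at this
    · intro j l hjl
      have hjl : x j = x l := congrArg Subtype.val hjl
      refine Subtype.ext (hAdisj j l (x j) (hx j) (hjl ▸ hx l) ?_)
      rw [hxy j, hjl, hxy l]
  · rw [lintegral_tsum fun j => (hkm j).aemeasurable, lintegral_tsum fun j => (hNm j).aemeasurable]
    refine (tsum_congr fun j => ?_).le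
    rw [lintegral_indicator (hAm j), lintegral_indicator (hIm j), setLIntegral_one]
    exact (hρ.transport _ _ (hAm j) (hg _) (hAinj j) fun x hx => hF _ _ (hAR j x hx)).symm

/-- Where `g ∘ h` is injective, so is `h`, and `g` is injective on the image. -/
lemma ScalesMeasure.comp {g h : X → X} {r s : ENNReal} (hg : ScalesMeasure ν g r)
    (hh : ScalesMeasure ν h s) (hm : Measurable h) : ScalesMeasure ν (g ∘ h) (r * s) := by
  intro C hC hinj
  have h1 : Set.InjOn h C := fun x hx y hy hxy => hinj hx hy (congrArg g hxy)
  have h2 : Set.InjOn g (h '' C) := by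
    rintro _ ⟨x, hx, rfl⟩ _ ⟨y, hy, rfl⟩ hxy
    exact congrArg h (hinj hx hy hxy)
  rw [Set.image_comp, mul_assoc]
  exact (hg _ (hC.image_of_measurable_injOn hm h1) h2).trans (mul_le_mul_right (hh _ hC h1) _)

/-- On a piece where `g` is injective, the integral of `ρ x (g x)` over any Borel set `s` is `ν (g
'' s) ≤ r * ν s`. Passing through the measure gives bounds along compositions without the
multiplicativity of `ρ`, which is not part of `IsRadonNikodymCocycle`. -/
lemma ScalesMeasure.ae_le [SigmaFinite ν] (hρ : IsRadonNikodymCocycle F ν ρ) {g : X → X}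
    {r : ENNReal} (h : ScalesMeasure ν g r) (hg : Measurable g) (hF : ∀ x, F x (g x)) {K : ℕ}
    (hK : ∀ y, {x | g x = y}.encard ≤ K) : ∀ᵐ x ∂ν, ENNReal.ofReal (ρ x (g x)) ≤ r := by
  obtain ⟨S, hS, hinj, hSu⟩ := exists_injOn_cover hg K Set.univ MeasurableSet.univ fun y => by
    simpa using hK y
  have hm : Measurable fun x => ENNReal.ofReal (ρ x (g x)) := by
    simpa using hρ.measurable_indicator MeasurableSet.univ hg fun x _ => hF x
  rw [← Measure.restrict_univ (μ := ν), hSu, ae_restrict_iUnion_iff]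
  intro n
  refine ae_le_of_forall_setLIntegral_le_of_sigmaFinite hm fun s hs _ => ?_
  rw [Measure.restrict_restrict hs, setLIntegral_const,
    ← hρ.transport _ _ (hs.inter (hS n)) hg ((hinj n).mono Set.inter_subset_right) fun x _ => hF x]
  exact h _ (hs.inter (hS n)) ((hinj n).mono Set.inter_subset_right)

end Relation

/-! ### Borel maps given by a partial coloring -/

section ColorMaps

variable {V : Type*} {G : SimpleGraph V} {k : ℕ} {c : G.edgeSet → Option (Fin k)}

open Classical in
/-- The edge of color `a` at the vertex `v`, and the edge `e` if there is no such edge. -/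
noncomputable def colorEdge (c : G.edgeSet → Option (Fin k)) (a : Fin k) (e : G.edgeSet) (v : V) :
    G.edgeSet := if h : ∃ f : G.edgeSet, v ∈ f.1 ∧ c f = some a then h.choose else e

lemma colorEdge_eq (hc : IsProper c) {a : Fin k} (e : G.edgeSet) {f : G.edgeSet} {v : V}
    (hv : v ∈ f.1) (hf : c f = some a) : colorEdge c a e v = f := by
  have h : ∃ f : G.edgeSet, v ∈ f.1 ∧ c f = some a := ⟨f, hv, hf⟩
  rw [colorEdge, dif_pos h]
  exact hc.eq_of_color h.choose_spec.1 hv h.choose_spec.2 hf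

lemma colorEdge_of_missing {a : Fin k} (e : G.edgeSet) {v : V} (h : a ∈ missing c v) :
    colorEdge c a e v = e := by
  rw [colorEdge, dif_neg]
  rintro ⟨f, hf, hfa⟩
  exact h f hf hfa

lemma mem_colorEdge {a : Fin k} {e : G.edgeSet} {v : V} (hv : v ∈ e.1) :
    v ∈ (colorEdge c a e v).1 := by
  rw [colorEdge]
  split_ifs with h
  · exact h.choose_spec.1
  · exact hv

lemma reachable_of_mem {e f : G.edgeSet} {v : V} (he : v ∈ e.1) (hf : v ∈ f.1) :
    G.lineGraph.Reachable e f := by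
  by_cases h : e = f
  · rw [h]
  · exact (SimpleGraph.lineGraph_adj_iff_exists.2 ⟨h, v, he, hf⟩ : G.lineGraph.Adj e f).reachable

variable [MeasurableSpace V] [StandardBorelSpace V]

/-- The two vertices of an edge. -/
noncomputable def endpoint (b : Bool) (e : G.edgeSet) : V :=
  bif b then maxVertex e.1 else minVertex e.1

lemma endpoint_mem (b : Bool) (e : G.edgeSet) : endpoint b e ∈ e.1 := by
  have h := mk_minVertex_maxVertex e.1
  cases b
  · exact h.subst (motive := fun t => minVertex e.1 ∈ t) (Sym2.mem_mk_left _ _)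
  · exact h.subst (motive := fun t => maxVertex e.1 ∈ t) (Sym2.mem_mk_right _ _)

lemma mem_edge_iff {e : G.edgeSet} {v : V} : v ∈ e.1 ↔ ∃ b, endpoint b e = v := by
  constructor
  · intro h
    rw [← mk_minVertex_maxVertex e.1, Sym2.mem_iff] at h
    rcases h with h | h
    · exact ⟨false, h.symm⟩
    · exact ⟨true, h.symm⟩
  · rintro ⟨b, rfl⟩
    exact endpoint_mem b e

lemma edge_eq_endpoint (b : Bool) (e : G.edgeSet) : e.1 = s(endpoint b e, endpoint (!b) e) := by
  have h := mk_minVertex_maxVertex e.1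
  cases b
  · exact h.symm
  · exact h.symm.trans Sym2.eq_swap

lemma measurable_endpoint (b : Bool) : Measurable (endpoint b : G.edgeSet → V) := by
  cases b
  · exact measurable_minVertex.comp measurable_subtype_coe
  · exact measurable_maxVertex.comp measurable_subtype_coe

section

variable [StandardBorelSpace G.edgeSet]

/-- A vertex has at most one edge of a given color, so `endpoint b` is injective on `T`, and the
Lusin–Souslin theorem applies. The other measurability statements for colors rest on this. -/
lemma measurableSet_image_endpoint (hc : IsProper c) {a : Fin k} {T : Set G.edgeSet}
    (hT : MeasurableSet T) (hTa : ∀ e ∈ T, c e = some a) (b : Bool) :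
    MeasurableSet (endpoint b '' T) := by
  refine hT.image_of_measurable_injOn (measurable_endpoint b) ?_
  intro e he f hf hef
  exact hc.eq_of_color (endpoint_mem b e) (hef ▸ endpoint_mem b f) (hTa e he) (hTa f hf)

lemma measurableSet_incident (hc : IsProper c) {a : Fin k} {T : Set G.edgeSet}
    (hT : MeasurableSet T) (hTa : ∀ e ∈ T, c e = some a) :
    MeasurableSet {v | ∃ e ∈ T, v ∈ e.1} := by
  have h : {v | ∃ e ∈ T, v ∈ e.1} = ⋃ b, endpoint b '' T := by
    ext v
    simp only [Set.mem_ofPred_eq, Set.mem_iUnion, Set.mem_image, mem_edge_iff]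
    exact ⟨fun ⟨e, he, b, hb⟩ => ⟨b, e, he, hb⟩, fun ⟨b, e, he, hb⟩ => ⟨e, he, b, hb⟩⟩
  rw [h]
  exact MeasurableSet.iUnion fun b => measurableSet_image_endpoint hc hT hTa b

lemma measurableSet_missing (hc : IsPartialColoring c) (a : Fin k) :
    MeasurableSet {v | a ∈ missing c v} := by
  have h : {v | a ∈ missing c v} = {v | ∃ e ∈ {e | c e = some a}, v ∈ e.1}ᶜ := by
    ext v
    rw [Set.mem_compl_iff, Set.mem_ofPred_eq, Set.mem_ofPred_eq, iff_not_comm, notMem_missing_iff]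
    exact ⟨fun ⟨e, he, hv⟩ => ⟨e, hv, he⟩, fun ⟨e, he, hv⟩ => ⟨e, hv, he⟩⟩
  rw [h]
  exact (measurableSet_incident hc.proper (hc.measurable a) fun e he => he).compl

lemma measurable_colorNbr (hc : IsPartialColoring c) (a : Fin k) : Measurable (colorNbr c a) := by
  intro B hB
  have h : colorNbr c a ⁻¹' B = ({v | a ∈ missing c v} ∩ B) ∪
      ⋃ b, endpoint b '' ({e | c e = some a} ∩ endpoint (!b) ⁻¹' B) := by
    ext v
    simp only [Set.mem_preimage, Set.mem_union, Set.mem_inter_iff, Set.mem_ofPred_eq,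
      Set.mem_iUnion, Set.mem_image]
    by_cases hv : a ∈ missing c v
    · have h1 : colorNbr c a v = v := by
        rw [colorNbr, dif_neg]
        rintro ⟨w, e, he, hea⟩
        exact hv e (by rw [he]; exact Sym2.mem_mk_left _ _) hea
      rw [h1]
      constructor
      · exact fun h => Or.inl ⟨hv, h⟩
      · rintro (h | ⟨b, e, ⟨hea, -⟩, rfl⟩)
        · exact h.2
        · exact absurd hea (hv e (endpoint_mem b e))
    · constructor
      · intro h
        obtain ⟨e, he, hea⟩ := exists_colorNbr hv
        obtain ⟨b, hb⟩ := mem_edge_iff.1 (show v ∈ e.1 by rw [he]; exact Sym2.mem_mk_left _ _)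
        refine Or.inr ⟨b, e, ⟨hea, ?_⟩, hb⟩
        rw [edge_eq_endpoint b e, hb, Sym2.congr_right] at he
        rwa [he]
      · rintro (h | ⟨b, e, ⟨hea, heB⟩, rfl⟩)
        · exact absurd h.1 hv
        · rwa [colorNbr_eq hc.proper (edge_eq_endpoint b e) hea]
  rw [h]
  refine ((measurableSet_missing hc a).inter hB).union (MeasurableSet.iUnion fun b => ?_)
  exact measurableSet_image_endpoint hc.proper
    ((hc.measurable a).inter (measurable_endpoint _ hB)) (fun e he => he.1) b

lemma measurable_pathVertex (hc : IsPartialColoring c) (a b : Fin k) (n : ℕ) :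
    Measurable fun z => pathVertex c z a b n := by
  induction n with
  | zero => exact measurable_id
  | succ n ih => exact (measurable_colorNbr hc _).comp ih

lemma measurableSet_pathValid (hc : IsPartialColoring c) (a b : Fin k) (n : ℕ) :
    MeasurableSet {z | PathValid c z a b n} := by
  have h : {z | PathValid c z a b n} = ⋂ j, ⋂ _ : j < n,
      (fun z => pathVertex c z a b j) ⁻¹' {v | altColor a b j ∈ missing c v}ᶜ := by
    ext z
    simp [PathValid]
  rw [h]
  exact MeasurableSet.iInter fun j => MeasurableSet.iInter fun _ =>
    measurable_pathVertex hc a b j (measurableSet_missing hc _).compl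

end

lemma measurable_colorEdge [StandardBorelSpace G.edgeSet] {X : Type*} [MeasurableSpace X]
    (hc : IsPartialColoring c) (a : Fin k) {f : X → G.edgeSet} {g : X → V} (hf : Measurable f)
    (hg : Measurable g) : Measurable fun x => colorEdge c a (f x) (g x) := by
  intro B hB
  have h : (fun x => colorEdge c a (f x) (g x)) ⁻¹' B =
      (g ⁻¹' {v | a ∈ missing c v} ∩ f ⁻¹' B) ∪
        g ⁻¹' {v | ∃ e ∈ {e | c e = some a} ∩ B, v ∈ e.1} := by
    ext x
    simp only [Set.mem_preimage, Set.mem_union, Set.mem_inter_iff, Set.mem_ofPred_eq]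
    by_cases hv : a ∈ missing c (g x)
    · rw [colorEdge_of_missing _ hv]
      constructor
      · exact fun h => Or.inl ⟨hv, h⟩
      · rintro (h | ⟨e, ⟨hea, -⟩, hv'⟩)
        · exact h.2
        · exact absurd hea (hv e hv')
    · obtain ⟨e, he, hea⟩ := notMem_missing_iff.1 hv
      rw [colorEdge_eq hc.proper _ he hea]
      constructor
      · exact fun h => Or.inr ⟨e, ⟨hea, h⟩, he⟩
      · rintro (h | ⟨e', ⟨hea', heB⟩, hv'⟩)
        · exact absurd h.1 hv
        · rwa [hc.proper.eq_of_color he hv' hea hea']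
  rw [h]
  exact ((hg (measurableSet_missing hc a)).inter (hf hB)).union
    (hg (measurableSet_incident hc.proper ((hc.measurable a).inter hB) fun e he => he.1))

/-- The composition of the maps that lead from an edge to the edge of a prescribed color at a
prescribed endpoint. -/
noncomputable def wordMap (c : G.edgeSet → Option (Fin k)) :
    List (Bool × Fin k) → G.edgeSet → G.edgeSet
  | [], e => e
  | l :: w, e => colorEdge c l.2 (wordMap c w e) (endpoint l.1 (wordMap c w e))

lemma wordMap_cons (l : Bool × Fin k) (w : List (Bool × Fin k)) :
    wordMap c (l :: w) = (fun e => colorEdge c l.2 e (endpoint l.1 e)) ∘ wordMap c w := rfl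

lemma measurable_wordMap [StandardBorelSpace G.edgeSet] (hc : IsPartialColoring c)
    (w : List (Bool × Fin k)) : Measurable (wordMap c w) := by
  induction w with
  | nil => exact measurable_id
  | cons l w ih => exact measurable_colorEdge hc _ ih ((measurable_endpoint _).comp ih)

lemma reachable_wordMap (w : List (Bool × Fin k)) (e : G.edgeSet) :
    G.lineGraph.Reachable e (wordMap c w e) := by
  induction w with
  | nil => exact SimpleGraph.Reachable.refl _
  | cons l w ih =>
    exact ih.trans (reachable_of_mem (endpoint_mem l.1 _) (mem_colorEdge (endpoint_mem l.1 _)))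

/-- A preimage of `f` under one letter contains one of the two vertices of `f`. Bounded fibers are
needed to cut the word maps into injective pieces. -/
lemma encard_wordMap_le {d : ℕ} (hd : ∀ v, {e : G.edgeSet | v ∈ e.1}.encard ≤ d)
    (w : List (Bool × Fin k)) (f : G.edgeSet) :
    {e | wordMap c w e = f}.encard ≤ ((2 * d) ^ w.length : ℕ) := by
  induction w generalizing f with
  | nil =>
    have h : {e | wordMap c [] e = f} = {f} := by
      ext e
      rfl
    rw [h, Set.encard_singleton]
    simp
  | cons l w ih =>
    have h : {e | colorEdge c l.2 e (endpoint l.1 e) = f}.encard ≤ (2 * d : ℕ) := by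
      refine le_trans (Set.encard_le_encard ?_) (encard_biUnion_le
        (s := Set.univ) (f := fun b : Bool => {e : G.edgeSet | endpoint b f ∈ e.1}) (m := 2)
        (n := d) (by rw [Set.encard_univ, ENat.card_eq_coe_fintype_card, Fintype.card_bool]) fun b _ => hd _)
      intro e he
      have h1 : endpoint l.1 e ∈ f.1 := by
        have := mem_colorEdge (c := c) (a := l.2) (endpoint_mem l.1 e)
        rwa [show colorEdge c l.2 e (endpoint l.1 e) = f from he] at this
      obtain ⟨b, hb⟩ := mem_edge_iff.1 h1
      refine Set.mem_iUnion₂.2 ⟨b, trivial, ?_⟩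
      change endpoint b f ∈ e.1
      rw [hb]
      exact endpoint_mem _ _
    rw [List.length_cons, pow_succ']
    refine le_trans (Set.encard_le_encard ?_) (encard_biUnion_le h fun g _ => ih g)
    intro e he
    exact Set.mem_iUnion₂.2 ⟨wordMap c w e, he, rfl⟩

variable {ν : Measure G.edgeSet} {ρ : G.edgeSet → G.edgeSet → ℝ} {D : ℕ}

/-- A letter fixes an edge or sends it to an adjacent one. On the moved part the density is at most
`D`; on the fixed part the letter is the identity, and `1 ≤ D`. -/
lemma scalesMeasure_wordMap [StandardBorelSpace G.edgeSet] (hc : IsPartialColoring c)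
    (hρ : IsRadonNikodymCocycle G.lineGraph.Reachable ν ρ) (hD : 1 ≤ D)
    (hbound : ∀ e f, G.lineGraph.Adj e f → ρ e f ≤ D) (w : List (Bool × Fin k)) :
    ScalesMeasure ν (wordMap c w) ((D : ENNReal) ^ w.length) := by
  induction w with
  | nil =>
    rw [List.length_nil, pow_zero]
    exact scalesMeasure_id
  | cons l w ih =>
    rw [wordMap_cons, List.length_cons, pow_succ']
    refine ScalesMeasure.comp ?_ ih (measurable_wordMap hc w)
    set g : G.edgeSet → G.edgeSet := fun e => colorEdge c l.2 e (endpoint l.1 e) with hg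
    have hgm : Measurable g := measurable_colorEdge hc _ measurable_id (measurable_endpoint _)
    intro C hC hinj
    have hS : MeasurableSet {e | g e = e} := measurableSet_eq_fun hgm measurable_id
    have h1 : g '' C = (C ∩ {e | g e = e}) ∪ g '' (C \ {e | g e = e}) := by
      conv_lhs => rw [← Set.inter_union_sdiff C {e | g e = e}]
      rw [Set.image_union]
      congr 1
      ext e
      constructor
      · rintro ⟨f, hf, rfl⟩
        rwa [show g f = f from hf.2]
      · intro he
        exact ⟨e, he, he.2⟩
    have hF : ∀ e, G.lineGraph.Reachable e (g e) := fun e =>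
      reachable_of_mem (endpoint_mem l.1 e) (mem_colorEdge (endpoint_mem l.1 e))
    have h2 : ν (g '' (C \ {e | g e = e})) ≤ D * ν (C \ {e | g e = e}) := by
      rw [hρ.transport _ g (hC.diff hS) hgm (hinj.mono Set.sdiff_subset) fun e _ => hF e,
        ← setLIntegral_const]
      refine setLIntegral_mono measurable_const fun e he => ?_
      have hadj : G.lineGraph.Adj e (g e) := SimpleGraph.lineGraph_adj_iff_exists.2
        ⟨fun h => he.2 h.symm, _, endpoint_mem l.1 e, mem_colorEdge (endpoint_mem l.1 e)⟩
      refine (ENNReal.ofReal_le_ofReal (hbound _ _ hadj)).trans ?_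
      rw [ENNReal.ofReal_natCast]
    have hD' : (1 : ENNReal) ≤ D := by exact_mod_cast hD
    calc ν (g '' C) ≤ ν (C ∩ {e | g e = e}) + ν (g '' (C \ {e | g e = e})) :=
        h1 ▸ measure_union_le _ _
      _ ≤ D * ν (C ∩ {e | g e = e}) + D * ν (C \ {e | g e = e}) :=
        add_le_add (le_mul_of_one_le_left' hD') h2
      _ = D * ν C := by rw [← mul_add, measure_inter_add_sdiff C hS]

/-- There are only countably many words, so one null set serves for all of them. -/
lemma ae_wordMap_le [StandardBorelSpace G.edgeSet] [SigmaFinite ν] (hc : IsPartialColoring c)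
    (hρ : IsRadonNikodymCocycle G.lineGraph.Reachable ν ρ) (hD : 1 ≤ D)
    (hbound : ∀ e f, G.lineGraph.Adj e f → ρ e f ≤ D) {d : ℕ}
    (hd : ∀ v, {e : G.edgeSet | v ∈ e.1}.encard ≤ d) :
    ∀ᵐ e ∂ν, ∀ w : List (Bool × Fin k),
      ENNReal.ofReal (ρ e (wordMap c w e)) ≤ (D : ENNReal) ^ w.length := by
  rw [ae_all_iff]
  intro w
  exact (scalesMeasure_wordMap hc hρ hD hbound w).ae_le hρ (measurable_wordMap hc w)
    (reachable_wordMap w) (encard_wordMap_le hd w)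

/-- The edges of a shiftable chain are images of its first edge under the maps `wordMap`. -/
lemma exists_wordMap (hc : IsProper c) {P : EdgeSeq G} (hP : IsShiftable c P) {e : G.edgeSet}
    (he : P.get? 0 = some e) (j : ℕ) (f : G.edgeSet) (hf : P.get? j = some f) :
    ∃ w : List (Bool × Fin k), w.length = j ∧ wordMap c w e = f := by
  induction j generalizing f with
  | zero => exact ⟨[], rfl, Option.some_injective _ (he.symm.trans hf)⟩
  | succ j ih =>
    obtain ⟨g, hg⟩ : ∃ g, P.get? j = some g := by
      rw [← Option.ne_none_iff_exists']
      intro h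
      exact Option.some_ne_none f (hf.symm.trans (P.2 h))
    obtain ⟨w, hw, hwg⟩ := ih g hg
    obtain ⟨v, hvg, hvf⟩ := hP.chain j g f hg hf
    obtain ⟨κ, hκ⟩ := Option.ne_none_iff_exists'.1 (hP.rest j f hf)
    obtain ⟨b, hb⟩ := mem_edge_iff.1 hvg
    refine ⟨(b, κ) :: w, by simp [hw], ?_⟩
    rw [wordMap_cons, Function.comp_apply, hwg]
    exact colorEdge_eq hc g (hb ▸ hvf) hκ

lemma sum_pow_le_pow {D : ℕ} (hD : 2 ≤ D) (n : ℕ) : ∑ j ∈ Finset.range n, D ^ j ≤ D ^ n := by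
  induction n with
  | zero => simp
  | succ n ih =>
    rw [Finset.sum_range_succ, pow_succ]
    nlinarith [Nat.zero_le (D ^ n)]

/-- The edge at position `i` is the image of `e` under a word of length `i`, so the weight is at
most a geometric sum. -/
lemma chainWeight_ofList_le (hc : IsProper c) (hD : 2 ≤ D) {e : G.edgeSet} {φ : G.edgeSet → ENNReal}
    (hφ : ∀ w : List (Bool × Fin k), φ (wordMap c w e) ≤ (D : ENNReal) ^ w.length)
    {A : List G.edgeSet} (hA : IsShiftable c (Stream'.Seq.ofList A)) (he : A.head? = some e) :
    chainWeight φ (Stream'.Seq.ofList A) ≤ (D : ENNReal) ^ A.length := by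
  have he' : (Stream'.Seq.ofList A).get? 0 = some e := by
    rw [Stream'.Seq.ofList_get?, ← List.head?_eq_getElem?, he]
  have hex : ∀ f : {f // f ∈ Stream'.Seq.ofList A}, ∃ j : Fin A.length, A[j] = f.1 := by
    rintro ⟨f, hf⟩
    obtain ⟨j, hj⟩ := Stream'.Seq.mem_iff_exists_get?.1 hf
    rw [Stream'.Seq.ofList_get?] at hj
    obtain ⟨hlt, hj⟩ := List.getElem?_eq_some_iff.1 hj.symm
    exact ⟨⟨j, hlt⟩, hj⟩
  choose j hj using hex
  have hjinj : Function.Injective j := by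
    intro f g h
    apply Subtype.ext
    rw [← hj, ← hj, h]
  calc chainWeight φ (Stream'.Seq.ofList A) = ∑' f : {f // f ∈ Stream'.Seq.ofList A}, φ A[j f] :=
        tsum_congr fun f => by rw [hj]
    _ ≤ ∑' i : Fin A.length, φ A[i] :=
        ENNReal.tsum_comp_le_tsum_of_injective hjinj fun i : Fin A.length => φ A[i]
    _ ≤ ∑' i : Fin A.length, (D : ENNReal) ^ (i : ℕ) := by
        refine ENNReal.tsum_le_tsum fun i => ?_
        obtain ⟨w, hw, hwf⟩ := exists_wordMap hc hA he' i A[i] (by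
          rw [Stream'.Seq.ofList_get?]
          exact List.getElem?_eq_getElem i.2)
        rw [← hwf, ← hw]
        exact hφ w
    _ = ((∑ i ∈ Finset.range A.length, D ^ i : ℕ) : ENNReal) := by
        rw [tsum_fintype, Fin.sum_univ_eq_sum_range fun i => (D : ENNReal) ^ i]
        push_cast
        rfl
    _ ≤ (D : ENNReal) ^ A.length := by exact_mod_cast sum_pow_le_pow hD _

/-- If no improvement of weight `L` exists, then almost every uncolored edge has only heavy 3-step
Vizing chains. -/
lemma ae_isHeavy [StandardBorelSpace G.edgeSet] [SigmaFinite ν] {d L : ℕ}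
    {c : G.edgeSet → Option (Fin (d + 1))} (hc : IsPartialColoring c)
    (hρ : IsRadonNikodymCocycle G.lineGraph.Reachable ν ρ) (hD : 2 ≤ D)
    (hbound : ∀ e f, G.lineGraph.Adj e f → ρ e f ≤ D)
    (hd : ∀ v, (G.neighborSet v).encard ≤ d) (himp : AdmitsNoImprovement ν ρ c L) :
    ∀ᵐ e ∂ν, e ∈ uncolored c → IsHeavy c e (fun f => ENNReal.ofReal (ρ e f)) L D := by
  have h : ∀ᵐ e ∂ν, ¬ (e ∈ uncolored c ∧ ∃ W, IsThreeStepVizingChain c e W ∧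
      ∑' f : {f // f ∈ W}, ENNReal.ofReal (ρ e f.1) ≤ (L : ENNReal)) :=
    measure_eq_zero_iff_ae_notMem.1 himp
  filter_upwards [h, ae_wordMap_le hc hρ (by omega) hbound (encard_edges_le hd)] with e h1 h2 he
  refine ⟨he, ?_, fun A hA hhead => chainWeight_ofList_le hc.proper hD h2 hA hhead⟩
  intro W hW
  by_contra hlt
  exact h1 ⟨he, W, hW, not_lt.1 hlt⟩

end ColorMaps

/-! ### Borel structure of the steps -/

section Steps

variable {V : Type*} {G : SimpleGraph V} {d : ℕ} {c : G.edgeSet → Option (Fin (d + 1))}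

lemma reachable_colorNbr (a : Fin (d + 1)) (v : V) : G.Reachable v (colorNbr c a v) := by
  by_cases h : a ∈ missing c v
  · rw [colorNbr, dif_neg]
    rintro ⟨w, e, he, hea⟩
    exact h e (by rw [he]; exact Sym2.mem_mk_left _ _) hea
  · obtain ⟨e, he, -⟩ := exists_colorNbr h
    have := e.2
    rw [he] at this
    exact (this : G.Adj _ _).reachable

lemma reachable_pathVertex (z : V) (a b : Fin (d + 1)) (n : ℕ) :
    G.Reachable z (pathVertex c z a b n) := by
  induction n with
  | zero => exact SimpleGraph.Reachable.refl _
  | succ n ih => exact ih.trans (reachable_colorNbr _ _)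

lemma Step.reachable {y v : V} {n : ℕ} (h : Step c y n v) : G.Reachable y v := by
  obtain ⟨z, hz, a, b, -, -, -, rfl⟩ := h
  exact hz.adj.reachable.trans (reachable_pathVertex z a b n)

lemma reachable_of_mem_of_mem (e : G.edgeSet) {v w : V} (hv : v ∈ e.1) (hw : w ∈ e.1) :
    G.Reachable v w := by
  obtain ⟨u, hu⟩ := hv
  rw [hu, Sym2.mem_iff] at hw
  rcases hw with rfl | rfl
  · exact SimpleGraph.Reachable.refl _
  · have := e.2
    rw [hu] at this
    exact (this : G.Adj _ _).reachable

lemma lineGraph_reachable_of_reachable {e f : G.edgeSet} {v w : V} (hv : v ∈ e.1) (hw : w ∈ f.1)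
    (h : G.Reachable v w) : G.lineGraph.Reachable e f := by
  obtain ⟨p⟩ := h
  induction p generalizing e with
  | nil => exact reachable_of_mem hv hw
  | @cons u u' _ hadj p ih =>
    have h1 : G.lineGraph.Reachable e ⟨s(u, u'), hadj⟩ :=
      reachable_of_mem hv (Sym2.mem_mk_left _ _)
    exact h1.trans (ih (Sym2.mem_mk_right _ _) hw)

lemma ChainStep.reachable {n₁ n₂ : ℕ} {e f : G.edgeSet} (h : ChainStep c n₁ n₂ e f) :
    G.lineGraph.Reachable e f := by
  obtain ⟨y₂, y₃, ⟨y₁, z₁, hy₁, hz₁, a, b, -, -, -, rfl⟩, h₂, z₃, a', b', n, hz₃, -, -, hv, rfl⟩ := h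
  refine lineGraph_reachable_of_reachable (v := y₁) (w := pathVertex c z₃ a' b' n) hy₁
    (by rw [pathEdge_val]; exact Sym2.mem_mk_left _ _) ?_
  have h1 : G.Reachable y₁ z₁ := by
    rcases hz₁ with hz₁ | hz₁
    · exact hz₁.adj.reachable
    · exact reachable_of_mem_of_mem e hy₁ (by rw [hz₁]; exact Sym2.mem_mk_right _ _)
  exact (h1.trans (reachable_pathVertex _ _ _ _)).trans
    (h₂.reachable.trans (hz₃.adj.reachable.trans (reachable_pathVertex _ _ _ _)))

variable [MeasurableSpace V] [StandardBorelSpace V]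

lemma isCountablyFunctional_mem : IsCountablyFunctional fun (e : G.edgeSet) (v : V) => v ∈ e.1 :=
  (IsCountablyFunctional.exists_of_countable fun b : Bool =>
    IsCountablyFunctional.of_measurable (measurable_endpoint b) MeasurableSet.univ).congr
      fun e v => by simp [mem_edge_iff]

variable [StandardBorelSpace G.edgeSet]

lemma isCountablyFunctional_coloredAdj (hc : IsPartialColoring c) :
    IsCountablyFunctional (ColoredAdj c) := by
  refine (IsCountablyFunctional.exists_of_countable fun a : Fin (d + 1) =>
    IsCountablyFunctional.of_measurable (measurable_colorNbr hc a)
      (measurableSet_missing hc a).compl).congr fun y z => ?_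
  constructor
  · rintro ⟨e, he, hce⟩
    obtain ⟨a, ha⟩ := Option.ne_none_iff_exists'.1 hce
    refine ⟨a, ?_, colorNbr_eq hc.proper he ha⟩
    exact notMem_missing_iff.2 ⟨e, by rw [he]; exact Sym2.mem_mk_left _ _, ha⟩
  · rintro ⟨a, ha, rfl⟩
    obtain ⟨e, he, hea⟩ := exists_colorNbr (c := c) (a := a) (v := y) ha
    exact ⟨e, he, by simp [hea]⟩

lemma isCountablyFunctional_pathStep (hc : IsPartialColoring c) (n : ℕ) :
    IsCountablyFunctional fun z v => PathStep c z n v := by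
  refine (IsCountablyFunctional.exists_of_countable
    fun p : {p : Fin (d + 1) × Fin (d + 1) // p.1 ≠ p.2} =>
    IsCountablyFunctional.of_measurable (measurable_pathVertex hc p.1.1 p.1.2 n)
      ((measurableSet_missing hc p.1.2).inter (measurableSet_pathValid hc p.1.1 p.1.2 n))).congr
      fun z v => ?_
  constructor
  · rintro ⟨a, b, hab, hb, hv, h⟩
    exact ⟨⟨(a, b), hab⟩, ⟨hb, hv⟩, h⟩
  · rintro ⟨⟨⟨a, b⟩, hab⟩, ⟨hb, hv⟩, h⟩
    exact ⟨a, b, hab, hb, hv, h⟩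

lemma isCountablyFunctional_step (hc : IsPartialColoring c) (n : ℕ) :
    IsCountablyFunctional fun y v => Step c y n v :=
  (isCountablyFunctional_coloredAdj hc).comp (isCountablyFunctional_pathStep hc n)

lemma isCountablyFunctional_startStep (hc : IsPartialColoring c) (n : ℕ) :
    IsCountablyFunctional fun e v => StartStep c e n v := by
  refine ((((isCountablyFunctional_mem (G := G)).comp (isCountablyFunctional_coloredAdj hc)).or
    isCountablyFunctional_mem).comp (isCountablyFunctional_pathStep hc n)).congr fun e v => ?_
  constructor
  · rintro ⟨y, z, hy, hz, h⟩
    refine ⟨z, ?_, h⟩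
    rcases hz with hz | hz
    · exact Or.inl ⟨y, hy, hz⟩
    · exact Or.inr (by rw [hz]; exact Sym2.mem_mk_right _ _)
  · rintro ⟨z, ⟨y, hy, hz⟩ | ⟨y, hz⟩, h⟩
    · exact ⟨y, z, hy, Or.inl hz, h⟩
    · have hz' : e.1 = s(y, z) := hz.trans Sym2.eq_swap
      exact ⟨y, z, by rw [hz']; exact Sym2.mem_mk_left _ _, Or.inr hz', h⟩

lemma isCountablyFunctional_edgeStep [Nonempty G.edgeSet] (hc : IsPartialColoring c) :
    IsCountablyFunctional fun y f => EdgeStep c y f := by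
  -- Only a default value for `colorEdge`; on the Borel sets below the required color is present and
  -- `e₀` is not taken.
  obtain ⟨e₀⟩ := ‹Nonempty G.edgeSet›
  have h := IsCountablyFunctional.exists_of_countable
    fun p : {p : Fin (d + 1) × Fin (d + 1) // p.1 ≠ p.2} × ℕ =>
    IsCountablyFunctional.of_measurable (g := fun z => colorEdge c (altColor p.1.1.1 p.1.1.2 p.2) e₀
        (pathVertex c z p.1.1.1 p.1.1.2 p.2))
      (measurable_colorEdge hc _ measurable_const
        (measurable_pathVertex hc p.1.1.1 p.1.1.2 p.2))
      ((measurableSet_missing hc p.1.1.2).inter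
        (measurableSet_pathValid hc p.1.1.1 p.1.1.2 (p.2 + 1)))
  have key : ∀ {z : V} {a b : Fin (d + 1)} {n : ℕ} (h : PathValid c z a b (n + 1)),
      colorEdge c (altColor a b n) e₀ (pathVertex c z a b n) = pathEdge h := fun h =>
    colorEdge_eq hc.proper e₀ (by rw [pathEdge_val]; exact Sym2.mem_mk_left _ _) (color_pathEdge h)
  refine ((isCountablyFunctional_coloredAdj hc).comp h).congr fun y f => ?_
  constructor
  · rintro ⟨z, a, b, n, hz, hab, hb, hv, rfl⟩
    exact ⟨z, hz, ⟨⟨(a, b), hab⟩, n⟩, ⟨hb, hv⟩, key hv⟩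
  · rintro ⟨z, hz, ⟨⟨⟨a, b⟩, hab⟩, n⟩, ⟨hb, hv⟩, rfl⟩
    exact ⟨z, a, b, n, hz, hab, hb, hv, key hv⟩

lemma isCountablyFunctional_chainStep [Nonempty G.edgeSet] (hc : IsPartialColoring c)
    (n₁ n₂ : ℕ) : IsCountablyFunctional fun e f => ChainStep c n₁ n₂ e f := by
  refine (((isCountablyFunctional_startStep hc (n₁ + 2)).comp
    (isCountablyFunctional_step hc (n₂ + 2))).comp
    (isCountablyFunctional_edgeStep hc)).congr fun e f => ?_
  constructor
  · rintro ⟨y₂, y₃, h₁, h₂, h₃⟩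
    exact ⟨y₃, ⟨y₂, h₁, h₂⟩, h₃⟩
  · rintro ⟨y₃, ⟨y₂, h₁, h₂⟩, h₃⟩
    exact ⟨y₂, y₃, h₁, h₂, h₃⟩

end Steps

/-! ### The measure of the set of uncolored edges -/

section Conclusion

lemma sum_encard_le {ι α : Type*} (A : ι → Set α) (s : Finset ι) :
    ∑ i ∈ s, (A i).encard ≤ {p : ι × α | p.2 ∈ A p.1}.encard := by
  classical
  have key : ∑ i ∈ s, (A i).encard = {p : ι × α | p.1 ∈ s ∧ p.2 ∈ A p.1}.encard := by
    induction s using Finset.induction_on with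
    | empty => simp
    | insert i s hi ih =>
      have h : {p : ι × α | p.1 ∈ insert i s ∧ p.2 ∈ A p.1} =
          Prod.mk i '' A i ∪ {p : ι × α | p.1 ∈ s ∧ p.2 ∈ A p.1} := by
        ext ⟨j, x⟩
        simp only [Finset.mem_insert, Set.mem_ofPred_eq, Set.mem_union, Set.mem_image,
          Prod.mk.injEq]
        constructor
        · rintro ⟨rfl | hj, hx⟩
          · exact Or.inl ⟨x, hx, rfl, rfl⟩
          · exact Or.inr ⟨hj, hx⟩
        · rintro (⟨x, hx, rfl, rfl⟩ | ⟨hj, hx⟩)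
          · exact ⟨Or.inl rfl, hx⟩
          · exact ⟨Or.inr hj, hx⟩
      rw [Finset.sum_insert hi, h, Set.encard_union_eq, ih,
        (Prod.mk_right_injective i).encard_image]
      rw [Set.disjoint_left]
      rintro _ ⟨x, -, rfl⟩ hx
      exact hi hx.1
  rw [key]
  exact Set.encard_le_encard fun p hp => hp.2

variable {V : Type*} {G : SimpleGraph V} {d : ℕ} {c : G.edgeSet → Option (Fin (d + 1))}

lemma sum_encard_chainStep_le (hc : IsProper c) (hd : ∀ v, (G.neighborSet v).encard ≤ d)
    (s : Finset (ℕ × ℕ)) (f : G.edgeSet) :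
    ∑ p ∈ s, {e | ChainStep c p.1 p.2 e f}.encard ≤
      (stepBound d * (stepBound d * (stepBound d * d)) : ℕ) :=
  (sum_encard_le (fun p : ℕ × ℕ => {e | ChainStep c p.1 p.2 e f}) s).trans
    (encard_chainStep_le hc hd f)

/-- Summed over all positions, the weight of the edges that are reached from an uncolored edge
without light 3-step Vizing chains is large. -/
lemma IsHeavy.le_sum {e : G.edgeSet} {φ : G.edgeSet → ENNReal} {L D T M₁ M₂ : ℕ}
    (H : IsHeavy c e φ L D) (hc : IsProper c) (hd : ∀ v, (G.neighborSet v).encard ≤ d)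
    (hD : 1 ≤ D) (hT : 2 * D ^ T ≤ L) (hlen : 3 * d + M₁ + M₂ + 10 ≤ T)
    (h₁ : 2 * badBound d d ≤ M₁) (h₂ : 2 * badBound d (M₁ + 2 * d + 2) ≤ M₂) :
    (M₁ : ENNReal) * M₂ * L ≤ 8 * ∑ p ∈ Finset.range M₁ ×ˢ Finset.range M₂,
      ∑' f : {f // ChainStep c p.1 p.2 e f}, φ f := by
  obtain ⟨S₁, hS₁, hcard₁, hS⟩ := H.exists_positions hc hd hD hT hlen
  -- By `h₁` at least half of the positions are suitable. The factor `8` comes from this, from the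
  -- same loss for the second path, and from the half of `L` carried by the third.
  have hM₁ : (M₁ : ENNReal) ≤ 2 * S₁.card := by
    have : M₁ ≤ 2 * S₁.card := by omega
    exact_mod_cast this
  have hrow : ∀ n₁ ∈ S₁, (M₂ : ENNReal) * L ≤ 4 * ∑ n₂ ∈ Finset.range M₂,
      ∑' f : {f // ChainStep c n₁ n₂ e f}, φ f := by
    intro n₁ hn₁
    obtain ⟨S₂, hS₂, hcard₂, hS₂L⟩ := hS n₁ hn₁
    have hM₂ : (M₂ : ENNReal) ≤ 2 * S₂.card := by
      have : M₂ ≤ 2 * S₂.card := by omega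
      exact_mod_cast this
    calc (M₂ : ENNReal) * L ≤ 2 * S₂.card * L := by gcongr
      _ = 2 * ∑ _ ∈ S₂, (L : ENNReal) := by rw [Finset.sum_const, nsmul_eq_mul, mul_assoc]
      _ ≤ 2 * ∑ n₂ ∈ S₂, 2 * ∑' f : {f // ChainStep c n₁ n₂ e f}, φ f := by
        gcongr with n₂ hn₂
        exact hS₂L n₂ hn₂
      _ = 4 * ∑ n₂ ∈ S₂, ∑' f : {f // ChainStep c n₁ n₂ e f}, φ f := by
        rw [← Finset.mul_sum, ← mul_assoc]
        norm_num
      _ ≤ _ := by gcongr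
  calc (M₁ : ENNReal) * M₂ * L ≤ 2 * S₁.card * M₂ * L := by gcongr
    _ = 2 * ∑ _ ∈ S₁, (M₂ : ENNReal) * L := by rw [Finset.sum_const, nsmul_eq_mul]; ring
    _ ≤ 2 * ∑ n₁ ∈ S₁, 4 * ∑ n₂ ∈ Finset.range M₂,
        ∑' f : {f // ChainStep c n₁ n₂ e f}, φ f := by
      refine mul_le_mul_right (Finset.sum_le_sum fun n₁ hn₁ => ?_) _
      exact hrow n₁ hn₁
    _ = 8 * ∑ n₁ ∈ S₁, ∑ n₂ ∈ Finset.range M₂,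
        ∑' f : {f // ChainStep c n₁ n₂ e f}, φ f := by
      rw [← Finset.mul_sum, ← mul_assoc]
      norm_num
    _ ≤ 8 * ∑ n₁ ∈ Finset.range M₁, ∑ n₂ ∈ Finset.range M₂,
        ∑' f : {f // ChainStep c n₁ n₂ e f}, φ f := by gcongr
    _ = _ := by rw [Finset.sum_product]

variable [MeasurableSpace V]

lemma measurableSet_uncolored {k : ℕ} {c : G.edgeSet → Option (Fin k)} (hc : IsPartialColoring c) :
    MeasurableSet (uncolored c) := by
  have h : uncolored c = (⋃ a, {e | c e = some a})ᶜ := by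
    ext e
    simp only [uncolored, Set.mem_ofPred_eq, Set.mem_compl_iff, Set.mem_iUnion, not_exists]
    rw [Option.eq_none_iff_forall_ne_some]
  rw [h]
  exact (MeasurableSet.iUnion fun a => hc.measurable a).compl

variable [StandardBorelSpace V] [StandardBorelSpace G.edgeSet] {ν : Measure G.edgeSet}
  {ρ : G.edgeSet → G.edgeSet → ℝ}

/-- Double counting: mass at least `M₁ M₂ L / 8` leaves almost every uncolored edge, and the
incoming mass of any edge is a number of triples bounded independently of `M₁` and `M₂`. -/
lemma measure_uncolored_le [IsProbabilityMeasure ν] (hc : IsPartialColoring c)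
    (hρ : IsRadonNikodymCocycle G.lineGraph.Reachable ν ρ)
    (hd : ∀ v, (G.neighborSet v).encard ≤ d) {L D T M₁ M₂ : ℕ} (hD : 2 ≤ D)
    (hbound : ∀ e f, G.lineGraph.Adj e f → ρ e f ≤ D) (himp : AdmitsNoImprovement ν ρ c L)
    (hT : 2 * D ^ T ≤ L) (hlen : 3 * d + M₁ + M₂ + 10 ≤ T)
    (h₁ : 2 * badBound d d ≤ M₁) (h₂ : 2 * badBound d (M₁ + 2 * d + 2) ≤ M₂) :
    (M₁ : ENNReal) * M₂ * L * ν (uncolored c) ≤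
      8 * (stepBound d * (stepBound d * (stepBound d * d)) : ℕ) := by
  have : Nonempty G.edgeSet := nonempty_of_isProbabilityMeasure ν
  set P := Finset.range M₁ ×ˢ Finset.range M₂ with hP
  have htr := fun p : ℕ × ℕ => hρ.exists_transport (isCountablyFunctional_chainStep hc p.1 p.2)
    (fun _ _ h => h.reachable) (K := stepBound d * (stepBound d * (stepBound d * d))) fun f => by
      simpa using sum_encard_chainStep_le hc.proper hd {p} f
  choose k N hk hN hkle hNle hkN using htr
  have hae : ∀ᵐ e ∂ν, e ∈ uncolored c →
      (M₁ : ENNReal) * M₂ * L ≤ 8 * ∑ p ∈ P, k p e := by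
    filter_upwards [ae_isHeavy hc hρ hD hbound hd himp] with e he hU
    refine ((he hU).le_sum hc.proper hd (by omega) hT hlen h₁ h₂).trans ?_
    gcongr with p hp
    exact hkle p e
  calc (M₁ : ENNReal) * M₂ * L * ν (uncolored c)
      = ∫⁻ _ in uncolored c, (M₁ : ENNReal) * M₂ * L ∂ν := (setLIntegral_const _ _).symm
    _ ≤ ∫⁻ e in uncolored c, 8 * ∑ p ∈ P, k p e ∂ν :=
      lintegral_mono_ae ((ae_restrict_iff' (measurableSet_uncolored hc)).2 hae)
    _ ≤ ∫⁻ e, 8 * ∑ p ∈ P, k p e ∂ν := setLIntegral_le_lintegral _ _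
    _ = 8 * ∑ p ∈ P, ∫⁻ e, k p e ∂ν := by
      rw [lintegral_const_mul _ (Finset.measurable_fun_sum _ fun p _ => hk p),
        lintegral_finsetSum _ fun p _ => hk p]
    _ ≤ 8 * ∑ p ∈ P, ∫⁻ f, N p f ∂ν := by
      exact mul_le_mul_right (Finset.sum_le_sum fun p _ => hkN p) _
    _ = 8 * ∫⁻ f, ∑ p ∈ P, N p f ∂ν := by rw [lintegral_finsetSum _ fun p _ => hN p]
    _ ≤ 8 * ∫⁻ _, ((stepBound d * (stepBound d * (stepBound d * d)) : ℕ) : ENNReal) ∂ν := by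
      gcongr with f
      calc ∑ p ∈ P, N p f ≤ ∑ p ∈ P, ({e | ChainStep c p.1 p.2 e f}.encard : ENNReal) :=
            Finset.sum_le_sum fun p _ => hNle p f
        _ = ((∑ p ∈ P, {e | ChainStep c p.1 p.2 e f}.encard : ℕ∞) : ENNReal) :=
            (map_sum ENat.toENNRealRingHom _ _).symm
        _ ≤ _ := by
            rw [← ENat.toENNReal_coe, ENat.toENNReal_le]
            exact sum_encard_chainStep_le hc.proper hd P f
    _ = _ := by rw [lintegral_const, measure_univ, mul_one]

/-! ### Numerical estimates and the choice of the parameters -/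

lemma stepBound_le (hd : 1 ≤ d) : stepBound d ≤ 4 * d ^ 3 := by
  unfold stepBound
  nlinarith [Nat.mul_le_mul_right (2 * d * d) hd]

lemma badBound_le (hd : 1 ≤ d) {l : ℕ} (hl : d ≤ l) : badBound d l ≤ 13 * l * d ^ 3 := by
  have h1 := Nat.mul_le_mul_left (2 * l) (stepBound_le hd)
  have h2 : l * 1 ≤ l * d ^ 3 := Nat.mul_le_mul_left l (Nat.one_le_pow _ _ hd)
  have h3 : l * d ≤ l * d ^ 3 := Nat.mul_le_mul_left l (Nat.le_self_pow (by norm_num) d)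
  unfold badBound
  nlinarith

/-- Here `T = ⌊x⌋ - 1`, and `q` will be `M₁`. The factor `512` leaves room in `T` for `M₁ = q`, `M₂
= 200 d³ q` and the fans; `520` absorbs the rounding; `100 d⁴ ≤ q` dominates the unsuitable centers
on the first path. -/
lemma exists_scale (hd : 1 ≤ d) {x : ℝ} (hx : (8 * (d : ℝ)) ^ 20 ≤ x) :
    ∃ T q : ℕ, (T : ℝ) + 1 ≤ x ∧ x ≤ 520 * d ^ 3 * q ∧ 512 * d ^ 3 * q ≤ T ∧ 100 * d ^ 4 ≤ q := by
  have hd' : (1 : ℝ) ≤ d := by exact_mod_cast hd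
  have hbig : 51202 * (d : ℝ) ^ 7 ≤ x := by
    refine le_trans ?_ hx
    rw [mul_pow]
    have : (d : ℝ) ^ 7 ≤ (d : ℝ) ^ 20 := pow_le_pow_right₀ hd' (by norm_num)
    nlinarith [pow_nonneg (zero_le_one.trans hd') 20]
  have hd7 : (1 : ℝ) ≤ (d : ℝ) ^ 7 := one_le_pow₀ hd'
  have hx0 : 0 ≤ x := by linarith
  set t := ⌊x⌋₊ with ht
  have ht1 : (t : ℝ) ≤ x := Nat.floor_le hx0
  have ht2 : x < t + 1 := Nat.lt_floor_add_one x
  have htN : 51200 * d ^ 7 + 1 ≤ t := by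
    have : ((51200 * d ^ 7 + 1 : ℕ) : ℝ) < t + 1 := by
      push_cast
      linarith
    exact_mod_cast Nat.lt_succ_iff.1 (by exact_mod_cast this)
  have hpos : 0 < 512 * d ^ 3 := by positivity
  have hq : 100 * d ^ 4 ≤ (t - 1) / (512 * d ^ 3) := by
    rw [Nat.le_div_iff_mul_le hpos]
    have : 100 * d ^ 4 * (512 * d ^ 3) = 51200 * d ^ 7 := by ring
    omega
  refine ⟨t - 1, (t - 1) / (512 * d ^ 3), ?_, ?_, Nat.mul_div_le _ _, hq⟩
  · have : ((t - 1 : ℕ) : ℝ) + 1 = t := by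
      rw [← Nat.cast_add_one, Nat.sub_add_cancel (by omega)]
    rw [this]
    exact ht1
  · set q := (t - 1) / (512 * d ^ 3)
    have h1 : t - 1 < 512 * d ^ 3 * (q + 1) := Nat.lt_mul_div_succ _ hpos
    have h2 : t + 1 ≤ 520 * d ^ 3 * q := by
      have h3 : 1 ≤ d ^ 3 := Nat.one_le_pow _ _ hd
      have h4 : 100 ≤ q := le_trans (by nlinarith [Nat.one_le_pow 4 d hd]) hq
      have h5 := Nat.mul_le_mul_left (d ^ 3) h4
      have h6 : 512 * d ^ 3 * (q + 1) = 512 * (d ^ 3 * q) + 512 * d ^ 3 := by ring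
      have h7 : 520 * d ^ 3 * q = 520 * (d ^ 3 * q) := by ring
      omega
    have h2' : ((t + 1 : ℕ) : ℝ) ≤ (520 * d ^ 3 * q : ℕ) := by exact_mod_cast h2
    push_cast at h2'
    linarith

end Conclusion

end MeasurableVizing

theorem theorem6p1 {V : Type*} [MeasurableSpace V] [StandardBorelSpace V]
    (G : SimpleGraph V) (hG : MeasurableSet G.edgeSet)
    (Δ : ℕ) (hΔ : IsMaxDegree G Δ)
    (ν : Measure G.edgeSet) [IsProbabilityMeasure ν]
    (hν : IsQuasiInvariant G.lineGraph.Reachable ν)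
    (ρ : G.edgeSet → G.edgeSet → ℝ)
    (hρ : IsRadonNikodymCocycle G.lineGraph.Reachable ν ρ)
    (hbound : ∀ e f, G.lineGraph.Adj e f → ρ e f ≤ 8 * (Δ : ℝ))
    (c : G.edgeSet → Option (Fin (Δ + 1))) (hc : IsPartialColoring c)
    (L : ℕ) (hL : (8 * (Δ : ℝ)) ^ 20 ≤ Real.logb (8 * (Δ : ℝ)) (L : ℝ))
    (himp : AdmitsNoImprovement ν ρ c L) :
    ν.real (uncolored c) ≤
      64 * (4 * (Δ : ℝ)) ^ 7 * (Nat.factorial Δ : ℝ) ^ 14 /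
        (Real.logb (8 * (Δ : ℝ)) (L : ℝ) ^ 2 * (L : ℝ)) := by
  have := hG.standardBorel
  have hd : ∀ v, (G.neighborSet v).encard ≤ Δ := hΔ.1
  obtain ⟨e₀⟩ : Nonempty G.edgeSet := nonempty_of_isProbabilityMeasure ν
  have hΔ1 : 1 ≤ Δ := by
    by_contra h0
    have h1 := encard_edges_le hd (endpoint true e₀)
    rw [show Δ = 0 by omega, Nat.cast_zero, nonpos_iff_eq_zero, Set.encard_eq_zero] at h1
    exact Set.eq_empty_iff_forall_notMem.1 h1 e₀ (endpoint_mem true e₀)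
  have hΔ' : (1 : ℝ) ≤ Δ := by exact_mod_cast hΔ1
  set x := Real.logb (8 * (Δ : ℝ)) (L : ℝ) with hx
  obtain ⟨T, q, hTx, hxq, hqT, hq⟩ := exists_scale hΔ1 hL
  have hxpos : 0 < x := lt_of_lt_of_le (by positivity) hL
  have hLpos : (0 : ℝ) < L := by
    rcases Nat.eq_zero_or_pos L with h | h
    · rw [hx, h, Nat.cast_zero, Real.logb_zero] at hxpos
      exact absurd hxpos (lt_irrefl _)
    · exact_mod_cast h
  -- The spare factor `8Δ ≥ 2` from `T + 1 ≤ x` pays for the `2`.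
  have hT : 2 * (8 * Δ) ^ T ≤ L := by
    have h1 : ((8 * (Δ : ℝ)) ^ (T + 1 : ℕ)) ≤ L := by
      rw [← Real.rpow_natCast, ← Real.le_logb_iff_rpow_le (by linarith) hLpos]
      push_cast
      exact hTx
    have h2 : (8 * Δ) ^ (T + 1) ≤ L := by exact_mod_cast h1
    rw [pow_succ'] at h2
    exact (Nat.mul_le_mul_right _ (by omega)).trans h2
  have hΔ3 : 1 ≤ Δ ^ 3 := Nat.one_le_pow _ _ hΔ1
  have hqΔ : 100 * Δ ≤ q := (Nat.mul_le_mul_left _ (Nat.le_self_pow (by norm_num) Δ)).trans hq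
  -- The second path may start after about `q` edges, and the bound for its unsuitable centers is of
  -- order `Δ³ q`; hence `M₂` is larger than `M₁` by a factor `200 Δ³`.
  have key := measure_uncolored_le (T := T) (M₁ := q) (M₂ := 200 * Δ ^ 3 * q) (D := 8 * Δ) hc hρ hd
    (by omega) (fun e f h => by exact_mod_cast hbound e f h) himp hT
    (by nlinarith [Nat.mul_le_mul hΔ3 (le_refl q)])
    (by
      refine (Nat.mul_le_mul_left 2 (badBound_le hΔ1 le_rfl)).trans ?_
      have h1 : 2 * (13 * Δ * Δ ^ 3) = 26 * Δ ^ 4 := by ring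
      omega)
    (by
      refine (Nat.mul_le_mul_left 2 (badBound_le hΔ1 (by omega))).trans ?_
      have h1 : 26 * (q + 2 * Δ + 2) ≤ 200 * q := by omega
      calc 2 * (13 * (q + 2 * Δ + 2) * Δ ^ 3) = 26 * (q + 2 * Δ + 2) * Δ ^ 3 := by ring
        _ ≤ 200 * q * Δ ^ 3 := Nat.mul_le_mul_right _ h1
        _ = 200 * Δ ^ 3 * q := by ring)
  have hK : stepBound Δ * (stepBound Δ * (stepBound Δ * Δ)) ≤ 64 * Δ ^ 10 := by
    have h1 := stepBound_le hΔ1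
    calc stepBound Δ * (stepBound Δ * (stepBound Δ * Δ))
        ≤ (4 * Δ ^ 3) * ((4 * Δ ^ 3) * ((4 * Δ ^ 3) * Δ)) := by gcongr
      _ = 64 * Δ ^ 10 := by ring
  have keyR : (q : ℝ) * (200 * Δ ^ 3 * q) * L * ν.real (uncolored c) ≤ 512 * Δ ^ 10 := by
    have h1 := ENNReal.toReal_mono (by finiteness) key
    rw [ENNReal.toReal_mul, ENNReal.toReal_mul, ENNReal.toReal_mul, ENNReal.toReal_mul,
      ENNReal.toReal_natCast, ENNReal.toReal_natCast, ENNReal.toReal_natCast,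
      ENNReal.toReal_natCast, ENNReal.toReal_ofNat] at h1
    have h2 : ((stepBound Δ * (stepBound Δ * (stepBound Δ * Δ)) : ℕ) : ℝ) ≤ 64 * Δ ^ 10 := by
      exact_mod_cast hK
    push_cast at h1 h2
    rw [Measure.real]
    linarith
  have hfac : (Δ : ℝ) ≤ (Nat.factorial Δ : ℝ) := by exact_mod_cast Nat.self_le_factorial Δ
  have hν0 : 0 ≤ ν.real (uncolored c) := measureReal_nonneg
  rw [le_div_iff₀ (by positivity)]
  calc ν.real (uncolored c) * (x ^ 2 * L)
      ≤ ν.real (uncolored c) * ((520 * Δ ^ 3 * q) ^ 2 * L) := by gcongr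
    -- `1352 = 520² / 200`.
    _ = 1352 * Δ ^ 3 * ((q : ℝ) * (200 * Δ ^ 3 * q) * L * ν.real (uncolored c)) := by ring
    _ ≤ 1352 * Δ ^ 3 * (512 * Δ ^ 10) := by gcongr
    _ = 692224 * (Δ : ℝ) ^ 13 := by ring
    -- `1048576 = 64 * 4 ^ 7`; the bound obtained is smaller than the stated one, and the remaining
    -- powers of `Δ` are given away.
    _ ≤ 1048576 * (Δ : ℝ) ^ 21 := by
      have : (Δ : ℝ) ^ 13 ≤ (Δ : ℝ) ^ 21 := pow_le_pow_right₀ hΔ' (by norm_num)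
      nlinarith [pow_nonneg (zero_le_one.trans hΔ') 21]
    _ = 64 * (4 * (Δ : ℝ)) ^ 7 * (Δ : ℝ) ^ 14 := by ring
    _ ≤ 64 * (4 * (Δ : ℝ)) ^ 7 * (Nat.factorial Δ : ℝ) ^ 14 := by gcongr
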